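/- **Theorem.** *Setting.* Let $\Bbbk$ be a commutative ring, $G$ a group, and $\mathcal C$ a $\Bbbk$-additive monoidal category (with $\Bbbk$-bilinear tensor product) which is pivotal: every object $X$ has a chosen dual $X^*$ with left (co)evaluations $\mathrm{ev}_X\colon X^*\otimes X\to\mathbb 1$, $\mathrm{coev}_X\colon\mathbb 1\to X\otimes X^*$ and right (co)evaluations $\widetilde{\mathrm{ev}}_X\colon X\otimes X^*\to\mathbb 1$, $\widetilde{\mathrm{coev}}_X\colon\mathbb 1\to X^*\otimes X$, such that the resulting left and right dual functors coincide as monoidal functors. Put $d_X=\mathrm{ev}_X\,\widetilde{\mathrm{coev}}_X\in\mathrm{End}(\mathbb 1)$. Associativity and unit constraints are suppressed below. Let $\mathcal C$ be $G$-graded by full $\Bbbk$-additive subcategories $(\mathcal C_\alpha)_{\alpha\in G}$ (disjoint up to zero objects): every object is a finite direct sum of objects of the $\mathcal C_\alpha$; $\mathcal C_\alpha\otimes\mathcal C_\beta\subset\mathcal C_{\alpha\beta}$; $\mathbb 1\in\mathcal C_1$; $X^*\in\mathcal C_{\alpha^{-1}}$ for $X\in\mathcal C_\alpha$; and $\mathrm{Hom}(X,Y)=0$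 for $X\in\mathcal C_\alpha$, $Y\in\mathcal C_\beta$, $\alpha\ne\beta$. Let $\mathcal E_\alpha$ be the class of $V\in\mathcal C_\alpha$ with $d_V$ invertible. Assume that $\mathcal C$ is *non-singular* (endomorphisms of $\mathbb 1$ act on every object in the same way from the left and from the right; all idempotents split; $\mathcal E_\alpha\neq\emptyset$ for all $\alpha$) and *$G$-centralizable* (for all $\alpha\in G$, $X\in\mathcal C$ the coend $\int^{Y\in\mathcal C_\alpha}Y^*\otimes X\otimes Y$ exists in $\mathcal C$). Let $\mathcal Z=\mathcal Z_G(\mathcal C)$ be the center of $\mathcal C$ relative to $\mathcal C_1$: its objects are pairs $(A,\sigma)$ with $\sigma=\{\sigma_X\colon A\otimes X\to X\otimes A\}_{X\in\mathcal C_1}$ natural, invertible, and satisfying $\sigma_{X\otimes Y}=(\mathrm{id}_X\otimes\sigma_Y)(\sigma_X\otimes\mathrm{id}_Y)$; its morphisms are the morphisms of $\mathcal C$ commuting with the half braidings; $(A,\sigma)\otimes(B,\rho)=(A\otimes B,(\sigma\otimes\mathrm{id}_B)(\mathrm{id}_A\otimes\rho))$. It is graded by the grading of the underlying objects. *The crossing.*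 Let $V\in\mathcal E_\alpha$. A functor $\varphi_V\colon\mathcal Z\to\mathcal Z$ is defined by splitting, for every $(A,\sigma)$, the idempotent $$\pi^V_{(A,\sigma)}=d_V^{-1}\,(\mathrm{ev}_V\otimes\mathrm{id})(\mathrm{id}_{V^*}\otimes\sigma_{V\otimes V^*}\otimes\mathrm{id}_V)(\mathrm{id}\otimes\widetilde{\mathrm{coev}}_V)$$ of $V^*\otimes A\otimes V$ as $\pi=qp$, $pq=\mathrm{id}$, through an object $E$, which underlies $\varphi_V(A,\sigma)$. The half braiding of $\varphi_V(A,\sigma)$ at $X$ is $d_V^{-1}(\mathrm{id}_X\otimes p)(\mathrm{ev}_V\otimes\mathrm{id})(\mathrm{id}_{V^*}\otimes\sigma_{V\otimes X\otimes V^*}\otimes\mathrm{id}_V)(\mathrm{id}\otimes\widetilde{\mathrm{coev}}_V)(q\otimes\mathrm{id}_X)$; on morphisms $\varphi_V(f)=p(\mathrm{id}_{V^*}\otimes f\otimes\mathrm{id}_V)q$; the monoidal structure is $(\varphi_V)_2=p(\mathrm{id}_{V^*\otimes A}\otimes\widetilde{\mathrm{ev}}_V\otimes\mathrm{id}_{B\otimes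 V})(q\otimes q)$ and $(\varphi_V)_0=p\,\widetilde{\mathrm{coev}}_V$. For $U,V\in\mathcal E_\alpha$ let $\delta^{U,V}\colon\varphi_V\to\varphi_U$, $$\delta^{U,V}_{(A,\sigma)}=d_V^{-1}\,p^U(\mathrm{ev}_V\otimes\mathrm{id})(\mathrm{id}_{V^*}\otimes\sigma_{V\otimes U^*}\otimes\mathrm{id}_U)(\mathrm{id}\otimes\widetilde{\mathrm{coev}}_U)q^V.$$ For $U\in\mathcal E_\alpha$, $V\in\mathcal E_\beta$, $W\in\mathcal E_{\beta\alpha}$ let $\zeta^{U,V,W}\colon\varphi_U\varphi_V\to\varphi_W$, $$\zeta^{U,V,W}_{(A,\sigma)}=d_U^{-1}d_V^{-1}\,p^W(\mathrm{ev}_U\otimes\mathrm{id})(\mathrm{id}_{U^*}\otimes\mathrm{ev}_V\otimes\mathrm{id})(\mathrm{id}_{U^*\otimes V^*}\otimes\sigma_{V\otimes U\otimes W^*}\otimes\mathrm{id}_W)(\mathrm{id}\otimes\widetilde{\mathrm{coev}}_W)(\mathrm{id}_{U^*}\otimes q^V\otimes\mathrm{id}_U)q^U,$$ and for $U\in\mathcal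 E_1$ let $\eta^U_{(A,\sigma)}=p^U(\mathrm{id}_{U^*}\otimes\sigma_U^{-1})(\widetilde{\mathrm{coev}}_U\otimes\mathrm{id}_A)\colon(A,\sigma)\to\varphi_U(A,\sigma)$. The crossing $\varphi$ of $\mathcal Z$ consists of the limits $\varphi_\alpha$ of the systems $(\varphi_V,\delta^{U,V})_{U,V\in\mathcal E_\alpha}$ of monoidal functors, with universal cones of monoidal natural isomorphisms $\iota^\alpha_V\colon\varphi_\alpha\to\varphi_V$, chosen so that $\varphi_\alpha(\mathcal Z_\beta)\subset\mathcal Z_{\alpha^{-1}\beta\alpha}$, and of the isomorphisms $\varphi_2(\alpha,\beta)\colon\varphi_\alpha\varphi_\beta\to\varphi_{\beta\alpha}$ and $\varphi_0\colon 1_{\mathcal Z}\to\varphi_1$ induced by $\zeta$ and $\eta$: $\iota^{\beta\alpha}_W\varphi_2(\alpha,\beta)=\zeta^{U,V,W}\varphi_U(\iota^\beta_V)(\iota^\alpha_U)_{\varphi_\beta}$ and $\iota^1_U\varphi_0=\eta^U$. This is a well-defined crossing: all $\varphi_\alpha$ are $\Bbbk$-linear strong monoidal auto-equivalences, and $\varphi_2,\varphi_0$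 are monoidal and make $\alpha\mapsto\varphi_\alpha$ a strong monoidal functor, with respect to $\alpha\otimes\beta=\beta\alpha$. *The free functors.* For $\alpha\in G$ let $Z_\alpha(X)=\int^{Y\in\mathcal C_\alpha}Y^*\otimes X\otimes Y$, with universal dinatural transformation $\rho^\alpha_{X,Y}\colon Y^*\otimes X\otimes Y\to Z_\alpha(X)$, $Y\in\mathcal C_\alpha$; this is a functor of $X$, and $\rho^\alpha$ is natural in $X$. Put $\partial^\alpha_{X,Y}=(\mathrm{id}_Y\otimes\rho^\alpha_{X,Y})(\mathrm{coev}_Y\otimes\mathrm{id}_{X\otimes Y})\colon X\otimes Y\to Y\otimes Z_\alpha(X)$. There are morphisms $(Z_\alpha)_2(X_1,X_2)\colon Z_\alpha(X_1\otimes X_2)\to Z_\alpha(X_1)\otimes Z_\alpha(X_2)$, $(Z_\alpha)_0\colon Z_\alpha(\mathbb 1)\to\mathbb 1$ and $Z_2(\alpha,\beta)_X\colon Z_\alpha Z_\beta(X)\to Z_{\beta\alpha}(X)$, determined by $$(\mathrm{id}_Y\otimes(Z_\alpha)_2(X_1,X_2))\,\partial^\alpha_{X_1\otimes X_2,Y}=(\partial^\alpha_{X_1,Y}\otimes\mathrm{id})(\mathrm{id}_{X_1}\otimes\partial^\alpha_{X_2,Y}),\qquad(\mathrm{id}_Y\otimes(Z_\alpha)_0)\,\partial^\alpha_{\mathbb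 1,Y}=\mathrm{id}_Y,$$ $$(\mathrm{id}_{Y'\otimes Y}\otimes Z_2(\alpha,\beta)_X)(\mathrm{id}_{Y'}\otimes\partial^\alpha_{Z_\beta(X),Y})(\partial^\beta_{X,Y'}\otimes\mathrm{id}_Y)=\partial^{\beta\alpha}_{X,Y'\otimes Y}$$ for all $Y\in\mathcal C_\alpha$, $Y'\in\mathcal C_\beta$. The $\alpha$-free functor is the comonoidal functor $\mathcal F_\alpha\colon\mathcal C\to\mathcal Z$ with $\mathcal F_\alpha(X)=(Z_\alpha(X),\sigma^\alpha_X)$, where $\sigma^\alpha_{X,Y}=(\mathrm{id}_Y\otimes Z_2(1,\alpha)_X)\,\partial^1_{Z_\alpha(X),Y}$ for $Y\in\mathcal C_1$, with $\mathcal F_\alpha(f)=Z_\alpha(f)$, $(\mathcal F_\alpha)_2=(Z_\alpha)_2$, $(\mathcal F_\alpha)_0=(Z_\alpha)_0$; all of this is well defined. *Conclusion.* Regard each $\varphi_\alpha$ as comonoidal through the inverses of its monoidal constraints. There is exactly one family of natural isomorphisms $\omega^{\alpha,\beta}\colon\varphi_\alpha\mathcal F_\beta\to\mathcal F_{\beta\alpha}$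 ($\alpha,\beta\in G$) such that for all $\alpha,\beta\in G$, $X\in\mathcal C$ and all $V\in\mathcal E_\alpha$ $$\omega^{\alpha,\beta}_X\circ(\iota^\alpha_V)^{-1}_{\mathcal F_\beta(X)}\circ p^V_{\mathcal F_\beta(X)}=d_V^{-1}\,Z_2(\alpha,\beta)_X\,\rho^\alpha_{Z_\beta(X),V}\colon\;V^*\otimes Z_\beta(X)\otimes V\to Z_{\beta\alpha}(X).$$ Every $\omega^{\alpha,\beta}$ is comonoidal. Moreover, for all $\alpha,\beta,\gamma\in G$ and $X\in\mathcal C$, $$\omega^{1,\alpha}_X=(\varphi_0)^{-1}_{\mathcal F_\alpha(X)},\qquad \omega^{\beta\alpha,\gamma}_X\circ\varphi_2(\alpha,\beta)_{\mathcal F_\gamma(X)}=\omega^{\alpha,\gamma\beta}_X\circ\varphi_\alpha(\omega^{\beta,\gamma}_X)$$ as morphisms $\varphi_1\mathcal F_\alpha(X)\to\mathcal F_\alpha(X)$ and $\varphi_\alpha\varphi_\beta\mathcal F_\gamma(X)\to\mathcal F_{\gamma\beta\alpha}(X)$, respectively. -/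

import Mathlib

open CategoryTheory MonoidalCategory Limits

universe w' w v u

noncomputable section

namespace GCat

/-! ### Pivotal categories -/

section Pivotal

/-- A chosen object `dual X = X*` for every `X`, which is both a left dual of `X`, through
`ev : X* ⊗ X ⟶ 𝟙` and `coev : 𝟙 ⟶ X ⊗ X*`, and a right dual of `X`, through
`evR : X ⊗ X* ⟶ 𝟙` and `coevR : 𝟙 ⟶ X* ⊗ X`. -/
class TwoSidedDuals (C : Type u) [Category.{v} C] [MonoidalCategory C] where
  dual : C → C
  leftPairing : ∀ X : C, ExactPairing X (dual X)
  rightPairing : ∀ X : C, ExactPairing (dual X) X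


variable {C : Type u} [Category.{v} C] [MonoidalCategory C] [TwoSidedDuals C]

/-- The dual object `X*`. -/
abbrev dual (X : C) : C := TwoSidedDuals.dual X

/-- The left evaluation. -/
def ev (X : C) : dual X ⊗ X ⟶ 𝟙_ C := (TwoSidedDuals.leftPairing X).evaluation'

/-- The left coevaluation. -/
def coev (X : C) : 𝟙_ C ⟶ X ⊗ dual X := (TwoSidedDuals.leftPairing X).coevaluation'

/-- The right evaluation. -/
def evR (X : C) : X ⊗ dual X ⟶ 𝟙_ C := (TwoSidedDuals.rightPairing X).evaluation'

/-- The right coevaluation. -/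
def coevR (X : C) : 𝟙_ C ⟶ dual X ⊗ X := (TwoSidedDuals.rightPairing X).coevaluation'

/-- The left dual functor on morphisms,
`(ev_Y ⊗ id) (id ⊗ f ⊗ id) (id ⊗ coev_X) : Y* ⟶ X*`. -/
def dualMap {X Y : C} (f : X ⟶ Y) : dual Y ⟶ dual X :=
  letI : HasRightDual X := { rightDual := dual X, exact := TwoSidedDuals.leftPairing X }
  letI : HasRightDual Y := { rightDual := dual Y, exact := TwoSidedDuals.leftPairing Y }
  rightAdjointMate f

/-- The right dual functor on morphisms,
`(id ⊗ evR_Y) (id ⊗ f ⊗ id) (coevR_X ⊗ id) : Y* ⟶ X*`. -/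
def dualMapR {X Y : C} (f : X ⟶ Y) : dual Y ⟶ dual X :=
  letI : HasLeftDual X := { leftDual := dual X, exact := TwoSidedDuals.rightPairing X }
  letI : HasLeftDual Y := { leftDual := dual Y, exact := TwoSidedDuals.rightPairing Y }
  leftAdjointMate f

theorem dualMap_id (X : C) : dualMap (𝟙 X) = 𝟙 (dual X) :=
  letI : HasRightDual X := { rightDual := dual X, exact := TwoSidedDuals.leftPairing X }
  rightAdjointMate_id

theorem dualMap_comp {X Y Z : C} (f : X ⟶ Y) (g : Y ⟶ Z) :
    dualMap (f ≫ g) = dualMap g ≫ dualMap f :=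
  letI : HasRightDual X := { rightDual := dual X, exact := TwoSidedDuals.leftPairing X }
  letI : HasRightDual Y := { rightDual := dual Y, exact := TwoSidedDuals.leftPairing Y }
  letI : HasRightDual Z := { rightDual := dual Z, exact := TwoSidedDuals.leftPairing Z }
  comp_rightAdjointMate

/-- The left monoidal constraint `X* ⊗ Y* ⟶ (Y ⊗ X)*`. -/
def dualTensor (X Y : C) : dual X ⊗ dual Y ⟶ dual (Y ⊗ X) :=
  𝟙 _ ⊗≫ (dual X ⊗ dual Y) ◁ coev (Y ⊗ X) ⊗≫
    (dual X ◁ ev Y) ▷ (X ⊗ dual (Y ⊗ X)) ⊗≫ ev X ▷ dual (Y ⊗ X) ⊗≫ 𝟙 _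

/-- The right monoidal constraint `X* ⊗ Y* ⟶ (Y ⊗ X)*`. -/
def dualTensorR (X Y : C) : dual X ⊗ dual Y ⟶ dual (Y ⊗ X) :=
  𝟙 _ ⊗≫ coevR (Y ⊗ X) ▷ (dual X ⊗ dual Y) ⊗≫
    (dual (Y ⊗ X) ⊗ Y) ◁ (evR X ▷ dual Y) ⊗≫ dual (Y ⊗ X) ◁ evR Y ⊗≫ 𝟙 _

variable (C) in
/-- The left monoidal constraint `𝟙 ⟶ 𝟙*`. -/
def dualUnit : 𝟙_ C ⟶ dual (𝟙_ C) := coev (𝟙_ C) ≫ (λ_ _).hom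

variable (C) in
/-- The right monoidal constraint `𝟙 ⟶ 𝟙*`. -/
def dualUnitR : 𝟙_ C ⟶ dual (𝟙_ C) := coevR (𝟙_ C) ≫ (ρ_ _).hom

/-- The left dimension `ev_X ∘ coevR_X` of an object, an endomorphism of the unit. -/
def leftDim (X : C) : 𝟙_ C ⟶ 𝟙_ C := coevR X ≫ ev X

end Pivotal

/-- A pivotal category: a rigid monoidal category whose left and right dual functors are equal as
monoidal functors. -/
class PivotalCategory (C : Type u) [Category.{v} C] [MonoidalCategory C] extends
    TwoSidedDuals C where
  map_eq : ∀ {X Y : C} (f : X ⟶ Y), dualMap f = dualMapR f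
  tensor_eq : ∀ X Y : C, dualTensor X Y = dualTensorR X Y
  unit_eq : dualUnit C = dualUnitR C

/-- Multiplication of a morphism by an endomorphism `s` of the unit object (on the left). -/
def scal {C : Type u} [Category.{v} C] [MonoidalCategory C] (s : 𝟙_ C ⟶ 𝟙_ C) {X Y : C}
    (f : X ⟶ Y) : X ⟶ Y :=
  (λ_ X).inv ≫ s ▷ X ≫ (λ_ X).hom ≫ f

/-- A monoidal category is pure if endomorphisms of the unit act on every object in the same way
from the left and from the right. -/
def IsPure (C : Type u) [Category.{v} C] [MonoidalCategory C] : Prop :=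
  ∀ (s : 𝟙_ C ⟶ 𝟙_ C) (X : C),
    (λ_ X).inv ≫ s ▷ X ≫ (λ_ X).hom = (ρ_ X).inv ≫ X ◁ s ≫ (ρ_ X).hom

/-! ### Graded categories -/

section Graded

variable (G : Type w) [Group G] (C : Type u) [Category.{v} C] [Preadditive C]
  [HasFiniteBiproducts C] [MonoidalCategory C]

/-- A `G`-grading of an additive monoidal category: full additive subcategories `comp α` with the
usual axioms. They are disjoint up to zero objects by `hom_eq_zero`. -/
structure GGrading where
  comp : G → ObjectProperty C
  additive : ∀ α, HasFiniteBiproducts (comp α).FullSubcategory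
  split : ∀ X : C, ∃ (s : Finset G) (Y : s → C),
    (∀ α : s, comp α (Y α)) ∧ Nonempty (X ≅ ⨁ Y)
  tensor_mem : ∀ {α β : G} {X Y : C}, comp α X → comp β Y → comp (α * β) (X ⊗ Y)
  hom_eq_zero : ∀ {α β : G} {X Y : C}, comp α X → comp β Y → α ≠ β → ∀ f : X ⟶ Y, f = 0
  unit_mem : comp 1 (𝟙_ C)

/-- A `G`-grading of a pivotal category; the chosen duals are compatible with the grading. -/
structure PivotalGrading [PivotalCategory C] extends GGrading G C where
  dual_mem : ∀ {α : G} {X : C}, comp α X → comp α⁻¹ (dual X)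

variable {G C}
variable [PivotalCategory C] (𝒢 : PivotalGrading G C)

/-- The class of objects of the component of degree `α` whose left dimension is invertible. -/
structure InvDim (α : G) where
  obj : C
  mem : 𝒢.comp α obj
  isIso : IsIso (leftDim obj)

variable {𝒢} in
/-- The inverse of the left dimension. -/
def InvDim.dInv {α : G} (V : InvDim 𝒢 α) : 𝟙_ C ⟶ 𝟙_ C :=
  haveI := V.isIso
  inv (leftDim V.obj)

/-- Non-singularity of a pivotal graded category. -/
structure NonSingular : Prop where
  pure : IsPure C
  splitIdempotents : IsIdempotentComplete C
  exists_invDim : ∀ α : G, Nonempty (InvDim 𝒢 α)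

variable {𝒢}

theorem InvDim.mem_slide {α : G} (V W : InvDim 𝒢 α) : 𝒢.comp 1 (V.obj ⊗ dual W.obj) := by
  simpa using 𝒢.tensor_mem V.mem (𝒢.dual_mem W.mem)

theorem InvDim.mem_slideX {α : G} (V W : InvDim 𝒢 α) {X : C} (hX : 𝒢.comp 1 X) :
    𝒢.comp 1 ((V.obj ⊗ X) ⊗ dual W.obj) := by
  simpa using 𝒢.tensor_mem (𝒢.tensor_mem V.mem hX) (𝒢.dual_mem W.mem)

theorem InvDim.mem_slide2 {α β γ : G} (h : β * α = γ) (U : InvDim 𝒢 α) (V : InvDim 𝒢 β)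
    (W : InvDim 𝒢 γ) : 𝒢.comp 1 ((V.obj ⊗ U.obj) ⊗ dual W.obj) := by
  subst h
  simpa using 𝒢.tensor_mem (𝒢.tensor_mem V.mem U.mem) (𝒢.dual_mem W.mem)

end Graded

/-! ### Relative centers -/

section RelCenter

variable {C : Type u} [Category.{v} C] [MonoidalCategory C]

/-- A (left) half braiding on `A` relative to the full subcategory of objects satisfying `D`. -/
structure RelHalfBraiding (D : ObjectProperty C) (A : C) where
  β : ∀ X, D X → (A ⊗ X ≅ X ⊗ A)
  monoidal : ∀ {X Y} (hX : D X) (hY : D Y) (hXY : D (X ⊗ Y)), (β (X ⊗ Y) hXY).hom =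
    (α_ _ _ _).inv ≫ (β X hX).hom ▷ Y ≫ (α_ _ _ _).hom ≫ X ◁ (β Y hY).hom ≫ (α_ _ _ _).inv
  naturality : ∀ {X Y} (hX : D X) (hY : D Y) (f : X ⟶ Y),
    A ◁ f ≫ (β Y hY).hom = (β X hX).hom ≫ f ▷ A

/-- The (left) center of `C` relative to the full subcategory `D`. -/
structure RelCenter (D : ObjectProperty C) where
  obj : C
  braiding : RelHalfBraiding D obj

namespace RelCenter

variable {D : ObjectProperty C}

/-- The half braiding `A ⊗ X ⟶ X ⊗ A`. -/
abbrev σ (A : RelCenter D) {X : C} (hX : D X) : A.obj ⊗ X ⟶ X ⊗ A.obj :=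
  (A.braiding.β X hX).hom

@[ext]
structure Hom (A B : RelCenter D) where
  f : A.obj ⟶ B.obj
  comm : ∀ {X : C} (hX : D X), f ▷ X ≫ B.σ hX = A.σ hX ≫ X ◁ f

instance : Category (RelCenter D) where
  Hom := Hom
  id A := { f := 𝟙 A.obj, comm := by simp }
  comp f g := { f := f.f ≫ g.f, comm := fun hX => by simp [g.comm, reassoc_of% f.comm hX] }

@[ext]
theorem hom_ext {A B : RelCenter D} {f g : A ⟶ B} (h : f.f = g.f) : f = g :=
  Hom.ext h


@[simp]
theorem id_f (A : RelCenter D) : Hom.f (𝟙 A) = 𝟙 A.obj := rfl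

@[simp]
theorem comp_f {A B E : RelCenter D} (f : A ⟶ B) (g : B ⟶ E) : (f ≫ g).f = f.f ≫ g.f := rfl

/-- An isomorphism of `C` which commutes with the half braidings is an isomorphism of the relative
center. -/
@[simps]
def isoOf {A B : RelCenter D} (e : A.obj ≅ B.obj)
    (h : ∀ {X : C} (hX : D X), e.hom ▷ X ≫ B.σ hX = A.σ hX ≫ X ◁ e.hom) : A ≅ B where
  hom := { f := e.hom, comm := h }
  inv := { f := e.inv
           comm := fun {X} hX => by
             rw [← cancel_epi (e.hom ▷ X), hom_inv_whiskerRight_assoc, reassoc_of% h hX,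
               whiskerLeft_hom_inv, Category.comp_id] }
  hom_inv_id := by ext; exact e.hom_inv_id
  inv_hom_id := by ext; exact e.inv_hom_id

/-- The tensor product of half braidings,
`(A, σ) ⊗ (B, ρ) = (A ⊗ B, (σ ⊗ id_B) (id_A ⊗ ρ))`. -/
def tensorObj (A B : RelCenter D) : RelCenter D where
  obj := A.obj ⊗ B.obj
  braiding :=
    { β := fun X hX =>
        α_ _ _ _ ≪≫ whiskerLeftIso A.obj (B.braiding.β X hX) ≪≫ (α_ _ _ _).symm ≪≫
          whiskerRightIso (A.braiding.β X hX) B.obj ≪≫ α_ _ _ _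
      monoidal := fun {X Y} hX hY hXY => by
        simp only [Iso.trans_hom, whiskerLeftIso_hom, Iso.symm_hom, whiskerRightIso_hom]
        rw [A.braiding.monoidal hX hY hXY, B.braiding.monoidal hX hY hXY]
        calc
          _ = 𝟙 _ ⊗≫ A.obj ◁ (B.σ hX) ▷ Y ⊗≫
              (_ ◁ (B.σ hY) ≫ (A.σ hX) ▷ _) ⊗≫ X ◁ (A.σ hY) ▷ B.obj ⊗≫ 𝟙 _ := by monoidal
          _ = _ := by rw [whisker_exchange]; monoidal
      naturality := fun {X Y} hX hY f => by
        simp only [Iso.trans_hom, whiskerLeftIso_hom, Iso.symm_hom, whiskerRightIso_hom]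
        calc
          _ = 𝟙 _ ⊗≫ (A.obj ◁ (B.obj ◁ f ≫ B.σ hY)) ⊗≫ (A.σ hY) ▷ B.obj ⊗≫ 𝟙 _ := by monoidal
          _ = 𝟙 _ ⊗≫ A.obj ◁ (B.σ hX) ⊗≫ (A.obj ◁ f ≫ A.σ hY) ▷ B.obj ⊗≫ 𝟙 _ := by
            rw [B.braiding.naturality hX hY]; monoidal
          _ = _ := by rw [A.braiding.naturality hX hY]; monoidal }

theorem tensorObj_σ (A B : RelCenter D) {X : C} (hX : D X) :
    (tensorObj A B).σ hX = (α_ _ _ _).hom ≫ A.obj ◁ B.σ hX ≫ (α_ _ _ _).inv ≫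
      A.σ hX ▷ B.obj ≫ (α_ _ _ _).hom := rfl

theorem whiskerLeft_comm (A : RelCenter D) {B₁ B₂ : RelCenter D} (f : B₁ ⟶ B₂) {X : C}
    (hX : D X) : (A.obj ◁ f.f) ▷ X ≫ (tensorObj A B₂).σ hX =
      (tensorObj A B₁).σ hX ≫ X ◁ A.obj ◁ f.f := by
  rw [tensorObj_σ, tensorObj_σ]
  change (A.obj ◁ f.f) ▷ X ≫ (α_ _ _ _).hom ≫ A.obj ◁ B₂.σ hX ≫ (α_ _ _ _).inv ≫
      A.σ hX ▷ B₂.obj ≫ (α_ X A.obj B₂.obj).hom = ((α_ A.obj B₁.obj X).hom ≫ A.obj ◁ B₁.σ hX ≫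
      (α_ _ _ _).inv ≫ A.σ hX ▷ B₁.obj ≫ (α_ _ _ _).hom) ≫ _
  calc
    _ = 𝟙 _ ⊗≫ A.obj ◁ (f.f ▷ X ≫ B₂.σ hX) ⊗≫ (A.σ hX) ▷ B₂.obj ⊗≫ 𝟙 _ := by monoidal
    _ = 𝟙 _ ⊗≫ A.obj ◁ (B₁.σ hX) ⊗≫
        ((A.obj ⊗ X) ◁ f.f ≫ (A.σ hX) ▷ B₂.obj) ⊗≫ 𝟙 _ := by
      rw [f.comm hX]; monoidal
    _ = _ := by rw [whisker_exchange]; monoidal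

theorem whiskerRight_comm {A₁ A₂ : RelCenter D} (f : A₁ ⟶ A₂) (B : RelCenter D) {X : C}
    (hX : D X) : f.f ▷ B.obj ▷ X ≫ (tensorObj A₂ B).σ hX =
      (tensorObj A₁ B).σ hX ≫ X ◁ f.f ▷ B.obj := by
  rw [tensorObj_σ, tensorObj_σ]
  change f.f ▷ B.obj ▷ X ≫ (α_ _ _ _).hom ≫ A₂.obj ◁ B.σ hX ≫ (α_ _ _ _).inv ≫
      A₂.σ hX ▷ B.obj ≫ (α_ X A₂.obj B.obj).hom = ((α_ A₁.obj B.obj X).hom ≫ A₁.obj ◁ B.σ hX ≫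
      (α_ _ _ _).inv ≫ A₁.σ hX ▷ B.obj ≫ (α_ _ _ _).hom) ≫ _
  calc
    _ = 𝟙 _ ⊗≫ (f.f ▷ (B.obj ⊗ X) ≫ A₂.obj ◁ (B.σ hX)) ⊗≫ (A₂.σ hX) ▷ B.obj ⊗≫ 𝟙 _ := by
      monoidal
    _ = 𝟙 _ ⊗≫ A₁.obj ◁ (B.σ hX) ⊗≫ (f.f ▷ X ≫ A₂.σ hX) ▷ B.obj ⊗≫ 𝟙 _ := by
      rw [← whisker_exchange]; monoidal
    _ = _ := by rw [f.comm hX]; monoidal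

/-- The unit `(𝟙, id)` of the relative center. -/
def tensorUnit : RelCenter D where
  obj := 𝟙_ C
  braiding :=
    { β := fun X _ => λ_ X ≪≫ (ρ_ X).symm
      monoidal := fun {X Y} _ _ _ => by simp
      naturality := fun {X Y} _ _ f => by simp }

theorem tensorUnit_σ {X : C} (hX : D X) :
    (tensorUnit (D := D)).σ hX = (λ_ X).hom ≫ (ρ_ X).inv := rfl

def whiskerLeft (A : RelCenter D) {B₁ B₂ : RelCenter D} (f : B₁ ⟶ B₂) :
    tensorObj A B₁ ⟶ tensorObj A B₂ where
  f := A.obj ◁ f.f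
  comm hX := whiskerLeft_comm A f hX

def whiskerRight {A₁ A₂ : RelCenter D} (f : A₁ ⟶ A₂) (B : RelCenter D) :
    tensorObj A₁ B ⟶ tensorObj A₂ B where
  f := f.f ▷ B.obj
  comm hX := whiskerRight_comm f B hX

theorem associator_comm (A B E : RelCenter D) {X : C} (hX : D X) :
    (α_ A.obj B.obj E.obj).hom ▷ X ≫ (tensorObj A (tensorObj B E)).σ hX =
      (tensorObj (tensorObj A B) E).σ hX ≫ X ◁ (α_ A.obj B.obj E.obj).hom := by
  simp only [tensorObj_σ]
  change (α_ A.obj B.obj E.obj).hom ▷ X ≫ (α_ A.obj (B.obj ⊗ E.obj) X).hom ≫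
      A.obj ◁ ((α_ _ _ _).hom ≫ B.obj ◁ E.σ hX ≫ (α_ _ _ _).inv ≫ B.σ hX ▷ E.obj ≫
        (α_ _ _ _).hom) ≫ (α_ _ _ _).inv ≫ A.σ hX ▷ (B.obj ⊗ E.obj) ≫ (α_ _ _ _).hom =
    ((α_ (A.obj ⊗ B.obj) E.obj X).hom ≫ (A.obj ⊗ B.obj) ◁ E.σ hX ≫ (α_ _ _ _).inv ≫
      ((α_ _ _ _).hom ≫ A.obj ◁ B.σ hX ≫ (α_ _ _ _).inv ≫ A.σ hX ▷ B.obj ≫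
        (α_ _ _ _).hom) ▷ E.obj ≫ (α_ _ _ _).hom) ≫ _
  monoidal

theorem leftUnitor_comm (A : RelCenter D) {X : C} (hX : D X) :
    (λ_ A.obj).hom ▷ X ≫ A.σ hX = (tensorObj tensorUnit A).σ hX ≫ X ◁ (λ_ A.obj).hom := by
  simp only [tensorObj_σ, tensorUnit_σ]
  change (λ_ A.obj).hom ▷ X ≫ A.σ hX = ((α_ (𝟙_ C) A.obj X).hom ≫ 𝟙_ C ◁ A.σ hX ≫
    (α_ _ _ _).inv ≫ ((λ_ X).hom ≫ (ρ_ X).inv) ▷ A.obj ≫ (α_ _ _ _).hom) ≫ _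
  monoidal

theorem rightUnitor_comm (A : RelCenter D) {X : C} (hX : D X) :
    (ρ_ A.obj).hom ▷ X ≫ A.σ hX = (tensorObj A tensorUnit).σ hX ≫ X ◁ (ρ_ A.obj).hom := by
  simp only [tensorObj_σ, tensorUnit_σ]
  change (ρ_ A.obj).hom ▷ X ≫ A.σ hX = ((α_ A.obj (𝟙_ C) X).hom ≫
    A.obj ◁ ((λ_ X).hom ≫ (ρ_ X).inv) ≫ (α_ _ _ _).inv ≫ A.σ hX ▷ 𝟙_ C ≫ (α_ _ _ _).hom) ≫ _
  monoidal

def associator (A B E : RelCenter D) :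
    tensorObj (tensorObj A B) E ≅ tensorObj A (tensorObj B E) :=
  isoOf (α_ A.obj B.obj E.obj) (associator_comm A B E)

def leftUnitor (A : RelCenter D) : tensorObj tensorUnit A ≅ A :=
  isoOf (λ_ A.obj) (leftUnitor_comm A)

def rightUnitor (A : RelCenter D) : tensorObj A tensorUnit ≅ A :=
  isoOf (ρ_ A.obj) (rightUnitor_comm A)

instance : MonoidalCategoryStruct (RelCenter D) where
  tensorObj := tensorObj
  whiskerLeft A _ _ f := whiskerLeft A f
  whiskerRight f B := whiskerRight f B
  tensorHom {_ B A _} f g := whiskerRight f A ≫ whiskerLeft B g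
  tensorUnit := tensorUnit
  associator := associator
  leftUnitor := leftUnitor
  rightUnitor := rightUnitor

theorem tensor_obj (A B : RelCenter D) : (A ⊗ B).obj = A.obj ⊗ B.obj := rfl

theorem unit_obj : (𝟙_ (RelCenter D)).obj = 𝟙_ C := rfl

theorem whiskerLeft_f (A : RelCenter D) {B₁ B₂ : RelCenter D} (f : B₁ ⟶ B₂) :
    (A ◁ f).f = A.obj ◁ f.f := rfl

theorem whiskerRight_f {A₁ A₂ : RelCenter D} (f : A₁ ⟶ A₂) (B : RelCenter D) :
    (f ▷ B).f = f.f ▷ B.obj := rfl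

theorem tensorHom_f {A₁ B₁ A₂ B₂ : RelCenter D} (f : A₁ ⟶ B₁) (g : A₂ ⟶ B₂) :
    (f ⊗ₘ g).f = f.f ⊗ₘ g.f := (MonoidalCategory.tensorHom_def f.f g.f).symm

instance : MonoidalCategory (RelCenter D) where
  tensorHom_def f g := rfl
  id_tensorHom_id A B := by
    ext; rw [tensorHom_f]; exact MonoidalCategory.id_tensorHom_id A.obj B.obj
  tensorHom_comp_tensorHom f₁ f₂ g₁ g₂ := by
    ext; simp only [comp_f, tensorHom_f]
    exact MonoidalCategory.tensorHom_comp_tensorHom f₁.f f₂.f g₁.f g₂.f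
  whiskerLeft_id A B := by ext; exact MonoidalCategory.whiskerLeft_id A.obj B.obj
  id_whiskerRight A B := by ext; exact MonoidalCategory.id_whiskerRight A.obj B.obj
  associator_naturality f₁ f₂ f₃ := by
    ext; simp only [comp_f, tensorHom_f]
    exact MonoidalCategory.associator_naturality f₁.f f₂.f f₃.f
  leftUnitor_naturality f := by ext; exact MonoidalCategory.leftUnitor_naturality f.f
  rightUnitor_naturality f := by ext; exact MonoidalCategory.rightUnitor_naturality f.f
  pentagon A B E F := by ext; exact MonoidalCategory.pentagon A.obj B.obj E.obj F.obj
  triangle A B := by ext; exact MonoidalCategory.triangle A.obj B.obj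

section Linear

variable {k : Type w'} [CommRing k] [Preadditive C] [MonoidalPreadditive C]

theorem f_injective {C : Type u} [Category.{v} C] [MonoidalCategory C] {D : ObjectProperty C}
    (A B : RelCenter D) : Function.Injective (fun f : A ⟶ B => f.f) :=
  fun _ _ h => hom_ext h

instance (A B : RelCenter D) : Zero (A ⟶ B) where
  zero := { f := 0, comm := fun {X} hX => by
              rw [MonoidalPreadditive.zero_whiskerRight, MonoidalPreadditive.whiskerLeft_zero,
                zero_comp, comp_zero] }

instance (A B : RelCenter D) : Add (A ⟶ B) where
  add f g := { f := f.f + g.f, comm := fun {X} hX => by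
                 rw [MonoidalPreadditive.add_whiskerRight, MonoidalPreadditive.whiskerLeft_add,
                   Preadditive.add_comp, Preadditive.comp_add, f.comm hX, g.comm hX] }

instance (A B : RelCenter D) : Neg (A ⟶ B) where
  neg f := { f := -f.f, comm := fun {X} hX => by
               have h1 : (-f.f) ▷ X = -(f.f ▷ X) := by
                 rw [eq_neg_iff_add_eq_zero, ← MonoidalPreadditive.add_whiskerRight,
                   neg_add_cancel, MonoidalPreadditive.zero_whiskerRight]
               have h2 : X ◁ (-f.f) = -(X ◁ f.f) := by
                 rw [eq_neg_iff_add_eq_zero, ← MonoidalPreadditive.whiskerLeft_add,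
                   neg_add_cancel, MonoidalPreadditive.whiskerLeft_zero]
               rw [h1, h2, Preadditive.neg_comp, Preadditive.comp_neg, f.comm hX] }

instance (A B : RelCenter D) : AddCommGroup (A ⟶ B) where
  add_assoc f g h := hom_ext (add_assoc f.f g.f h.f)
  zero_add f := hom_ext (zero_add f.f)
  add_zero f := hom_ext (add_zero f.f)
  neg_add_cancel f := hom_ext (neg_add_cancel f.f)
  add_comm f g := hom_ext (add_comm f.f g.f)
  nsmul := nsmulRec
  zsmul := zsmulRec

instance [Linear k C] [MonoidalLinear k C] (A B : RelCenter D) : SMul k (A ⟶ B) := ⟨fun r f =>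
  { f := r • f.f, comm := fun {X} hX => by
      rw [MonoidalLinear.smul_whiskerRight, MonoidalLinear.whiskerLeft_smul, Linear.smul_comp,
        Linear.comp_smul, f.comm hX] }⟩

instance : Preadditive (RelCenter D) where
  add_comp _ _ _ f g h := by ext; exact Preadditive.add_comp _ _ _ f.f g.f h.f
  comp_add _ _ _ f g h := by ext; exact Preadditive.comp_add _ _ _ f.f g.f h.f

/-- The underlying morphism, as an additive map. -/
def fHom (A B : RelCenter D) : (A ⟶ B) →+ (A.obj ⟶ B.obj) where
  toFun f := f.f
  map_zero' := rfl
  map_add' _ _ := rfl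

instance [Linear k C] [MonoidalLinear k C] : Linear k (RelCenter D) where
  homModule A B := (f_injective A B).module k (fHom A B) (fun _ _ => rfl)
  smul_comp _ _ _ r f g := by ext; exact Linear.smul_comp _ _ _ r f.f g.f
  comp_smul _ _ _ f r g := by ext; exact Linear.comp_smul _ _ _ f.f r g.f

end Linear

end RelCenter

end RelCenter

/-! ### Crossings -/

section Crossing

variable (k : Type w') [CommRing k] {G : Type w} [Group G] {E : Type u} [Category.{v} E]
  [Preadditive E] [Linear k E] [MonoidalCategory E]

/-- A crossing on a category `E` graded by the classes of objects `P α`: a strong monoidal functor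
`φ` from the discrete category on `G`, with tensor product `α ⊗ β = βα`, to the monoidal category
of `k`-linear strong monoidal auto-equivalences of `E` and monoidal natural isomorphisms, such that
`φ_α (E_β) ⊆ E_{α⁻¹βα}`.
The isomorphism `φ₂(α, β) : φ_α φ_β ⟶ φ_{βα}` is `mul α β γ h` where `γ` is equal to `β * α` by
`h`, and `φ₀` is `one`. -/
structure Crossing (P : G → ObjectProperty E) where
  functor : G → E ⥤ E
  [monoidal : ∀ α, (functor α).Monoidal]
  additive : ∀ α, (functor α).Additive
  linear : ∀ α, (functor α).Linear k
  isEquivalence : ∀ α, (functor α).IsEquivalence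
  mul : ∀ (α β γ : G), β * α = γ → (functor β ⋙ functor α ≅ functor γ)
  mul_monoidal : ∀ (α β γ : G) (h : β * α = γ), NatTrans.IsMonoidal (mul α β γ h).hom
  one : 𝟭 E ≅ functor 1
  one_monoidal : NatTrans.IsMonoidal one.hom
  assoc : ∀ (α β γ βα γβ γβα : G) (h₁ : β * α = βα) (h₂ : γ * β = γβ) (h₃ : γ * βα = γβα)
    (h₄ : γβ * α = γβα) (X : E),
    (functor α).map ((mul β γ γβ h₂).hom.app X) ≫ (mul α γβ γβα h₄).hom.app X =
      (mul α β βα h₁).hom.app ((functor γ).obj X) ≫ (mul βα γ γβα h₃).hom.app X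
  one_left : ∀ (α : G) (X : E),
    one.hom.app ((functor α).obj X) ≫ (mul 1 α α (mul_one α)).hom.app X = 𝟙 _
  one_right : ∀ (α : G) (X : E),
    (functor α).map (one.hom.app X) ≫ (mul α 1 α (one_mul α)).hom.app X = 𝟙 _
  grading : ∀ (α : G) {β : G} {X : E}, P β X → P (α⁻¹ * β * α) ((functor α).obj X)

attribute [instance] Crossing.monoidal

end Crossing

/-- A comonoidal natural transformation between comonoidal functors. -/
structure IsComonoidal {C : Type u} [Category.{v} C] [MonoidalCategory C] {E : Type w}
    [Category.{w'} E] [MonoidalCategory E] {F F' : C ⥤ E} [F.OplaxMonoidal] [F'.OplaxMonoidal]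
    (τ : F ⟶ F') : Prop where
  counit : τ.app (𝟙_ C) ≫ Functor.OplaxMonoidal.η F' = Functor.OplaxMonoidal.η F
  comul : ∀ X Y : C, τ.app (X ⊗ Y) ≫ Functor.OplaxMonoidal.δ F' X Y =
    Functor.OplaxMonoidal.δ F X Y ≫ (τ.app X ⊗ₘ τ.app Y)

/-! ### The crossing of the `G`-center -/

section Slides

variable {C : Type u} [Category.{v} C] [MonoidalCategory C] [TwoSidedDuals C]

/-- The object `V* ⊗ A ⊗ V`. -/
abbrev conjObj (V A : C) : C := (dual V ⊗ A) ⊗ V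

variable {D : ObjectProperty C} (A : RelCenter D)

/-- The morphism `V* ⊗ A ⊗ V ⟶ W* ⊗ A ⊗ W` which creates `W* ⊗ W` on the right, slides `A` across
`V ⊗ W*` by the half braiding, and annihilates `V* ⊗ V` on the left. -/
def slide (V W : C) (h : D (V ⊗ dual W)) : conjObj V A.obj ⟶ conjObj W A.obj :=
  𝟙 _ ⊗≫ ((dual V ⊗ A.obj) ⊗ V) ◁ coevR W ⊗≫ dual V ◁ A.σ h ▷ W ⊗≫
    ev V ▷ ((dual W ⊗ A.obj) ⊗ W) ⊗≫ 𝟙 _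

/-- The morphism `V* ⊗ A ⊗ V ⊗ X ⟶ X ⊗ V* ⊗ A ⊗ V` which creates `V* ⊗ V` on the right, slides `A`
across `V ⊗ X ⊗ V*`, and annihilates `V* ⊗ V` on the left. -/
def slideX (V X : C) (h : D ((V ⊗ X) ⊗ dual V)) :
    conjObj V A.obj ⊗ X ⟶ X ⊗ conjObj V A.obj :=
  𝟙 _ ⊗≫ (((dual V ⊗ A.obj) ⊗ V) ⊗ X) ◁ coevR V ⊗≫ dual V ◁ A.σ h ▷ V ⊗≫
    ev V ▷ (X ⊗ ((dual V ⊗ A.obj) ⊗ V)) ⊗≫ 𝟙 _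

/-- The morphism `U* ⊗ V* ⊗ A ⊗ V ⊗ U ⟶ W* ⊗ A ⊗ W` which creates `W* ⊗ W` on the right, slides `A`
across `V ⊗ U ⊗ W*`, and annihilates `V* ⊗ V` and then `U* ⊗ U` on the left. -/
def slide2 (U V W : C) (h : D ((V ⊗ U) ⊗ dual W)) :
    conjObj U (conjObj V A.obj) ⟶ conjObj W A.obj :=
  𝟙 _ ⊗≫ ((dual U ⊗ ((dual V ⊗ A.obj) ⊗ V)) ⊗ U) ◁ coevR W ⊗≫
    (dual U ⊗ dual V) ◁ A.σ h ▷ W ⊗≫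
    dual U ◁ ev V ▷ (U ⊗ ((dual W ⊗ A.obj) ⊗ W)) ⊗≫
    ev U ▷ ((dual W ⊗ A.obj) ⊗ W) ⊗≫ 𝟙 _

/-- The morphism `A ⟶ U* ⊗ A ⊗ U` which creates `U* ⊗ U` on the left of `A` and slides `A` across
`U` by the inverse of the half braiding. -/
def insertU (U : C) (h : D U) : A.obj ⟶ conjObj U A.obj :=
  𝟙 _ ⊗≫ coevR U ▷ A.obj ⊗≫ dual U ◁ (A.braiding.β U h).inv ⊗≫ 𝟙 _

/-- The morphism `V* ⊗ A ⊗ V ⊗ V* ⊗ B ⊗ V ⟶ V* ⊗ A ⊗ B ⊗ V` induced by `evR V`. -/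
def contract (V A B : C) : conjObj V A ⊗ conjObj V B ⟶ conjObj V (A ⊗ B) :=
  𝟙 _ ⊗≫ (dual V ⊗ A) ◁ evR V ▷ (B ⊗ V) ⊗≫ 𝟙 _

end Slides

section GCenter

variable {G : Type w} [Group G] {C : Type u} [Category.{v} C] [Preadditive C]
  [HasFiniteBiproducts C] [MonoidalCategory C] [PivotalCategory C]

/-- The `G`-center: the center of `C` relative to the neutral component. -/
abbrev ZG (𝒢 : PivotalGrading G C) := RelCenter (𝒢.comp 1)

variable {𝒢 : PivotalGrading G C}

/-- The idempotent `π^V_{(A,σ)}` of `V* ⊗ A ⊗ V`. -/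
def piV {α : G} (V : InvDim 𝒢 α) (A : ZG 𝒢) : conjObj V.obj A.obj ⟶ conjObj V.obj A.obj :=
  scal V.dInv (slide A V.obj V.obj (V.mem_slide V))

/-- The endofunctor `φ_V` of the `G`-center attached to an object `V` with invertible left
dimension: `p A` and `q A` split the idempotent `π^V_A` through the object underlying `φ_V (A)`,
and the half braiding of `φ_V (A)`, the action of `φ_V` on morphisms, and the monoidal structure
of `φ_V` are given by explicit formulas. -/
structure ConjFunctor {α : G} (V : InvDim 𝒢 α) where
  functor : ZG 𝒢 ⥤ ZG 𝒢
  [monoidal : functor.Monoidal]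
  p : ∀ A : ZG 𝒢, conjObj V.obj A.obj ⟶ (functor.obj A).obj
  q : ∀ A : ZG 𝒢, (functor.obj A).obj ⟶ conjObj V.obj A.obj
  p_q : ∀ A : ZG 𝒢, p A ≫ q A = piV V A
  q_p : ∀ A : ZG 𝒢, q A ≫ p A = 𝟙 _
  braiding : ∀ (A : ZG 𝒢) {X : C} (hX : 𝒢.comp 1 X), (functor.obj A).σ hX =
    scal V.dInv (q A ▷ X ≫ slideX A V.obj X (V.mem_slideX V hX) ≫ X ◁ p A)
  map_f : ∀ {A B : ZG 𝒢} (f : A ⟶ B),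
    (functor.map f).f = q A ≫ (dual V.obj ◁ f.f) ▷ V.obj ≫ p B
  mu_f : ∀ A B : ZG 𝒢, (Functor.LaxMonoidal.μ functor A B).f =
    (q A ⊗ₘ q B) ≫ contract V.obj A.obj B.obj ≫ p (A ⊗ B)
  epsilon_f : (Functor.LaxMonoidal.ε functor).f =
    (coevR V.obj ≫ (ρ_ (dual V.obj)).inv ▷ V.obj) ≫ p (𝟙_ (ZG 𝒢))

attribute [instance] ConjFunctor.monoidal

/-- The morphism `δ^{U,V}_A : φ_V (A) ⟶ φ_U (A)`. -/
def deltaUV {α : G} {U V : InvDim 𝒢 α} (φU : ConjFunctor U) (φV : ConjFunctor V) (A : ZG 𝒢) :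
    (φV.functor.obj A).obj ⟶ (φU.functor.obj A).obj :=
  scal V.dInv (φV.q A ≫ slide A V.obj U.obj (V.mem_slide U) ≫ φU.p A)

/-- The morphism `ζ^{U,V,W}_A : φ_U φ_V (A) ⟶ φ_W (A)`. -/
def zetaUVW {α β γ : G} (h : β * α = γ) {U : InvDim 𝒢 α} {V : InvDim 𝒢 β} {W : InvDim 𝒢 γ}
    (φU : ConjFunctor U) (φV : ConjFunctor V) (φW : ConjFunctor W) (A : ZG 𝒢) :
    (φU.functor.obj (φV.functor.obj A)).obj ⟶ (φW.functor.obj A).obj :=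
  scal U.dInv (scal V.dInv (φU.q (φV.functor.obj A) ≫ (dual U.obj ◁ φV.q A) ▷ U.obj ≫
    slide2 A U.obj V.obj W.obj (InvDim.mem_slide2 h U V W) ≫ φW.p A))

/-- The morphism `η^U_A : A ⟶ φ_U (A)`. -/
def etaU {U : InvDim 𝒢 1} (φU : ConjFunctor U) (A : ZG 𝒢) : A.obj ⟶ (φU.functor.obj A).obj :=
  insertU A U.obj U.mem ≫ φU.p A

theorem mem_tensor {α β γ : G} (h : β * α = γ) {Y' Y : C} (hY' : 𝒢.comp β Y')
    (hY : 𝒢.comp α Y) : 𝒢.comp γ (Y' ⊗ Y) := h ▸ 𝒢.tensor_mem hY' hY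

variable (k : Type w') [CommRing k] [Linear k C] [MonoidalPreadditive C] [MonoidalLinear k C]

variable (𝒢) in
/-- The canonical crossing of the `G`-center: for every `α`, the functor `φ_α` is the limit, with
universal cone `ι α V : φ_α ⟶ φ_V`, of the system of monoidal functors `φ_V` and monoidal natural
isomorphisms `δ^{U,V}`, where `U` and `V` run over the objects of degree `α` with invertible left
dimension; `φ₂` and `φ₀` are induced by the morphisms `ζ` and `η`. All morphisms of the system are
invertible and there is exactly one from each object to each other one, so that a cone is
universal if and only if it consists of isomorphisms. -/
structure CanonicalCrossing extends
    Crossing k (E := ZG 𝒢) (fun α : G => fun A : ZG 𝒢 => 𝒢.comp α A.obj) where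
  conj : ∀ {α : G} (V : InvDim 𝒢 α), ConjFunctor V
  ι : ∀ {α : G} (V : InvDim 𝒢 α), functor α ≅ (conj V).functor
  ι_monoidal : ∀ {α : G} (V : InvDim 𝒢 α), NatTrans.IsMonoidal (ι V).hom
  ι_delta : ∀ {α : G} (U V : InvDim 𝒢 α) (A : ZG 𝒢),
    ((ι V).hom.app A).f ≫ deltaUV (conj U) (conj V) A = ((ι U).hom.app A).f
  mul_ι : ∀ {α β γ : G} (h : β * α = γ) (U : InvDim 𝒢 α) (V : InvDim 𝒢 β) (W : InvDim 𝒢 γ)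
    (A : ZG 𝒢), ((mul α β γ h).hom.app A ≫ (ι W).hom.app A).f =
      ((ι U).hom.app ((functor β).obj A) ≫ (conj U).functor.map ((ι V).hom.app A)).f ≫
        zetaUVW h (conj U) (conj V) (conj W) A
  one_ι : ∀ (U : InvDim 𝒢 (1 : G)) (A : ZG 𝒢),
    (one.hom.app A ≫ (ι U).hom.app A).f = etaU (conj U) A

/-! ### Centralizers and free functors -/

variable (𝒢) in
/-- The functor `(Y, Y') ↦ Y* ⊗ X ⊗ Y'` on the component of degree `α`. -/
def coendFunctor (α : G) (X : C) :
    (𝒢.comp α).FullSubcategoryᵒᵖ ⥤ (𝒢.comp α).FullSubcategory ⥤ C where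
  obj Y :=
    { obj := fun Y' => (dual Y.unop.obj ⊗ X) ⊗ Y'.obj
      map := fun f => (dual Y.unop.obj ⊗ X) ◁ f.hom }
  map g := { app := fun Y' => (dualMap g.unop.hom ▷ X) ▷ Y'.obj
             naturality := fun _ _ f => (whisker_exchange _ _) }
  map_id Y := by ext; simp [dualMap_id]
  map_comp f g := by ext; simp [dualMap_comp]

variable (𝒢) in
/-- `C` is `G`-centralizable: for every `α` and `X`, the coend of `Y* ⊗ X ⊗ Y`, where `Y` runs over
the component of degree `α`, exists in `C`. -/
def GCentralizable : Prop :=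
  ∀ (α : G) (X : C), HasCoend (coendFunctor 𝒢 α X)

variable (𝒢) in
/-- A centralizer of degree `α`: a functor `Z : C ⥤ C` with universal dinatural transformations
`ρ X Y : Y* ⊗ X ⊗ Y ⟶ Z (X)`, where `Y` runs over the component of degree `α`, which are natural
in `X`. -/
structure Centralizer (α : G) where
  Z : C ⥤ C
  ρ : ∀ (X : C) {Y : C}, 𝒢.comp α Y → ((dual Y ⊗ X) ⊗ Y ⟶ Z.obj X)
  naturality : ∀ {X X' : C} (f : X ⟶ X') {Y : C} (hY : 𝒢.comp α Y),
    (dual Y ◁ f) ▷ Y ≫ ρ X' hY = ρ X hY ≫ Z.map f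
  dinaturality : ∀ (X : C) {Y Y' : C} (hY : 𝒢.comp α Y) (hY' : 𝒢.comp α Y') (g : Y ⟶ Y'),
    (dualMap g ▷ X) ▷ Y ≫ ρ X hY = (dual Y' ⊗ X) ◁ g ≫ ρ X hY'
  isColimit : ∀ X : C, Nonempty (IsColimit (Cowedge.mk (F := coendFunctor 𝒢 α X) (Z.obj X)
    (fun Y => ρ X Y.property) (fun Y Y' g => dinaturality X Y.property Y'.property g.hom)))

/-- The morphism `∂_{X,Y} = (id_Y ⊗ ρ_{X,Y}) (coev_Y ⊗ id) : X ⊗ Y ⟶ Y ⊗ Z (X)`. -/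
def Centralizer.del {α : G} (Z : Centralizer 𝒢 α) (X : C) {Y : C} (hY : 𝒢.comp α Y) :
    X ⊗ Y ⟶ Y ⊗ Z.Z.obj X :=
  𝟙 _ ⊗≫ coev Y ▷ (X ⊗ Y) ⊗≫ Y ◁ Z.ρ X hY

/-- For a family `Z` of centralizers of all degrees: the morphisms
`Z₂(α, β)_X : Z_α Z_β (X) ⟶ Z_{βα} (X)` (with `γ = βα`), and the half braidings
`σ^α_{X,Y} = (id_Y ⊗ Z₂(1, α)_X) ∂^1_{Z_α(X),Y}` of the objects `Z_α (X)`. -/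
structure FreeHalfBraidings (Z : ∀ α : G, Centralizer 𝒢 α) where
  Z2 : ∀ (α β γ : G), β * α = γ → ∀ X : C, (Z α).Z.obj ((Z β).Z.obj X) ⟶ (Z γ).Z.obj X
  Z2_spec : ∀ (α β γ : G) (h : β * α = γ) (X : C) {Y Y' : C} (hY : 𝒢.comp α Y)
    (hY' : 𝒢.comp β Y'),
    (𝟙 _ ⊗≫ (Z β).del X hY' ▷ Y ⊗≫ Y' ◁ (Z α).del ((Z β).Z.obj X) hY ⊗≫
      (Y' ⊗ Y) ◁ Z2 α β γ h X : X ⊗ (Y' ⊗ Y) ⟶ (Y' ⊗ Y) ⊗ (Z γ).Z.obj X) =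
      (Z γ).del X (mem_tensor h hY' hY)
  halfBraiding : ∀ (α : G) (X : C), RelHalfBraiding (𝒢.comp 1) ((Z α).Z.obj X)
  halfBraiding_spec : ∀ (α : G) (X : C) {Y : C} (hY : 𝒢.comp 1 Y),
    ((halfBraiding α X).β Y hY).hom =
      (Z 1).del ((Z α).Z.obj X) hY ≫ Y ◁ Z2 1 α α (mul_one α) X
  map_comm : ∀ (α : G) {X X' : C} (f : X ⟶ X') {Y : C} (hY : 𝒢.comp 1 Y),
    (Z α).Z.map f ▷ Y ≫ ((halfBraiding α X').β Y hY).hom =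
      ((halfBraiding α X).β Y hY).hom ≫ Y ◁ (Z α).Z.map f

/-- The functor `F_α : X ↦ (Z_α (X), σ^α_X)`. -/
def FreeHalfBraidings.functor {Z : ∀ α : G, Centralizer 𝒢 α} (F : FreeHalfBraidings Z) (α : G) :
    C ⥤ ZG 𝒢 where
  obj X := { obj := (Z α).Z.obj X, braiding := F.halfBraiding α X }
  map f := { f := (Z α).Z.map f, comm := F.map_comm α f }
  map_id X := by ext; exact (Z α).Z.map_id X
  map_comp f g := by ext; exact (Z α).Z.map_comp f g

/-- The free functors `F_α : C ⥤ Z_G(C)` associated with a family `Z` of centralizers of all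
degrees, with their comonoidal structures, given by the morphisms
`(Z_α)₂(X₁, X₂) : Z_α (X₁ ⊗ X₂) ⟶ Z_α (X₁) ⊗ Z_α (X₂)` and `(Z_α)₀ : Z_α (𝟙) ⟶ 𝟙`. -/
structure FreeFunctors (Z : ∀ α : G, Centralizer 𝒢 α) extends FreeHalfBraidings Z where
  [oplaxMonoidal : ∀ α : G, (toFreeHalfBraidings.functor α).OplaxMonoidal]
  comul_spec : ∀ (α : G) (X₁ X₂ : C) {Y : C} (hY : 𝒢.comp α Y),
    (Z α).del (X₁ ⊗ X₂) hY ≫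
      Y ◁ (Functor.OplaxMonoidal.δ (toFreeHalfBraidings.functor α) X₁ X₂).f =
    𝟙 _ ⊗≫ X₁ ◁ (Z α).del X₂ hY ⊗≫ (Z α).del X₁ hY ▷ (Z α).Z.obj X₂ ≫
      (α_ Y ((Z α).Z.obj X₁) ((Z α).Z.obj X₂)).hom
  counit_spec : ∀ (α : G) {Y : C} (hY : 𝒢.comp α Y),
    (Z α).del (𝟙_ C) hY ≫
      Y ◁ (Functor.OplaxMonoidal.η (toFreeHalfBraidings.functor α)).f = (λ_ Y).hom ≫ (ρ_ Y).inv

attribute [instance] FreeFunctors.oplaxMonoidal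

variable {k} in
/-- A family of isomorphisms `ω^{α,β} : φ_α F_β ⟶ F_{βα}` (with `γ = βα`) is canonical if its
composition with the epimorphisms `V* ⊗ Z_β (X) ⊗ V ⟶ φ_V F_β (X) ≅ φ_α F_β (X)` is equal to
`d_V⁻¹ Z₂(α, β)_X ρ^α_{Z_β (X), V}` for every object `V` of degree `α` with invertible left
dimension `d_V`. -/
def IsCanonical {Z : ∀ α : G, Centralizer 𝒢 α} (F : FreeFunctors Z)
    (φ : CanonicalCrossing 𝒢 k)
    (ω : ∀ α β γ : G, β * α = γ → (F.functor β ⋙ φ.functor α ≅ F.functor γ)) : Prop :=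
  ∀ (α β γ : G) (h : β * α = γ) (V : InvDim 𝒢 α) (X : C),
    (φ.conj V).p ((F.functor β).obj X) ≫ ((φ.ι V).inv.app ((F.functor β).obj X)).f ≫
        ((ω α β γ h).hom.app X).f =
      scal V.dInv ((Z α).ρ ((Z β).Z.obj X) V.mem ≫ F.Z2 α β γ h X)

end GCenter

end GCat

end

noncomputable section

namespace GCat

/-! ### Squares -/

section Squares

variable {C : Type u} [Category.{v} C] [MonoidalCategory C]

/-! A square over `Y` is a morphism `A ⊗ Y ⟶ Y ⊗ B`. Half braidings and the morphisms `∂` are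
squares, and duality turns the projections `p` into squares as well. Squares compose horizontally
(`hc`, tensoring the objects `Y`) and vertically (`vc`, tensoring the objects `A` and `B`). Both
sides of `ω` are characterised by natural families of squares, so that every identity reduces to
cancelling such a family.

On one side, `φ_α (A)` carries a twist: an invertible family `A ⊗ Y ⟶ Y ⊗ φ_α (A)`, for `Y` of
degree `α`, compatible with the half braiding of `A`. Given a twist `S` with values in `B` and a
compatible family `T` with values in `E`, exactly one morphism `B ⟶ E` carries `S` to `T`. Indeed
the family `S⁻¹T : Y ⊗ B ⟶ Y ⊗ E` is controlled by its value at one `V` with invertible dimension,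
because `Y ⊗ V*` has degree `1`, and the normalized partial trace over `V` extracts the morphism
(`whiskerLeft_ptr`, `exists_descent`). Moving `A` across `Y ⊗ V*` gives a twist with values in a
splitting of `π` (`isTwist_of_split`), and each explicit formula in the definition of the crossing
computes the unique morphism furnished by descent (the lemmas `split_slideX` to `split_insertU`).
Coherence of the crossing is then checked after precomposition with invertible squares.

On the other side, the coend property makes `∂^α` universal among all families with source `X`.
Hence there are quotients `∂^{βα}/∂^β`: squares `g` over `Y` whose horizontal product with `∂^β` at
`Y'` is `∂^{βα}` at `Y' ⊗ Y`. They exist by rigidity, are unique, natural and multiplicative, and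
are invertible because `∂^β/∂^{βα}` exists over the dual of `Y`. The quotient equals `Z₂(α, β) ∂^α`,
so this is a twist of degree `α` over `F_β (X)` with values in `F_{βα} (X)` (`quotient_isTwist`).

The morphism `ω` is the comparison of these two twists. Bending at `V` gives its defining formula;
its comonoidality and its two compatibilities with the crossing express identities between
quotients, such as `(∂^{γβ}/∂^γ)(∂^{γβα}/∂^{γβ}) = ∂^{γβα}/∂^γ` (`quotient_hc`). -/

/-- The horizontal composition of squares `A ⊗ Y ⟶ Y ⊗ B` and `B ⊗ Z ⟶ Z ⊗ E`. -/
def hc {A B E Y Z : C} (f : A ⊗ Y ⟶ Y ⊗ B) (g : B ⊗ Z ⟶ Z ⊗ E) : A ⊗ (Y ⊗ Z) ⟶ (Y ⊗ Z) ⊗ E :=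
  (α_ A Y Z).inv ≫ f ▷ Z ≫ (α_ Y B Z).hom ≫ Y ◁ g ≫ (α_ Y Z E).inv

/-- The vertical composition of squares `A ⊗ Y ⟶ Y ⊗ A'` and `B ⊗ Y ⟶ Y ⊗ B'`. -/
def vc {A B A' B' Y : C} (f : A ⊗ Y ⟶ Y ⊗ A') (g : B ⊗ Y ⟶ Y ⊗ B') :
    (A ⊗ B) ⊗ Y ⟶ Y ⊗ (A' ⊗ B') :=
  (α_ A B Y).hom ≫ A ◁ g ≫ (α_ A Y B').inv ≫ f ▷ B' ≫ (α_ Y A' B').hom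

/-- The unit for the vertical composition. -/
def vu (Y : C) : 𝟙_ C ⊗ Y ⟶ Y ⊗ 𝟙_ C := (λ_ Y).hom ≫ (ρ_ Y).inv

/-- The unit for the horizontal composition. -/
def hu (A : C) : A ⊗ 𝟙_ C ⟶ 𝟙_ C ⊗ A := (ρ_ A).hom ≫ (λ_ A).inv

variable {A B E F Y Z W : C}

theorem hc_assoc (f : A ⊗ Y ⟶ Y ⊗ B) (g : B ⊗ Z ⟶ Z ⊗ E) (h : E ⊗ W ⟶ W ⊗ F) :
    hc (hc f g) h ≫ (α_ Y Z W).hom ▷ F = A ◁ (α_ Y Z W).hom ≫ hc f (hc g h) := by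
  simp only [hc]; monoidal

theorem hc_hu (f : A ⊗ Y ⟶ Y ⊗ B) :
    hc f (hu B) ≫ (ρ_ Y).hom ▷ B = A ◁ (ρ_ Y).hom ≫ f := by
  simp only [hc, hu]; monoidal

theorem vc_assoc {A' B' E' : C} (f : A ⊗ Y ⟶ Y ⊗ A') (g : B ⊗ Y ⟶ Y ⊗ B')
    (h : E ⊗ Y ⟶ Y ⊗ E') :
    vc (vc f g) h ≫ Y ◁ (α_ A' B' E').hom = (α_ A B E).hom ▷ Y ≫ vc f (vc g h) := by
  simp only [vc]; monoidal

theorem vu_vc (f : A ⊗ Y ⟶ Y ⊗ B) :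
    vc (vu Y) f ≫ Y ◁ (λ_ B).hom = (λ_ A).hom ▷ Y ≫ f := by
  simp only [vc, vu]; monoidal

theorem vc_vu (f : A ⊗ Y ⟶ Y ⊗ B) :
    vc f (vu Y) ≫ Y ◁ (ρ_ B).hom = (ρ_ A).hom ▷ Y ≫ f := by
  simp only [vc, vu]; monoidal

/-- Interchange law of the two compositions. Beyond coherence it only needs `f` and `g'` to slide
past each other. -/
theorem hc_vc {A' B' A'' B'' : C} (f : A ⊗ Y ⟶ Y ⊗ A') (g : B ⊗ Y ⟶ Y ⊗ B')
    (f' : A' ⊗ Z ⟶ Z ⊗ A'') (g' : B' ⊗ Z ⟶ Z ⊗ B'') :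
    hc (vc f g) (vc f' g') = vc (hc f f') (hc g g') := by
  simp only [hc, vc]
  calc
    _ = 𝟙 _ ⊗≫ A ◁ g ▷ Z ⊗≫ (f ▷ (B' ⊗ Z) ≫ (Y ⊗ A') ◁ g') ⊗≫ Y ◁ f' ▷ B'' ⊗≫ 𝟙 _ := by monoidal
    _ = _ := by rw [← whisker_exchange]; monoidal

theorem hc_vu (Y Z : C) : hc (vu Y) (vu Z) = vu (Y ⊗ Z) := by
  simp only [hc, vu]; monoidal

theorem pre_hc {A₀ : C} (a : A₀ ⟶ A) (f : A ⊗ Y ⟶ Y ⊗ B) (g : B ⊗ Z ⟶ Z ⊗ E) :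
    hc (a ▷ Y ≫ f) g = a ▷ (Y ⊗ Z) ≫ hc f g := by
  simp only [hc]; monoidal

theorem hc_post (f : A ⊗ Y ⟶ Y ⊗ B) (g : B ⊗ Z ⟶ Z ⊗ E) (e : E ⟶ F) :
    hc f (g ≫ Z ◁ e) = hc f g ≫ (Y ⊗ Z) ◁ e := by
  simp only [hc]; monoidal

theorem hc_mid {B' : C} (f : A ⊗ Y ⟶ Y ⊗ B) (b : B ⟶ B') (g : B' ⊗ Z ⟶ Z ⊗ E) :
    hc (f ≫ Y ◁ b) g = hc f (b ▷ Z ≫ g) := by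
  simp only [hc]; monoidal

theorem pre_vc {A₀ B₀ A' B' : C} (a : A₀ ⟶ A) (b : B₀ ⟶ B) (f : A ⊗ Y ⟶ Y ⊗ A')
    (g : B ⊗ Y ⟶ Y ⊗ B') :
    vc (a ▷ Y ≫ f) (b ▷ Y ≫ g) = (a ⊗ₘ b) ▷ Y ≫ vc f g := by
  simp only [vc, MonoidalCategory.tensorHom_def]
  calc
    _ = 𝟙 _ ⊗≫ A₀ ◁ b ▷ Y ⊗≫ (A₀ ◁ g ≫ a ▷ _) ⊗≫ f ▷ B' ⊗≫ 𝟙 _ := by monoidal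
    _ = 𝟙 _ ⊗≫ (A₀ ◁ b ≫ a ▷ B) ▷ Y ⊗≫ A ◁ g ⊗≫ f ▷ B' ⊗≫ 𝟙 _ := by
      rw [whisker_exchange]; monoidal
    _ = _ := by rw [whisker_exchange]; monoidal

theorem vc_post {A' B' A₁ B₁ : C} (f : A ⊗ Y ⟶ Y ⊗ A') (g : B ⊗ Y ⟶ Y ⊗ B') (a : A' ⟶ A₁)
    (b : B' ⟶ B₁) :
    vc (f ≫ Y ◁ a) (g ≫ Y ◁ b) = vc f g ≫ Y ◁ (a ⊗ₘ b) := by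
  simp only [vc, MonoidalCategory.tensorHom_def']
  calc
    _ = 𝟙 _ ⊗≫ A ◁ g ⊗≫ ((A ⊗ Y) ◁ b ≫ f ▷ _) ⊗≫ Y ◁ a ▷ B₁ ⊗≫ 𝟙 _ := by monoidal
    _ = _ := by rw [whisker_exchange]; monoidal

theorem vc_post_left {A' B' A₁ : C} (f : A ⊗ Y ⟶ Y ⊗ A') (g : B ⊗ Y ⟶ Y ⊗ B') (a : A' ⟶ A₁) :
    vc f g ≫ Y ◁ (a ▷ B') = vc (f ≫ Y ◁ a) g := by
  simp only [vc]; monoidal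

theorem vc_post_right {A' B' B₁ : C} (f : A ⊗ Y ⟶ Y ⊗ A') (g : B ⊗ Y ⟶ Y ⊗ B') (b : B' ⟶ B₁) :
    vc f g ≫ Y ◁ (A' ◁ b) = vc f (g ≫ Y ◁ b) := by
  have := vc_post f g (𝟙 A') b
  simpa using this.symm

theorem pre_vc_left {A₀ A' B' : C} (a : A₀ ⟶ A) (f : A ⊗ Y ⟶ Y ⊗ A') (g : B ⊗ Y ⟶ Y ⊗ B') :
    vc (a ▷ Y ≫ f) g = (a ▷ B) ▷ Y ≫ vc f g := by
  have := pre_vc a (𝟙 B) f g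
  simpa using this

theorem pre_vc_right {B₀ A' B' : C} (b : B₀ ⟶ B) (f : A ⊗ Y ⟶ Y ⊗ A') (g : B ⊗ Y ⟶ Y ⊗ B') :
    vc f (b ▷ Y ≫ g) = (A ◁ b) ▷ Y ≫ vc f g := by
  have := pre_vc (𝟙 A) b f g
  simpa using this

theorem vc_natural {A' B' Y' : C} {f : A ⊗ Y ⟶ Y ⊗ A'} {f' : A ⊗ Y' ⟶ Y' ⊗ A'}
    {g : B ⊗ Y ⟶ Y ⊗ B'} {g' : B ⊗ Y' ⟶ Y' ⊗ B'} {y : Y ⟶ Y'}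
    (hf : A ◁ y ≫ f' = f ≫ y ▷ A') (hg : B ◁ y ≫ g' = g ≫ y ▷ B') :
    (A ⊗ B) ◁ y ≫ vc f' g' = vc f g ≫ y ▷ (A' ⊗ B') := by
  simp only [vc]
  calc
    _ = 𝟙 _ ⊗≫ A ◁ (B ◁ y ≫ g') ⊗≫ f' ▷ B' ⊗≫ 𝟙 _ := by monoidal
    _ = 𝟙 _ ⊗≫ A ◁ g ⊗≫ (A ◁ y ≫ f') ▷ B' ⊗≫ 𝟙 _ := by rw [hg]; monoidal
    _ = _ := by rw [hf]; monoidal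

instance isIso_hc (f : A ⊗ Y ⟶ Y ⊗ B) (g : B ⊗ Z ⟶ Z ⊗ E) [IsIso f] [IsIso g] :
    IsIso (hc f g) := by
  unfold hc; infer_instance

instance isIso_vc {A' B' : C} (f : A ⊗ Y ⟶ Y ⊗ A') (g : B ⊗ Y ⟶ Y ⊗ B') [IsIso f] [IsIso g] :
    IsIso (vc f g) := by
  unfold vc; infer_instance

instance isIso_vu : IsIso (vu Y) := by
  unfold vu; infer_instance

end Squares

/-! ### Natural families of squares -/

section Families

variable {C : Type u} [Category.{v} C] [MonoidalCategory C]

/-- A family of squares `A ⊗ Y ⟶ Y ⊗ B`, natural with respect to the objects `Y` of `D`. -/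
structure Fam (D : ObjectProperty C) (A B : C) where
  app : ∀ {Y : C}, D Y → (A ⊗ Y ⟶ Y ⊗ B)
  naturality : ∀ {Y Y' : C} (hY : D Y) (hY' : D Y') (f : Y ⟶ Y'),
    A ◁ f ≫ app hY' = app hY ≫ f ▷ B

namespace Fam

variable {D D₂ D₃ D' : ObjectProperty C} {A A' B B' E F : C}

@[simps]
def pre (a : A' ⟶ A) (S : Fam D A B) : Fam D A' B where
  app hY := a ▷ _ ≫ S.app hY
  naturality hY hY' f := by
    rw [whisker_exchange_assoc, S.naturality hY hY', Category.assoc]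

@[simps]
def post (S : Fam D A B) (b : B ⟶ B') : Fam D A B' where
  app {Y} hY := S.app hY ≫ Y ◁ b
  naturality hY hY' f := by
    rw [reassoc_of% S.naturality hY hY' f, Category.assoc, whisker_exchange]

@[simps]
def tensor (S : Fam D A A') (T : Fam D B B') : Fam D (A ⊗ B) (A' ⊗ B') where
  app hY := vc (S.app hY) (T.app hY)
  naturality hY hY' f := vc_natural (S.naturality hY hY' f) (T.naturality hY hY' f)

variable (D) in
def unit : Fam D (𝟙_ C) (𝟙_ C) where
  app {Y} _ := vu Y
  naturality hY hY' f := by simp [vu]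

/-- The members of the family `S` jointly detect morphisms from `B ⊗ R`. -/
def Detects (S : Fam D A B) : Prop :=
  ∀ {R N : C} (g g' : B ⊗ R ⟶ N),
    (∀ {Y : C} (hY : D Y), S.app hY ▷ R ≫ (α_ Y B R).hom ≫ Y ◁ g =
      S.app hY ▷ R ≫ (α_ Y B R).hom ≫ Y ◁ g') → g = g'

/-- The case where the auxiliary object `R` is the unit. -/
theorem Detects.hom_ext {S : Fam D A B} (hS : S.Detects) {g g' : B ⟶ E}
    (h : ∀ {Y : C} (hY : D Y), S.app hY ≫ Y ◁ g = S.app hY ≫ Y ◁ g') : g = g' := by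
  rw [← cancel_epi (ρ_ B).hom]
  refine hS _ _ fun {Y} hY => ?_
  have := congrArg (fun k => (ρ_ _).hom ≫ k) (h hY)
  simpa using this

theorem Detects.hc_ext {S : Fam D A B} (hS : S.Detects) {Z : C} {g g' : B ⊗ Z ⟶ Z ⊗ E}
    (h : ∀ {Y : C} (hY : D Y), hc (S.app hY) g = hc (S.app hY) g') : g = g' := by
  refine hS _ _ fun {Y} hY => ?_
  have := h hY
  simp only [hc, Iso.cancel_iso_inv_left] at this
  rw [← cancel_mono (α_ Y Z E).inv]
  simpa only [Category.assoc] using this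

/-- The square `g` divides the family `R` by the family `S`. -/
def Divides (S : Fam D A B) (R : Fam D' A E) {Z : C} (g : B ⊗ Z ⟶ Z ⊗ E) : Prop :=
  ∀ (Y : C) (hY : D Y) (hYZ : D' (Y ⊗ Z)), hc (S.app hY) g = R.app hYZ

theorem Detects.unique {S : Fam D A B} (hS : S.Detects) {R : Fam D' A E} {Z : C}
    (hZ : ∀ Y : C, D Y → D' (Y ⊗ Z)) {g g' : B ⊗ Z ⟶ Z ⊗ E} (hg : S.Divides R g)
    (hg' : S.Divides R g') : g = g' :=
  hS.hc_ext fun {Y} hY => by rw [hg Y hY (hZ Y hY), hg' Y hY (hZ Y hY)]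

/-- After multiplication by a member of `S` over `Y`, the claim becomes naturality of `R` along `Y ◁
z`; detection cancels `S`. -/
theorem Detects.natural {S : Fam D A B} (hS : S.Detects) {R : Fam D' A E} {Z Z' : C}
    (hZ : ∀ Y : C, D Y → D' (Y ⊗ Z)) (hZ' : ∀ Y : C, D Y → D' (Y ⊗ Z'))
    {g : B ⊗ Z ⟶ Z ⊗ E} {g' : B ⊗ Z' ⟶ Z' ⊗ E} (hg : S.Divides R g) (hg' : S.Divides R g')
    (z : Z ⟶ Z') : B ◁ z ≫ g' = g ≫ z ▷ E := by
  refine hS _ _ fun {Y} hY => ?_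
  have h := R.naturality (hZ Y hY) (hZ' Y hY) (Y ◁ z)
  rw [← hg Y hY, ← hg' Y hY] at h
  simp only [hc] at h
  rw [← cancel_epi (α_ A Y Z).inv, ← cancel_mono (α_ Y Z' E).inv]
  calc
    _ = 𝟙 _ ⊗≫ ((S.app hY) ▷ Z ≫ (Y ⊗ B) ◁ z) ⊗≫ Y ◁ g' ⊗≫ 𝟙 _ := by monoidal
    _ = A ◁ Y ◁ z ≫ (α_ A Y Z').inv ≫ S.app hY ▷ Z' ≫ (α_ Y B Z').hom ≫ Y ◁ g' ≫
      (α_ Y Z' E).inv := by rw [← whisker_exchange]; monoidal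
    _ = _ := by rw [h]; monoidal

/-- Quotients multiply like fractions, `(R/S)(Q/R) = Q/S`. The rebracketing of `Y ⊗ (Z ⊗ W)` is
absorbed by naturality of `Q` along the associator. -/
theorem Divides.comp {S : Fam D A B} {R : Fam D₂ A E} {Q : Fam D₃ A F} {Z W : C}
    (hZ : ∀ Y : C, D Y → D₂ (Y ⊗ Z)) (hW : ∀ Y : C, D₂ Y → D₃ (Y ⊗ W)) {g : B ⊗ Z ⟶ Z ⊗ E}
    {g' : E ⊗ W ⟶ W ⊗ F} (hg : S.Divides R g) (hg' : R.Divides Q g') :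
    S.Divides Q (hc g g') := by
  intro Y hY hYZ
  rw [← cancel_epi (A ◁ (α_ Y Z W).hom), ← hc_assoc, hg Y hY (hZ Y hY),
    hg' (Y ⊗ Z) (hZ Y hY) (hW _ (hZ Y hY)), Q.naturality (hW _ (hZ Y hY)) hYZ]

theorem divides_hu (S : Fam D A B) : S.Divides S (hu B) := by
  intro Y hY hYZ
  rw [← cancel_mono ((ρ_ Y).hom ▷ B), hc_hu, S.naturality hYZ hY]

/-- A morphism which transforms a detecting family into another one is compatible with the squares
which divide these families by themselves. -/
theorem Detects.comm_of_divides {S : Fam D A B} (hS : S.Detects) {T : Fam D A E} {m : B ⟶ E}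
    (hm : ∀ {Y : C} (hY : D Y), S.app hY ≫ Y ◁ m = T.app hY) {X : C}
    (hX : ∀ Y : C, D Y → D (Y ⊗ X)) {g : B ⊗ X ⟶ X ⊗ B} {g' : E ⊗ X ⟶ X ⊗ E}
    (hg : S.Divides S g) (hg' : T.Divides T g') : m ▷ X ≫ g' = g ≫ X ◁ m := by
  refine hS.hc_ext fun {Y} hY => ?_
  rw [← hc_mid, hm, hg' Y hY (hX Y hY), hc_post, hg Y hY (hX Y hY), hm]

end Fam

end Families

end GCat

end

noncomputable section

namespace GCat

/-! ### Duality -/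

section Duality

variable {C : Type u} [Category.{v} C] [MonoidalCategory C] [TwoSidedDuals C]

theorem coev_ev (X : C) : dual X ◁ coev X ⊗≫ ev X ▷ dual X = ⊗𝟙.hom :=
  letI := TwoSidedDuals.leftPairing X
  ExactPairing.coevaluation_evaluation'' X (dual X)

theorem ev_coev (X : C) : coev X ▷ X ⊗≫ X ◁ ev X = ⊗𝟙.hom :=
  letI := TwoSidedDuals.leftPairing X
  ExactPairing.evaluation_coevaluation'' X (dual X)

theorem coevR_evR (X : C) : X ◁ coevR X ⊗≫ evR X ▷ X = ⊗𝟙.hom :=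
  letI := TwoSidedDuals.rightPairing X
  ExactPairing.coevaluation_evaluation'' (dual X) X

theorem evR_coevR (X : C) : coevR X ▷ dual X ⊗≫ dual X ◁ evR X = ⊗𝟙.hom :=
  letI := TwoSidedDuals.rightPairing X
  ExactPairing.evaluation_coevaluation'' (dual X) X

theorem dualMap_ev {X Y : C} (f : X ⟶ Y) : dualMap f ▷ X ≫ ev X = dual Y ◁ f ≫ ev Y :=
  letI : HasRightDual X := { rightDual := dual X, exact := TwoSidedDuals.leftPairing X }
  letI : HasRightDual Y := { rightDual := dual Y, exact := TwoSidedDuals.leftPairing Y }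
  rightAdjointMate_comp_evaluation f

theorem coev_dualMap {X Y : C} (f : X ⟶ Y) : coev Y ≫ Y ◁ dualMap f = coev X ≫ f ▷ dual X :=
  letI : HasRightDual X := { rightDual := dual X, exact := TwoSidedDuals.leftPairing X }
  letI : HasRightDual Y := { rightDual := dual Y, exact := TwoSidedDuals.leftPairing Y }
  coevaluation_comp_rightAdjointMate f

/-- A square over `Y` is invertible if it has a companion over the dual of `Y` such that the
composites are compatible with the right evaluation and coevaluation. -/
theorem isIso_of_companion {A B Y : C} (f : A ⊗ Y ⟶ Y ⊗ B) (f' : B ⊗ dual Y ⟶ dual Y ⊗ A)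
    (h₁ : A ◁ evR Y ≫ hu A = hc f f' ≫ evR Y ▷ A)
    (h₂ : B ◁ coevR Y ≫ hc f' f = hu B ≫ coevR Y ▷ B) : IsIso f := by
  -- The inverse is the companion bent back by the right duality; each composite collapses to the
  -- zigzag identity.
  refine ⟨𝟙 _ ⊗≫ (Y ⊗ B) ◁ coevR Y ⊗≫ Y ◁ f' ▷ Y ⊗≫ evR Y ▷ (A ⊗ Y) ⊗≫ 𝟙 _, ?_, ?_⟩
  · calc
      _ = 𝟙 _ ⊗≫ (f ▷ 𝟙_ C ≫ (Y ⊗ B) ◁ coevR Y) ⊗≫ Y ◁ f' ▷ Y ⊗≫ evR Y ▷ (A ⊗ Y) ⊗≫ 𝟙 _ := by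
        monoidal
      _ = 𝟙 _ ⊗≫ (A ⊗ Y) ◁ coevR Y ⊗≫ (hc f f' ≫ evR Y ▷ A) ▷ Y ⊗≫ 𝟙 _ := by
        rw [← whisker_exchange, hc]; monoidal
      _ = 𝟙 _ ⊗≫ A ◁ (Y ◁ coevR Y ⊗≫ evR Y ▷ Y) ⊗≫ 𝟙 _ := by
        rw [← h₁, hu]; monoidal
      _ = 𝟙 _ := by rw [coevR_evR]; monoidal
  · calc
      _ = 𝟙 _ ⊗≫ (Y ⊗ B) ◁ coevR Y ⊗≫ Y ◁ f' ▷ Y ⊗≫ (evR Y ▷ (A ⊗ Y) ≫ 𝟙_ C ◁ f) ⊗≫ 𝟙 _ := by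
        monoidal
      _ = 𝟙 _ ⊗≫ Y ◁ (B ◁ coevR Y ≫ hc f' f) ⊗≫ evR Y ▷ (Y ⊗ B) ⊗≫ 𝟙 _ := by
        rw [← whisker_exchange, hc]; monoidal
      _ = 𝟙 _ ⊗≫ (Y ◁ coevR Y ⊗≫ evR Y ▷ Y) ▷ B ⊗≫ 𝟙 _ := by
        rw [h₂, hu]; monoidal
      _ = 𝟙 _ := by rw [coevR_evR]; monoidal

namespace Fam

variable {D D' : ObjectProperty C} {A B E : C}

/-- The product of `R/S` over `Z` and `S/R` over the dual of `Z` is `S/S`, which is trivial over the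
unit. Naturality of `S/S` along `evR`, and of `R/R` along `coevR`, makes `g'` a companion of `g`. -/
theorem Detects.isIso_of_divides {S : Fam D A B} (hS : S.Detects) {R : Fam D' A E}
    (hR : R.Detects) {Z : C} (hZ : ∀ Y : C, D Y → D' (Y ⊗ Z))
    (hZ' : ∀ Y : C, D' Y → D (Y ⊗ dual Z)) (h1 : ∀ Y : C, D Y → D (Y ⊗ 𝟙_ C))
    (h1' : ∀ Y : C, D' Y → D' (Y ⊗ 𝟙_ C)) (h2 : ∀ Y : C, D Y → D (Y ⊗ (Z ⊗ dual Z)))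
    (h2' : ∀ Y : C, D' Y → D' (Y ⊗ (dual Z ⊗ Z))) {g : B ⊗ Z ⟶ Z ⊗ E}
    {g' : E ⊗ dual Z ⟶ dual Z ⊗ B} (hg : S.Divides R g) (hg' : R.Divides S g') :
    IsIso g :=
  isIso_of_companion g g'
    (hS.natural h2 h1 (hg.comp hZ hZ' hg') S.divides_hu (evR Z))
    (hR.natural h1' h2' R.divides_hu (hg'.comp hZ' hZ hg) (coevR Z))

/-- A detecting family with values in `B` and the squares on `B` which divide it by itself give
rise to a half braiding of `B`. -/
def Detects.halfBraiding {S : Fam D A B} (hS : S.Detects) {D₁ : ObjectProperty C}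
    (h : ∀ {X : C}, D₁ X → ∀ Y : C, D Y → D (Y ⊗ X)) (h1 : D₁ (𝟙_ C))
    (hdual : ∀ {X : C}, D₁ X → D₁ (dual X)) (hmul : ∀ {X Y : C}, D₁ X → D₁ Y → D₁ (X ⊗ Y))
    (g : ∀ {X : C}, D₁ X → (B ⊗ X ⟶ X ⊗ B))
    (hg : ∀ {X : C} (hX : D₁ X), S.Divides S (g hX)) :
    RelHalfBraiding D₁ B where
  β _ hX :=
    haveI := hS.isIso_of_divides hS (h hX) (h (hdual hX)) (h h1) (h h1) (h (hmul hX (hdual hX)))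
      (h (hmul (hdual hX) hX)) (hg hX) (hg (hdual hX))
    asIso (g hX)
  monoidal hX hY hXY := hS.unique (h hXY) (hg hXY) ((hg hX).comp (h hX) (h hY) (hg hY))
  naturality hX hY f := hS.natural (h hX) (h hY) (hg hX) (hg hY) f

end Fam

/-- The trace over `V` on the left. -/
def tr (V : C) {M N : C} (f : V ⊗ M ⟶ V ⊗ N) : M ⟶ N :=
  (λ_ M).inv ≫ coevR V ▷ M ≫ (α_ _ _ _).hom ≫ dual V ◁ f ≫ (α_ _ _ _).inv ≫ ev V ▷ N ≫ (λ_ N).hom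

/-- The morphism `Y* ⊗ A ⊗ Y ⟶ E` obtained from a square by the left evaluation. -/
def mateL {A Y E : C} (f : A ⊗ Y ⟶ Y ⊗ E) : conjObj Y A ⟶ E :=
  (α_ _ _ _).hom ≫ dual Y ◁ f ≫ (α_ _ _ _).inv ≫ ev Y ▷ E ≫ (λ_ E).hom

/-- The morphism `E ⟶ Y* ⊗ A ⊗ Y` obtained from an inverse square by the right coevaluation. -/
def mateR {A Y E : C} (f : Y ⊗ E ⟶ A ⊗ Y) : E ⟶ conjObj Y A :=
  (λ_ E).inv ≫ coevR Y ▷ E ≫ (α_ _ _ _).hom ≫ dual Y ◁ f ≫ (α_ _ _ _).inv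

/-- The square obtained from a morphism `Y* ⊗ A ⊗ Y ⟶ E` by the left coevaluation. -/
def comate {A Y E : C} (r : conjObj Y A ⟶ E) : A ⊗ Y ⟶ Y ⊗ E :=
  𝟙 _ ⊗≫ coev Y ▷ (A ⊗ Y) ⊗≫ Y ◁ r

variable {A B E Y : C}

theorem mateR_mateL (u : Y ⊗ B ⟶ A ⊗ Y) (f : A ⊗ Y ⟶ Y ⊗ E) :
    mateR u ≫ mateL f = tr Y (u ≫ f) := by
  simp [mateR, mateL, tr]

theorem mateL_post (f : A ⊗ Y ⟶ Y ⊗ B) (b : B ⟶ E) : mateL (f ≫ Y ◁ b) = mateL f ≫ b := by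
  simp only [mateL]
  rw [whiskerLeft_comp_assoc, associator_inv_naturality_right_assoc, whisker_exchange_assoc,
    leftUnitor_naturality]
  simp

theorem mateR_pre (e : E ⟶ B) (u : Y ⊗ B ⟶ A ⊗ Y) : mateR (Y ◁ e ≫ u) = e ≫ mateR u := by
  simp only [mateR]
  rw [leftUnitor_inv_naturality_assoc, whisker_exchange_assoc,
    associator_naturality_right_assoc, whiskerLeft_comp_assoc]

/-- The loop of `V` closes up without meeting `m`. Hence whiskering with an object of invertible
dimension is injective. -/
theorem tr_whiskerLeft (V : C) {M N : C} (m : M ⟶ N) : tr V (V ◁ m) = scal (leftDim V) m := by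
  simp only [tr, scal, leftDim]
  calc
    _ = 𝟙 _ ⊗≫ coevR V ▷ M ⊗≫ ((dual V ⊗ V) ◁ m ≫ ev V ▷ N) ⊗≫ 𝟙 _ := by monoidal
    _ = _ := by rw [whisker_exchange]; monoidal

/-- Together with `comate_mateL` this is the duality bijection between morphisms `Y* ⊗ A ⊗ Y ⟶ E`
and squares `A ⊗ Y ⟶ Y ⊗ E`, through which `ρ` and `∂`, or `p` and a twist, determine each other. -/
theorem mateL_comate (r : conjObj Y A ⟶ E) : mateL (comate r) = r := by
  simp only [mateL, comate]
  calc
    _ = 𝟙 _ ⊗≫ dual Y ◁ coev Y ▷ (A ⊗ Y) ⊗≫ ((dual Y ⊗ Y) ◁ r ≫ ev Y ▷ E) ⊗≫ 𝟙 _ := by monoidal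
    _ = 𝟙 _ ⊗≫ (dual Y ◁ coev Y ⊗≫ ev Y ▷ dual Y) ▷ (A ⊗ Y) ⊗≫ r := by
      rw [whisker_exchange]; monoidal
    _ = _ := by rw [coev_ev]; monoidal

theorem comate_mateL (f : A ⊗ Y ⟶ Y ⊗ E) : comate (mateL f) = f := by
  simp only [mateL, comate]
  calc
    _ = 𝟙 _ ⊗≫ (coev Y ▷ (A ⊗ Y) ≫ (Y ⊗ dual Y) ◁ f) ⊗≫ Y ◁ ev Y ▷ E ⊗≫ 𝟙 _ := by monoidal
    _ = f ⊗≫ (coev Y ▷ Y ⊗≫ Y ◁ ev Y) ▷ E ⊗≫ 𝟙 _ := by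
      rw [← whisker_exchange]; monoidal
    _ = _ := by rw [ev_coev]; monoidal

theorem comate_post (r : conjObj Y A ⟶ B) (b : B ⟶ E) : comate (r ≫ b) = comate r ≫ Y ◁ b := by
  simp only [comate]; monoidal

theorem comate_pre {A' : C} (a : A' ⟶ A) (r : conjObj Y A ⟶ B) :
    comate ((dual Y ◁ a) ▷ Y ≫ r) = a ▷ Y ≫ comate r := by
  simp only [comate]
  calc
    _ = 𝟙 _ ⊗≫ (coev Y ▷ (A' ⊗ Y) ≫ (Y ⊗ dual Y) ◁ (a ▷ Y)) ⊗≫ Y ◁ r := by monoidal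
    _ = _ := by rw [← whisker_exchange]; monoidal

end Duality

/-! ### Endomorphisms of the unit -/

section Scalars

variable {C : Type u} [Category.{v} C] [MonoidalCategory C]

theorem scal_comp (s : 𝟙_ C ⟶ 𝟙_ C) {X Y Z : C} (f : X ⟶ Y) (g : Y ⟶ Z) :
    scal s f ≫ g = scal s (f ≫ g) := by simp [scal]

theorem comp_scal (s : 𝟙_ C ⟶ 𝟙_ C) {X Y Z : C} (f : X ⟶ Y) (g : Y ⟶ Z) :
    f ≫ scal s g = scal s (f ≫ g) := by
  simp only [scal, leftUnitor_inv_naturality_assoc, whisker_exchange_assoc,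
    leftUnitor_naturality_assoc]

theorem scal_whiskerRight (s : 𝟙_ C ⟶ 𝟙_ C) {X Y : C} (f : X ⟶ Y) (Z : C) :
    scal s f ▷ Z = scal s (f ▷ Z) := by
  simp only [scal]; monoidal

/-- Scalars act on the left, so moving one across `Z` is exactly where purity enters. -/
theorem IsPure.whiskerLeft_scal (h : IsPure C) (s : 𝟙_ C ⟶ 𝟙_ C) {X Y : C} (f : X ⟶ Y) (Z : C) :
    Z ◁ scal s f = scal s (Z ◁ f) := by
  have h1 : ∀ W : C, s ▷ W = (λ_ W).hom ≫ ((ρ_ W).inv ≫ W ◁ s ≫ (ρ_ W).hom) ≫ (λ_ W).inv := by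
    intro W; rw [← h]; simp
  simp only [scal, h1]; monoidal

theorem scal_scal (s t : 𝟙_ C ⟶ 𝟙_ C) {X Y : C} (f : X ⟶ Y) :
    scal s (scal t f) = scal (s ≫ t) f := by simp [scal]

theorem scal_id (X Y : C) (f : X ⟶ Y) : scal (𝟙 _) f = f := by simp [scal]

theorem IsPure.scal_eq (h : IsPure C) (s : 𝟙_ C ⟶ 𝟙_ C) {X Y : C} (f : X ⟶ Y) :
    scal s f = (ρ_ X).inv ≫ X ◁ s ≫ (ρ_ X).hom ≫ f := by
  have := h s X
  simp only [scal, reassoc_of% this]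

end Scalars

end GCat

end

noncomputable section

namespace GCat

/-! ### Half braidings as families of squares, and slides -/

section

variable {C : Type u} [Category.{v} C] [MonoidalCategory C] {D : ObjectProperty C}

/-- A single invertible member suffices: it cancels, and then `V` is stripped off by injectivity of
whiskering. -/
theorem Fam.detects_of_isIso {A B : C} {S : Fam D A B} {V : C} (hV : D V)
    (hS : IsIso (S.app hV)) (hf : ∀ {M N : C} (m m' : M ⟶ N), V ◁ m = V ◁ m' → m = m') :
    S.Detects := by
  intro R N g g' h
  have := h hV
  rw [cancel_epi, cancel_epi] at this
  exact hf _ _ this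

theorem whiskerLeft_unit_injective {M N : C} (m m' : M ⟶ N) (h : 𝟙_ C ◁ m = 𝟙_ C ◁ m') :
    m = m' := by
  simpa using h

namespace RelCenter

/-- The half braiding, as a family of squares. -/
def fam (A : RelCenter D) : Fam D A.obj A.obj where
  app hX := A.σ hX
  naturality hX hY f := A.braiding.naturality hX hY f

theorem σ_tensor (A : RelCenter D) {X Y : C} (hX : D X) (hY : D Y) (hXY : D (X ⊗ Y)) :
    A.σ hXY = hc (A.σ hX) (A.σ hY) := A.braiding.monoidal hX hY hXY

theorem fam_detects (A : RelCenter D) (h1 : D (𝟙_ C)) : A.fam.Detects :=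
  Fam.detects_of_isIso h1 (inferInstanceAs (IsIso (A.braiding.β _ h1).hom))
    whiskerLeft_unit_injective

theorem fam_divides (A : RelCenter D) {X : C} (hX : D X) : A.fam.Divides A.fam (A.σ hX) :=
  fun _ hY hYX => (A.σ_tensor hY hX hYX).symm

/-- The unit condition is not among the axioms of a half braiding. It follows because both sides
divide the half braiding by itself over the unit, and quotients are unique. -/
theorem σ_unit (A : RelCenter D) (h1 : D (𝟙_ C)) (h : ∀ X : C, D X → D (X ⊗ 𝟙_ C)) :
    A.σ h1 = hu A.obj :=
  Fam.Detects.unique (A.fam_detects h1) h (A.fam_divides h1) A.fam.divides_hu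

end RelCenter

variable [TwoSidedDuals C] (A : RelCenter D)

/-- The square `A ⊗ Y ⟶ Y ⊗ (W* ⊗ A ⊗ W)` obtained from the half braiding of `A` at `Y ⊗ W*`. -/
def slideOut (Y W : C) (h : D (Y ⊗ dual W)) : A.obj ⊗ Y ⟶ Y ⊗ conjObj W A.obj :=
  𝟙 _ ⊗≫ (A.obj ⊗ Y) ◁ coevR W ⊗≫ A.σ h ▷ W ⊗≫ 𝟙 _

/-- The inverse, up to a scalar, of `slideOut` on the range of the slide. -/
def slideIn (Y W : C) (h : D (Y ⊗ dual W)) : Y ⊗ conjObj W A.obj ⟶ A.obj ⊗ Y :=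
  𝟙 _ ⊗≫ (A.braiding.β _ h).inv ▷ W ⊗≫ (A.obj ⊗ Y) ◁ ev W ⊗≫ 𝟙 _

theorem slide_eq (V W : C) (h : D (V ⊗ dual W)) : slide A V W h = mateL (slideOut A V W h) := by
  simp only [slide, mateL, slideOut]; monoidal

theorem slideX_eq (V X : C) (h : D ((V ⊗ X) ⊗ dual V)) :
    slideX A V X h = 𝟙 _ ⊗≫ dual V ◁ slideOut A (V ⊗ X) V h ⊗≫
      ev V ▷ (X ⊗ conjObj V A.obj) ⊗≫ 𝟙 _ := by
  simp only [slideX, slideOut]; monoidal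

theorem slide2_eq (U V W : C) (h : D ((V ⊗ U) ⊗ dual W)) :
    slide2 A U V W h = 𝟙 _ ⊗≫ (dual U ⊗ dual V) ◁ slideOut A (V ⊗ U) W h ⊗≫
      dual U ◁ ev V ▷ (U ⊗ conjObj W A.obj) ⊗≫ ev U ▷ conjObj W A.obj ⊗≫ 𝟙 _ := by
  simp only [slide2, slideOut]; monoidal

theorem slideOut_natural {Y Y' : C} (W : C) (h : D (Y ⊗ dual W)) (h' : D (Y' ⊗ dual W))
    (f : Y ⟶ Y') :
    A.obj ◁ f ≫ slideOut A Y' W h' = slideOut A Y W h ≫ f ▷ conjObj W A.obj := by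
  have hn := A.braiding.naturality h h' (f ▷ dual W)
  simp only [slideOut]
  calc
    _ = 𝟙 _ ⊗≫ (A.obj ◁ f ▷ 𝟙_ C ≫ A.obj ◁ Y' ◁ coevR W) ⊗≫ A.σ h' ▷ W ⊗≫ 𝟙 _ := by monoidal
    _ = 𝟙 _ ⊗≫ (A.obj ⊗ Y) ◁ coevR W ⊗≫ (A.obj ◁ f ▷ dual W ≫ A.σ h') ▷ W ⊗≫ 𝟙 _ := by
      rw [← MonoidalCategory.whiskerLeft_comp, ← whisker_exchange]; monoidal
    _ = _ := by rw [hn]; monoidal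

/-- Multiplicativity of the half braiding lets `A` cross `X` before `Y ⊗ W*`. This is what makes
`slideOut` compatible with the action of the neutral component. -/
theorem slideOut_tensor {X Y : C} (W : C) (hX : D X) (h : D (Y ⊗ dual W))
    (h' : D ((X ⊗ Y) ⊗ dual W)) (h'' : D (X ⊗ (Y ⊗ dual W))) :
    slideOut A (X ⊗ Y) W h' = hc (A.σ hX) (slideOut A Y W h) := by
  have hn := A.braiding.naturality h'' h' (α_ X Y (dual W)).inv
  rw [← cancel_epi (A.obj ◁ (α_ X Y (dual W)).hom), whiskerLeft_hom_inv_assoc,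
    show (A.braiding.β _ h'').hom = _ from A.σ_tensor hX h h''] at hn
  simp only [slideOut]
  rw [show A.σ h' = _ from hn]
  simp only [hc]
  calc
    _ = 𝟙 _ ⊗≫ (((A.obj ⊗ X) ⊗ Y) ◁ coevR W ≫ (A.σ hX ▷ Y) ▷ (dual W ⊗ W)) ⊗≫
        X ◁ A.σ h ▷ W ⊗≫ 𝟙 _ := by monoidal
    _ = _ := by rw [whisker_exchange]; monoidal

/-- The half braiding cancels its inverse, leaving the loop `coevR W ≫ ev W` on the right of `A ⊗
Y`; purity turns it into a scalar on the left. -/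
theorem slideOut_slideIn (hp : IsPure C) {Y W : C} (h : D (Y ⊗ dual W)) :
    slideOut A Y W h ≫ slideIn A Y W h = scal (leftDim W) (𝟙 _) := by
  rw [hp.scal_eq, leftDim]
  simp only [slideOut, slideIn]
  calc
    _ = 𝟙 _ ⊗≫ (A.obj ⊗ Y) ◁ coevR W ⊗≫ ((A.braiding.β _ h).hom ≫ (A.braiding.β _ h).inv) ▷ W ⊗≫
        (A.obj ⊗ Y) ◁ ev W ⊗≫ 𝟙 _ := by monoidal
    _ = _ := by rw [Iso.hom_inv_id]; monoidal

/-- By naturality along the evaluation of the inner `W* ⊗ W`, crossing `Y ⊗ W*` can be replaced by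
crossing `(Y ⊗ W*) ⊗ (W ⊗ W*)`. The first factor cancels the inverse half braiding, and the second
one produces the slide. -/
theorem slideIn_slideOut {Y W : C} (h : D (Y ⊗ dual W)) (hW : D (W ⊗ dual W))
    (h2 : D ((Y ⊗ dual W) ⊗ (W ⊗ dual W))) :
    slideIn A Y W h ≫ slideOut A Y W h = Y ◁ slide A W W hW := by
  have hn := A.braiding.naturality h2 h (𝟙 ((Y ⊗ dual W) ⊗ (W ⊗ dual W)) ⊗≫ Y ◁ ev W ▷ dual W ⊗≫ 𝟙 _)
  rw [show (A.braiding.β _ h2).hom = _ from A.σ_tensor h hW h2] at hn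
  simp only [slideOut, slideIn, slide]
  calc
    _ = 𝟙 _ ⊗≫ (A.braiding.β (Y ⊗ dual W) h).inv ▷ W ⊗≫ (A.obj ⊗ Y) ◁ (ev W ▷ 𝟙_ C ≫ 𝟙_ C ◁ coevR W) ⊗≫
        A.σ h ▷ W ⊗≫ 𝟙 _ := by monoidal
    _ = 𝟙 _ ⊗≫ ((A.braiding.β (Y ⊗ dual W) h).inv ▷ (W ⊗ 𝟙_ C) ≫
        (A.obj ⊗ (Y ⊗ dual W)) ◁ (W ◁ coevR W)) ⊗≫
        (A.obj ◁ (𝟙 ((Y ⊗ dual W) ⊗ (W ⊗ dual W)) ⊗≫ Y ◁ ev W ▷ dual W ⊗≫ 𝟙 _) ≫ A.σ h) ▷ W ⊗≫ 𝟙 _ := by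
      rw [← whisker_exchange]; monoidal
    _ = 𝟙 _ ⊗≫ ((Y ⊗ dual W) ⊗ A.obj) ◁ (W ◁ coevR W) ⊗≫
        ((A.braiding.β (Y ⊗ dual W) h).inv ≫ (A.braiding.β (Y ⊗ dual W) h).hom) ▷ ((W ⊗ dual W) ⊗ W) ⊗≫
        (Y ⊗ dual W) ◁ A.σ hW ▷ W ⊗≫
        Y ◁ ev W ▷ ((dual W ⊗ A.obj) ⊗ W) ⊗≫ 𝟙 _ := by
      rw [← whisker_exchange, hn, hc]; monoidal
    _ = _ := by rw [Iso.inv_hom_id]; monoidal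

/-- A second description of the slide, dual to `slide_eq`: it makes the inclusion `q` a mate of the
inverse twist, as `slide_eq` makes `p` a mate of the twist. -/
theorem slide_eq_mateR {V : C} (h : D (V ⊗ dual V)) (h1 : D (𝟙_ C))
    (h1' : ∀ X : C, D X → D (X ⊗ 𝟙_ C)) (h2 : D ((V ⊗ dual V) ⊗ (V ⊗ dual V))) :
    slide A V V h = mateR (slideIn A V V h) := by
  -- Capping `V ⊗ V*` with `evR` undoes the crossing, by naturality and triviality of the half
  -- braiding at the unit; a zigzag remains.
  have hcap : slideOut A V V h ⊗≫ evR V ▷ (A.obj ⊗ V) ⊗≫ 𝟙 _ = 𝟙 (A.obj ⊗ V) := by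
    have hn := A.braiding.naturality h h1 (evR V)
    rw [show (A.braiding.β _ h1).hom = _ from A.σ_unit h1 h1'] at hn
    simp only [slideOut]
    calc
      _ = 𝟙 _ ⊗≫ (A.obj ⊗ V) ◁ coevR V ⊗≫ ((A.braiding.β _ h).hom ≫ evR V ▷ A.obj) ▷ V ⊗≫
          𝟙 _ := by monoidal
      _ = 𝟙 _ ⊗≫ A.obj ◁ (V ◁ coevR V ⊗≫ evR V ▷ V) ⊗≫ 𝟙 _ := by
        rw [← hn, hu]; monoidal
      _ = _ := by rw [coevR_evR]; monoidal
  have ht : slideIn A V V h = V ◁ slide A V V h ≫ (𝟙 _ ⊗≫ evR V ▷ (A.obj ⊗ V) ⊗≫ 𝟙 _) := by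
    rw [← slideIn_slideOut A h h h2, Category.assoc]
    calc
      _ = slideIn A V V h ≫ 𝟙 _ := (Category.comp_id _).symm
      _ = slideIn A V V h ≫ (slideOut A V V h ⊗≫ evR V ▷ (A.obj ⊗ V) ⊗≫ 𝟙 (A.obj ⊗ V)) :=
        congrArg (slideIn A V V h ≫ ·) hcap.symm
      _ = _ := by monoidal
  rw [ht, mateR_pre]
  have : mateR (𝟙 _ ⊗≫ evR V ▷ (A.obj ⊗ V) ⊗≫ 𝟙 _ : V ⊗ conjObj V A.obj ⟶ A.obj ⊗ V) =
      𝟙 (conjObj V A.obj) := by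
    simp only [mateR]
    calc
      _ = 𝟙 _ ⊗≫ (coevR V ▷ dual V ⊗≫ dual V ◁ evR V) ▷ (A.obj ⊗ V) ⊗≫ 𝟙 _ := by monoidal
      _ = _ := by rw [evR_coevR]; monoidal
  rw [this, Category.comp_id]

end

end GCat

end

noncomputable section

namespace GCat

variable {G : Type w} [Group G] {C : Type u} [Category.{v} C] [Preadditive C]
  [HasFiniteBiproducts C] [MonoidalCategory C] [PivotalCategory C] {𝒢 : PivotalGrading G C}

/-! ### Descent -/

theorem InvDim.scal_dInv {α : G} (V : InvDim 𝒢 α) {X Y : C} (f : X ⟶ Y) :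
    scal V.dInv (scal (leftDim V.obj) f) = f := by
  have := V.isIso
  rw [scal_scal, dInv, IsIso.inv_hom_id, scal_id]

/-- The normalized trace over an object with invertible left dimension. -/
def InvDim.ptr {α : G} (V : InvDim 𝒢 α) {M N : C} (f : V.obj ⊗ M ⟶ V.obj ⊗ N) : M ⟶ N :=
  scal V.dInv (tr V.obj f)

theorem InvDim.ptr_whiskerLeft {α : G} (V : InvDim 𝒢 α) {M N : C} (m : M ⟶ N) :
    V.ptr (V.obj ◁ m) = m := by
  rw [ptr, tr_whiskerLeft, V.scal_dInv]

theorem InvDim.whiskerLeft_injective {α : G} (V : InvDim 𝒢 α) {M N : C} (m m' : M ⟶ N)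
    (h : V.obj ◁ m = V.obj ◁ m') : m = m' := by
  rw [← V.ptr_whiskerLeft m, h, V.ptr_whiskerLeft]

/-- Since `Y ⊗ V*` has degree `1`, the member of `f` at `(Y ⊗ V*) ⊗ V` is the member at `V`,
whiskered. Naturality along `Y ⊗ ev_V` therefore converts the trace at `V` into the member at `Y`,
times a loop of `V` standing to the right of `Y`. Purity moves the loop to the left, where the
inverse dimension cancels it. -/
theorem whiskerLeft_ptr (hp : IsPure C) {α : G} (V : InvDim 𝒢 α) {M N : C}
    (f : ∀ {Y : C}, 𝒢.comp α Y → (Y ⊗ M ⟶ Y ⊗ N))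
    (hf : ∀ {Y Y' : C} (hY : 𝒢.comp α Y) (hY' : 𝒢.comp α Y') (y : Y ⟶ Y'),
      y ▷ M ≫ f hY' = f hY ≫ y ▷ N)
    (hX : ∀ {X Y : C} (_ : 𝒢.comp 1 X) (hY : 𝒢.comp α Y) (hXY : 𝒢.comp α (X ⊗ Y)),
      f hXY = (α_ X Y M).hom ≫ X ◁ f hY ≫ (α_ X Y N).inv) {Y : C} (hY : 𝒢.comp α Y) :
    Y ◁ V.ptr (f V.mem) = f hY := by
  have h1 : 𝒢.comp 1 (Y ⊗ dual V.obj) := mem_tensor (mul_inv_cancel α) hY (𝒢.dual_mem V.mem)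
  have h2 : 𝒢.comp α ((Y ⊗ dual V.obj) ⊗ V.obj) := mem_tensor (one_mul α) h1 V.mem
  have hn := hf h2 hY (𝟙 _ ⊗≫ Y ◁ ev V.obj ⊗≫ 𝟙 Y)
  rw [hX h1 V.mem h2] at hn
  have key : Y ◁ tr V.obj (f V.mem) = scal (leftDim V.obj) (f hY) := by
    have e : scal (leftDim V.obj) (𝟙 Y) = (ρ_ Y).inv ≫ Y ◁ leftDim V.obj ≫ (ρ_ Y).hom := by
      rw [hp.scal_eq, Category.comp_id]
    calc
      _ = 𝟙 _ ⊗≫ Y ◁ coevR V.obj ▷ M ⊗≫ (((α_ (Y ⊗ dual V.obj) V.obj M).hom ≫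
          (Y ⊗ dual V.obj) ◁ f V.mem ≫ (α_ (Y ⊗ dual V.obj) V.obj N).inv) ≫
          (𝟙 _ ⊗≫ Y ◁ ev V.obj ⊗≫ 𝟙 Y) ▷ N) := by
        simp only [tr]; monoidal
      _ = ((ρ_ Y).inv ≫ Y ◁ leftDim V.obj ≫ (ρ_ Y).hom) ▷ M ≫ f hY := by
        rw [← hn, leftDim]; monoidal
      _ = _ := by
        rw [← e, scal_whiskerRight, scal_comp, id_whiskerRight, Category.id_comp]
  rw [InvDim.ptr, hp.whiskerLeft_scal, key, V.scal_dInv]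

/-- Descent along an invertible family. -/
theorem exists_descent (hp : IsPure C) {α : G} (V : InvDim 𝒢 α) {M N : C} {P : C → C}
    (Pm : ∀ {Y Y' : C}, (Y ⟶ Y') → (P Y ⟶ P Y'))
    (c : ∀ {X : C} (_ : 𝒢.comp 1 X) (Y : C), P (X ⊗ Y) ⟶ X ⊗ P Y)
    (s : ∀ {Y : C}, 𝒢.comp α Y → (P Y ⟶ Y ⊗ M)) (t : ∀ {Y : C}, 𝒢.comp α Y → (P Y ⟶ Y ⊗ N))
    (hs : ∀ {Y : C} (hY : 𝒢.comp α Y), IsIso (s hY))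
    (sn : ∀ {Y Y' : C} (hY : 𝒢.comp α Y) (hY' : 𝒢.comp α Y') (y : Y ⟶ Y'),
      Pm y ≫ s hY' = s hY ≫ y ▷ M)
    (tn : ∀ {Y Y' : C} (hY : 𝒢.comp α Y) (hY' : 𝒢.comp α Y') (y : Y ⟶ Y'),
      Pm y ≫ t hY' = t hY ≫ y ▷ N)
    (sX : ∀ {X Y : C} (hX : 𝒢.comp 1 X) (hY : 𝒢.comp α Y) (hXY : 𝒢.comp α (X ⊗ Y)),
      s hXY = c hX Y ≫ X ◁ s hY ≫ (α_ X Y M).inv)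
    (tX : ∀ {X Y : C} (hX : 𝒢.comp 1 X) (hY : 𝒢.comp α Y) (hXY : 𝒢.comp α (X ⊗ Y)),
      t hXY = c hX Y ≫ X ◁ t hY ≫ (α_ X Y N).inv) :
    ∃ m : M ⟶ N, ∀ {Y : C} (hY : 𝒢.comp α Y), s hY ≫ Y ◁ m = t hY := by
  -- The quotients `s⁻¹t : Y ⊗ M ⟶ Y ⊗ N` are natural and compatible with the degree `1` part, since
  -- the morphisms `c` cancel; so they are whiskerings of one morphism, read off at `V`.
  refine ⟨V.ptr (inv (s V.mem) ≫ t V.mem), fun {Y} hY => ?_⟩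
  rw [whiskerLeft_ptr hp V (fun hY => inv (s hY) ≫ t hY) ?_ ?_ hY, IsIso.hom_inv_id_assoc]
  · intro Y Y' hY hY' y
    rw [← cancel_epi (s hY), ← reassoc_of% sn hY hY' y]
    simp [tn hY hY' y]
  · intro X Y hX hY hXY
    rw [← cancel_epi (s hXY), IsIso.hom_inv_id_assoc, sX hX hY hXY, tX hX hY hXY]
    simp

/-! ### Twists -/

namespace Fam

/-- A family over the component of degree `α` is compatible with the half braiding of its source. -/
def Acts {α : G} (A : ZG 𝒢) {E : C} (T : Fam (𝒢.comp α) A.obj E) : Prop :=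
  ∀ {X Y : C} (hX : 𝒢.comp 1 X) (hY : 𝒢.comp α Y) (hXY : 𝒢.comp α (X ⊗ Y)),
    T.app hXY = hc (A.σ hX) (T.app hY)

/-- An invertible family of squares compatible with the half braiding of its source. -/
structure IsTwist {α : G} (A : ZG 𝒢) {E : C} (S : Fam (𝒢.comp α) A.obj E) : Prop where
  acts : S.Acts A
  isIso : ∀ {Y : C} (hY : 𝒢.comp α Y), IsIso (S.app hY)

variable {α β γ : G} {A A' : ZG 𝒢} {B E E' : C}

theorem IsTwist.detects {S : Fam (𝒢.comp α) A.obj B} (hS : S.IsTwist A) (V : InvDim 𝒢 α) :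
    S.Detects :=
  detects_of_isIso V.mem (hS.isIso V.mem) V.whiskerLeft_injective

theorem Acts.pre {T : Fam (𝒢.comp α) A.obj B} (hT : T.Acts A) (f : A' ⟶ A) :
    (T.pre f.f).Acts A' := by
  intro X Y hX hY hXY
  simp only [pre_app]
  rw [hT hX hY hXY, ← hc_mid, ← f.comm, pre_hc]

theorem Acts.post {T : Fam (𝒢.comp α) A.obj B} (hT : T.Acts A) (b : B ⟶ E) :
    (T.post b).Acts A := by
  intro X Y hX hY hXY
  simp only [post_app]
  rw [hT hX hY hXY, hc_post]

theorem Acts.tensor {T : Fam (𝒢.comp α) A.obj B} (hT : T.Acts A) {T' : Fam (𝒢.comp α) A'.obj E}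
    (hT' : T'.Acts A') : (T.tensor T').Acts (A ⊗ A') := by
  intro X Y hX hY hXY
  simp only [tensor_app]
  rw [hT hX hY hXY, hT' hX hY hXY, ← hc_vc]
  rfl

theorem IsTwist.tensor {T : Fam (𝒢.comp α) A.obj B} (hT : T.IsTwist A)
    {T' : Fam (𝒢.comp α) A'.obj E} (hT' : T'.IsTwist A') : (T.tensor T').IsTwist (A ⊗ A') where
  acts := Acts.tensor hT.acts hT'.acts
  isIso hY := by
    have := hT.isIso hY
    have := hT'.isIso hY
    exact isIso_vc _ _

theorem isTwist_unit (α : G) : (Fam.unit (𝒢.comp α)).IsTwist (𝟙_ (ZG 𝒢)) where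
  acts _ _ _ := (hc_vu _ _).symm
  isIso _ := isIso_vu

theorem isTwist_fam (A : ZG 𝒢) : A.fam.IsTwist A where
  acts hX hY hXY := A.σ_tensor hX hY hXY
  isIso hY := inferInstanceAs (IsIso (A.braiding.β _ hY).hom)

/-- Descent applied to `Y ↦ A ⊗ Y`. The resulting morphism works at every `Y` of degree `α`,
although any formula for it involves only `V`. -/
theorem IsTwist.exists_hom (hp : IsPure C) (V : InvDim 𝒢 α) {S : Fam (𝒢.comp α) A.obj B}
    (hS : S.IsTwist A) {T : Fam (𝒢.comp α) A.obj E} (hT : T.Acts A) :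
    ∃ m : B ⟶ E, ∀ {Y : C} (hY : 𝒢.comp α Y), S.app hY ≫ Y ◁ m = T.app hY :=
  exists_descent hp V (P := fun Y => A.obj ⊗ Y) (fun y => A.obj ◁ y)
    (fun hX Y => (α_ _ _ _).inv ≫ A.σ hX ▷ Y ≫ (α_ _ _ _).hom) S.app T.app hS.isIso S.naturality
    T.naturality (fun hX hY hXY => by rw [hS.acts hX hY hXY, hc]; simp)
    (fun hX hY hXY => by rw [hT hX hY hXY, hc]; simp)

/-- Descent applied to `Y ↦ (A ⊗ Y) ⊗ Z`, with `R` taken at `Y ⊗ Z`. Naturality of `R` along the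
associator reconciles `(X ⊗ Y) ⊗ Z` with `X ⊗ (Y ⊗ Z)`. -/
theorem IsTwist.exists_divides (hp : IsPure C) (V : InvDim 𝒢 α) {S : Fam (𝒢.comp α) A.obj B}
    (hS : S.IsTwist A) {R : Fam (𝒢.comp γ) A.obj E} (hR : R.Acts A) (h : α * β = γ) {Z : C}
    (hZ : 𝒢.comp β Z) : ∃ g : B ⊗ Z ⟶ Z ⊗ E, S.Divides R g := by
  obtain ⟨g, hg⟩ := exists_descent hp V (P := fun Y => (A.obj ⊗ Y) ⊗ Z) (fun y => (A.obj ◁ y) ▷ Z)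
    (fun hX Y => ((α_ _ _ _).inv ≫ A.σ hX ▷ Y ≫ (α_ _ _ _).hom) ▷ Z ≫ (α_ _ _ _).hom)
    (fun {Y} hY => S.app hY ▷ Z ≫ (α_ Y B Z).hom)
    (fun {Y} hY => (α_ A.obj Y Z).hom ≫ R.app (mem_tensor h hY hZ) ≫ (α_ Y Z E).hom)
    (fun hY => by have := hS.isIso hY; infer_instance)
    (fun hY hY' y => by
      rw [← comp_whiskerRight_assoc, S.naturality hY hY']; simp)
    (fun {Y Y'} hY hY' y => by
      have := R.naturality (mem_tensor h hY hZ) (mem_tensor h hY' hZ) (y ▷ Z)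
      rw [associator_naturality_middle_assoc, reassoc_of% this]; simp)
    (fun hX hY hXY => by rw [hS.acts hX hY hXY, hc]; monoidal)
    (fun {X Y} hX hY hXY => by
      have hYZ := mem_tensor h hY hZ
      have hn := R.naturality (mem_tensor h hXY hZ) (mem_tensor (one_mul γ) hX hYZ)
        (α_ X Y Z).hom
      rw [hR hX hYZ, ← cancel_mono ((α_ X Y Z).inv ▷ E), Category.assoc, Category.assoc,
        hom_inv_whiskerRight, Category.comp_id] at hn
      rw [← hn, hc]; monoidal)
  refine ⟨g, fun Y hY hYZ => ?_⟩
  have := hg hY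
  rw [hc, ← cancel_epi (α_ A.obj Y Z).hom, Iso.hom_inv_id_assoc,
    ← cancel_mono (α_ Y Z E).hom]
  simpa using this

end Fam

end GCat

end

noncomputable section

namespace GCat

/-! ### Mates of composite squares -/

section Mates

variable {C : Type u} [Category.{v} C] [MonoidalCategory C] [TwoSidedDuals C] {A B E F : C}

theorem mateL_scal (hp : IsPure C) (s : 𝟙_ C ⟶ 𝟙_ C) {Y : C} (f : A ⊗ Y ⟶ Y ⊗ E) :
    mateL (scal s f) = scal s (mateL f) := by
  simp only [mateL, hp.whiskerLeft_scal, scal_comp, comp_scal]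

theorem mateR_scal (hp : IsPure C) (s : 𝟙_ C ⟶ 𝟙_ C) {Y : C} (f : Y ⊗ E ⟶ A ⊗ Y) :
    mateR (scal s f) = scal s (mateR f) := by
  simp only [mateR, hp.whiskerLeft_scal, scal_comp, comp_scal]

theorem conj_mateL {A' Y : C} (a : A' ⟶ A) (f : A ⊗ Y ⟶ Y ⊗ E) :
    (dual Y ◁ a) ▷ Y ≫ mateL f = mateL (a ▷ Y ≫ f) := by
  simp [mateL]

theorem mateR_mateL_self {Y : C} (u : Y ⊗ E ⟶ A ⊗ Y) (f : A ⊗ Y ⟶ Y ⊗ E) (h : u ≫ f = 𝟙 _) :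
    mateR u ≫ mateL f = scal (leftDim Y) (𝟙 E) := by
  rw [mateR_mateL, h, ← MonoidalCategory.whiskerLeft_id, tr_whiskerLeft]

theorem mateL_hc {V X : C} (f : A ⊗ V ⟶ V ⊗ B) (g : B ⊗ X ⟶ X ⊗ E) :
    𝟙 _ ⊗≫ dual V ◁ hc f g ⊗≫ ev V ▷ (X ⊗ E) ⊗≫ 𝟙 _ = mateL f ▷ X ≫ g := by
  simp only [mateL, hc]
  calc
    _ = 𝟙 _ ⊗≫ dual V ◁ f ▷ X ⊗≫ ((dual V ⊗ V) ◁ g ≫ ev V ▷ (X ⊗ E)) ⊗≫ 𝟙 _ := by monoidal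
    _ = _ := by rw [whisker_exchange]; monoidal

theorem mateL_hc_hc {U V : C} (f : A ⊗ V ⟶ V ⊗ B) (g : B ⊗ U ⟶ U ⊗ E) :
    𝟙 (conjObj U (conjObj V A)) ⊗≫ (dual U ⊗ dual V) ◁ hc f g ⊗≫ dual U ◁ ev V ▷ (U ⊗ E) ⊗≫
      ev U ▷ E ⊗≫ 𝟙 E = (dual U ◁ mateL f) ▷ U ≫ mateL g := by
  calc
    _ = 𝟙 _ ⊗≫ dual U ◁ (𝟙 ((dual V ⊗ A) ⊗ (V ⊗ U)) ⊗≫ dual V ◁ hc f g ⊗≫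
        ev V ▷ (U ⊗ E) ⊗≫ 𝟙 (U ⊗ E))
        ⊗≫ ev U ▷ E ⊗≫ 𝟙 _ := by monoidal
    _ = 𝟙 _ ⊗≫ dual U ◁ (𝟙 ((dual V ⊗ A) ⊗ (V ⊗ U)) ⊗≫ mateL f ▷ U ≫ g) ⊗≫ ev U ▷ E ⊗≫ 𝟙 _ := by
      rw [← mateL_hc]; monoidal
    _ = _ := by simp only [mateL]; monoidal

theorem mateR_contract {V : C} (u : V ⊗ E ⟶ B ⊗ V) :
    conjObj V A ◁ mateR u ≫ contract V A B =
      𝟙 _ ⊗≫ (dual V ⊗ A) ◁ u ⊗≫ 𝟙 _ := by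
  simp only [mateR, contract]
  calc
    _ = 𝟙 _ ⊗≫ ((dual V ⊗ A) ⊗ V) ◁ (coevR V ▷ E) ⊗≫
        ((dual V ⊗ A) ◁ ((V ⊗ dual V) ◁ u ≫ evR V ▷ (B ⊗ V))) ⊗≫ 𝟙 _ := by monoidal
    _ = 𝟙 _ ⊗≫ (dual V ⊗ A) ◁ (V ◁ coevR V ⊗≫ evR V ▷ V) ▷ E ⊗≫ (dual V ⊗ A) ◁ u ⊗≫ 𝟙 _ := by
      rw [whisker_exchange]; monoidal
    _ = _ := by rw [coevR_evR]; monoidal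

/-- The `evR` of the contraction meets the `coevR` of the mate and straightens, after which `u`
cancels `g`. This evaluates the formula for `φ₂` of a conjugation functor. -/
theorem contract_mateL_vc {V : C} (f : A ⊗ V ⟶ V ⊗ E) (g : B ⊗ V ⟶ V ⊗ F) (u : V ⊗ F ⟶ B ⊗ V)
    (h : u ≫ g = 𝟙 _) :
    conjObj V A ◁ mateR u ≫ contract V A B ≫ mateL (vc f g) = mateL f ▷ F := by
  rw [← Category.assoc, mateR_contract]
  simp only [mateL, vc]
  calc
    _ = 𝟙 _ ⊗≫ (dual V ⊗ A) ◁ (u ≫ g) ⊗≫ dual V ◁ f ▷ F ⊗≫ ev V ▷ (E ⊗ F) ⊗≫ 𝟙 _ := by monoidal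
    _ = _ := by rw [h]; monoidal

theorem mateL_vu (V : C) :
    (coevR V ≫ (ρ_ (dual V)).inv ▷ V) ≫ mateL (vu V) = leftDim V := by
  simp only [mateL, vu, leftDim]; monoidal

theorem insertU_eq {D : ObjectProperty C} (A : RelCenter D) (U : C) (h : D U) :
    insertU A U h = mateR (A.braiding.β U h).inv := by
  simp only [insertU, mateR]; monoidal

end Mates

variable {G : Type w} [Group G] {C : Type u} [Category.{v} C] [Preadditive C]
  [HasFiniteBiproducts C] [MonoidalCategory C] [PivotalCategory C] {𝒢 : PivotalGrading G C}
  {α β γ : G}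

theorem mem_tensor_dual {Y W : C} (hY : 𝒢.comp α Y) (hW : 𝒢.comp α W) :
    𝒢.comp 1 (Y ⊗ dual W) :=
  mem_tensor (mul_inv_cancel α) hY (𝒢.dual_mem hW)

theorem mem_tensor_one {Y X : C} (hX : 𝒢.comp 1 X) (hY : 𝒢.comp α Y) : 𝒢.comp α (Y ⊗ X) :=
  mem_tensor (mul_one α) hY hX

theorem mem_one_tensor {X Y : C} (hX : 𝒢.comp 1 X) (hY : 𝒢.comp α Y) : 𝒢.comp α (X ⊗ Y) :=
  mem_tensor (one_mul α) hX hY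

theorem mem_one_dual {X : C} (hX : 𝒢.comp 1 X) : 𝒢.comp 1 (dual X) := by
  simpa using 𝒢.dual_mem hX

/-! ### The twist attached to an object with invertible dimension -/

/-- The squares `slideOut`, as a family. -/
@[simps]
def slideFam (A : ZG 𝒢) {W : C} (hW : 𝒢.comp α W) : Fam (𝒢.comp α) A.obj (conjObj W A.obj) where
  app {Y} hY := slideOut A Y W (mem_tensor_dual hY hW)
  naturality _ _ f := slideOut_natural A W _ _ f

theorem slideFam_acts (A : ZG 𝒢) {W : C} (hW : 𝒢.comp α W) : (slideFam A hW).Acts A :=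
  fun hX hY hXY => slideOut_tensor A W hX (mem_tensor_dual hY hW) (mem_tensor_dual hXY hW)
    (mem_one_tensor hX (mem_tensor_dual hY hW))

/-- Rebracketing `slideOut ≫ slideIn ≫ slideOut`: one pair is a whiskered slide, the other is the
scalar `d_V`. At `Y = V` its mate is the idempotency of `π`. -/
theorem slideOut_slide (hp : IsPure C) (A : ZG 𝒢) (V : InvDim 𝒢 α) {Y : C} (hY : 𝒢.comp α Y) :
    slideOut A Y V.obj (mem_tensor_dual hY V.mem) ≫ Y ◁ slide A V.obj V.obj (V.mem_slide V) =
      scal (leftDim V.obj) (slideOut A Y V.obj (mem_tensor_dual hY V.mem)) := by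
  rw [← slideIn_slideOut A (mem_tensor_dual hY V.mem) (V.mem_slide V)
    (mem_one_tensor (mem_tensor_dual hY V.mem) (V.mem_slide V)), ← Category.assoc,
    slideOut_slideIn A hp, scal_comp, Category.id_comp]

theorem slide_slide (hp : IsPure C) (A : ZG 𝒢) (V : InvDim 𝒢 α) :
    slide A V.obj V.obj (V.mem_slide V) ≫ slide A V.obj V.obj (V.mem_slide V) =
      scal (leftDim V.obj) (slide A V.obj V.obj (V.mem_slide V)) := by
  rw [slide_eq, ← mateL_post, ← slide_eq, slideOut_slide hp A V V.mem, mateL_scal hp, ← slide_eq]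

theorem piV_idem (hp : IsPure C) (V : InvDim 𝒢 α) (A : ZG 𝒢) : piV V A ≫ piV V A = piV V A := by
  simp only [piV, scal_comp, comp_scal, slide_slide hp, V.scal_dInv]

theorem slideOut_piV (hp : IsPure C) (A : ZG 𝒢) (V : InvDim 𝒢 α) {Y : C} (hY : 𝒢.comp α Y) :
    (slideFam A V.mem).app hY ≫ Y ◁ piV V A = (slideFam A V.mem).app hY := by
  simp only [piV, slideFam_app, hp.whiskerLeft_scal, comp_scal]
  rw [slideOut_slide hp A V hY, V.scal_dInv]

section Split

variable {V : InvDim 𝒢 α} {A : ZG 𝒢} {E : C} {p : conjObj V.obj A.obj ⟶ E}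
  {q : E ⟶ conjObj V.obj A.obj}

theorem twist_hom_inv (hp : IsPure C) (hpq : p ≫ q = piV V A) {Y : C} (hY : 𝒢.comp α Y) :
    ((slideFam A V.mem).post p).app hY ≫
      scal V.dInv (Y ◁ q ≫ slideIn A Y V.obj (mem_tensor_dual hY V.mem)) = 𝟙 _ := by
  simp only [Fam.post_app, Category.assoc, comp_scal, ← whiskerLeft_comp_assoc, hpq]
  rw [← Category.assoc, slideOut_piV hp, slideFam_app, slideOut_slideIn A hp, V.scal_dInv]

theorem twist_inv_hom (hp : IsPure C) (hpq : p ≫ q = piV V A) (hqp : q ≫ p = 𝟙 E) {Y : C}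
    (hY : 𝒢.comp α Y) :
    scal V.dInv (Y ◁ q ≫ slideIn A Y V.obj (mem_tensor_dual hY V.mem)) ≫
      ((slideFam A V.mem).post p).app hY = 𝟙 _ := by
  simp only [Fam.post_app, slideFam_app, Category.assoc, scal_comp]
  rw [← Category.assoc (slideIn _ _ _ _), slideIn_slideOut A (mem_tensor_dual hY V.mem)
    (V.mem_slide V) (mem_one_tensor (mem_tensor_dual hY V.mem) (V.mem_slide V)),
    ← MonoidalCategory.whiskerLeft_comp, ← MonoidalCategory.whiskerLeft_comp,
    ← hp.whiskerLeft_scal, ← comp_scal, ← scal_comp]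
  change Y ◁ (q ≫ piV V A ≫ p) = _
  rw [← hpq, Category.assoc, hqp, Category.comp_id, hqp, MonoidalCategory.whiskerLeft_id]

/-- `slideOut` followed by `slideIn` is invertible, and in the other order it gives a multiple of
`π`. Replacing the conjugate of `A` by the range of `π` therefore makes the square invertible. -/
theorem isTwist_of_split (hp : IsPure C) (hpq : p ≫ q = piV V A) (hqp : q ≫ p = 𝟙 E) :
    ((slideFam A V.mem).post p).IsTwist A where
  acts := Fam.Acts.post (slideFam_acts A V.mem) p
  isIso hY := ⟨_, twist_hom_inv hp hpq hY, twist_inv_hom hp hpq hqp hY⟩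

/-- The bent square at `V` is the slide followed by `p`, and `p` absorbs `π`. Thus `p` can be
recovered from the twist at `V`. -/
theorem mateL_twist (hpq : p ≫ q = piV V A) (hqp : q ≫ p = 𝟙 E) :
    mateL (((slideFam A V.mem).post p).app V.mem) = scal (leftDim V.obj) p := by
  have h : p = scal V.dInv (slide A V.obj V.obj (V.mem_slide V) ≫ p) := by
    rw [← scal_comp]
    change p = piV V A ≫ p
    rw [← hpq, Category.assoc, hqp, Category.comp_id]
  rw [Fam.post_app, slideFam_app, mateL_post, ← slide_eq]
  conv_rhs => rw [h]
  have := V.isIso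
  rw [scal_scal, InvDim.dInv, IsIso.hom_inv_id, scal_id]

/-- `q` is the mate of the inverse of the twist at `V`, because `q` absorbs `π` and the slide is the
mate of `slideIn`. -/
theorem mateR_twist (hp : IsPure C) (hpq : p ≫ q = piV V A) (hqp : q ≫ p = 𝟙 E) :
    q = mateR (scal V.dInv (V.obj ◁ q ≫ slideIn A V.obj V.obj (mem_tensor_dual V.mem V.mem))) := by
  rw [mateR_scal hp, mateR_pre, ← slide_eq_mateR A (V.mem_slide V) 𝒢.unit_mem
    (fun X hX => mem_tensor_one 𝒢.unit_mem hX) (mem_one_tensor (V.mem_slide V) (V.mem_slide V)),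
    ← comp_scal]
  change q = q ≫ piV V A
  rw [← hpq, ← Category.assoc, hqp, Category.id_comp]

/-- If a square at `V` factors through the twist attached to a splitting, then so does the
morphism obtained from it by the left evaluation. -/
theorem split_comp_mateL (hpq : p ≫ q = piV V A) (hqp : q ≫ p = 𝟙 E) {N : C} {m : E ⟶ N}
    {t : A.obj ⊗ V.obj ⟶ V.obj ⊗ N}
    (h : ((slideFam A V.mem).post p).app V.mem ≫ V.obj ◁ m = t) :
    scal V.dInv (q ≫ mateL t) = m := by
  rw [← h, mateL_post, mateL_twist hpq hqp, scal_comp, comp_scal, V.scal_dInv, reassoc_of% hqp]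

end Split

end GCat

end

noncomputable section

namespace GCat

/-! ### Coherence of monoidal functors, tested by squares over one object -/

section Test

variable {C : Type u} [Category.{v} C] [MonoidalCategory C]

/-- Left whiskering with `Y` is injective on morphisms. -/
def WhiskerInj (Y : C) : Prop := ∀ {M N : C} (m m' : M ⟶ N), Y ◁ m = Y ◁ m' → m = m'

theorem WhiskerInj.tensor {Y Z : C} (hY : WhiskerInj Y) (hZ : WhiskerInj Z) :
    WhiskerInj (Y ⊗ Z) := by
  intro M N m m' h
  refine hZ _ _ (hY _ _ ?_)
  simpa using h

theorem WhiskerInj.ext {Y P M N : C} (hY : WhiskerInj Y) (s : P ⟶ Y ⊗ M) [IsIso s] {m m' : M ⟶ N}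
    (h : s ≫ Y ◁ m = s ≫ Y ◁ m') : m = m' :=
  hY _ _ ((cancel_epi s).1 h)

section Coherence

variable {Y Z : C} {A B E A' B' E' AB BE EB ABE ABE' : C} {f : A ⊗ Y ⟶ Y ⊗ A'} {g : B ⊗ Y ⟶ Y ⊗ B'}
  {h : E ⊗ Y ⟶ Y ⊗ E'} {fg : (A ⊗ B) ⊗ Y ⟶ Y ⊗ AB} {gh : (B ⊗ E) ⊗ Y ⟶ Y ⊗ BE}

/-- In this group of lemmas `f`, `g`, `h` play the role of twists at one object `Y`, and the
morphisms `m` that of monoidal constraints, pinned down by carrying a vertical product of twists to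
the twist over the tensor product. Each coherence relation is verified after precomposition with an
invertible square, where it becomes an identity for `vc`. -/
theorem WhiskerInj.map_whiskerRight_mul (hY : WhiskerInj Y) [IsIso f] [IsIso h]
    {fh : (A ⊗ E) ⊗ Y ⟶ Y ⊗ AB} {a : A ⟶ B} {a' : A' ⟶ B'} {a'' : AB ⟶ BE}
    {m : A' ⊗ E' ⟶ AB} {m' : B' ⊗ E' ⟶ BE} (ha : f ≫ Y ◁ a' = a ▷ Y ≫ g)
    (ha' : fh ≫ Y ◁ a'' = a ▷ E ▷ Y ≫ gh) (hm : vc f h ≫ Y ◁ m = fh)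
    (hm' : vc g h ≫ Y ◁ m' = gh) : a' ▷ E' ≫ m' = m ≫ a'' := by
  refine hY.ext (vc f h) ?_
  rw [MonoidalCategory.whiskerLeft_comp, MonoidalCategory.whiskerLeft_comp, ← Category.assoc,
    vc_post_left, ha, pre_vc_left, Category.assoc, hm', reassoc_of% hm, ha']

theorem WhiskerInj.map_whiskerLeft_mul (hY : WhiskerInj Y) [IsIso f] [IsIso h]
    {hf : (E ⊗ A) ⊗ Y ⟶ Y ⊗ AB} {hg : (E ⊗ B) ⊗ Y ⟶ Y ⊗ EB} {a : A ⟶ B} {a' : A' ⟶ B'}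
    {a'' : AB ⟶ EB} {m : E' ⊗ A' ⟶ AB} {m' : E' ⊗ B' ⟶ EB} (ha : f ≫ Y ◁ a' = a ▷ Y ≫ g)
    (ha' : hf ≫ Y ◁ a'' = (E ◁ a) ▷ Y ≫ hg) (hm : vc h f ≫ Y ◁ m = hf)
    (hm' : vc h g ≫ Y ◁ m' = hg) : E' ◁ a' ≫ m' = m ≫ a'' := by
  refine hY.ext (vc h f) ?_
  rw [MonoidalCategory.whiskerLeft_comp, MonoidalCategory.whiskerLeft_comp, ← Category.assoc,
    vc_post_right, ha, pre_vc_right, Category.assoc, hm', reassoc_of% hm, ha']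

theorem WhiskerInj.mul_assoc (hY : WhiskerInj Y) [IsIso f] [IsIso g] [IsIso h]
    {s : ((A ⊗ B) ⊗ E) ⊗ Y ⟶ Y ⊗ ABE} {s' : (A ⊗ (B ⊗ E)) ⊗ Y ⟶ Y ⊗ ABE'}
    {m₁ : A' ⊗ B' ⟶ AB} {m₂ : AB ⊗ E' ⟶ ABE} {m₃ : B' ⊗ E' ⟶ BE} {m₄ : A' ⊗ BE ⟶ ABE'}
    {a : ABE ⟶ ABE'} (h₁ : vc f g ≫ Y ◁ m₁ = fg) (h₂ : vc fg h ≫ Y ◁ m₂ = s)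
    (h₃ : vc g h ≫ Y ◁ m₃ = gh) (h₄ : vc f gh ≫ Y ◁ m₄ = s')
    (ha : s ≫ Y ◁ a = (α_ A B E).hom ▷ Y ≫ s') :
    m₁ ▷ E' ≫ m₂ ≫ a = (α_ A' B' E').hom ≫ A' ◁ m₃ ≫ m₄ := by
  refine hY.ext (vc (vc f g) h) ?_
  simp only [MonoidalCategory.whiskerLeft_comp]
  rw [← Category.assoc, vc_post_left, h₁, reassoc_of% h₂, ha, reassoc_of% vc_assoc f g h,
    ← Category.assoc (vc f _), vc_post_right, h₃, h₄]

theorem WhiskerInj.unit_mul (hY : WhiskerInj Y) [IsIso f] {s : 𝟙_ C ⊗ Y ⟶ Y ⊗ E}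
    {s' : (𝟙_ C ⊗ A) ⊗ Y ⟶ Y ⊗ B'} {e : 𝟙_ C ⟶ E} {m : E ⊗ A' ⟶ B'} {l : B' ⟶ A'}
    (he : vu Y ≫ Y ◁ e = s) (hm : vc s f ≫ Y ◁ m = s')
    (hl : s' ≫ Y ◁ l = (λ_ A).hom ▷ Y ≫ f) : (λ_ A').hom = e ▷ A' ≫ m ≫ l := by
  refine hY.ext (vc (vu Y) f) ?_
  simp only [MonoidalCategory.whiskerLeft_comp]
  rw [vu_vc, ← Category.assoc, vc_post_left, he, reassoc_of% hm, hl]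

theorem WhiskerInj.mul_unit (hY : WhiskerInj Y) [IsIso f] {s : 𝟙_ C ⊗ Y ⟶ Y ⊗ E}
    {s' : (A ⊗ 𝟙_ C) ⊗ Y ⟶ Y ⊗ B'} {e : 𝟙_ C ⟶ E} {m : A' ⊗ E ⟶ B'} {r : B' ⟶ A'}
    (he : vu Y ≫ Y ◁ e = s) (hm : vc f s ≫ Y ◁ m = s')
    (hr : s' ≫ Y ◁ r = (ρ_ A).hom ▷ Y ≫ f) : (ρ_ A').hom = A' ◁ e ≫ m ≫ r := by
  refine hY.ext (vc f (vu Y)) ?_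
  simp only [MonoidalCategory.whiskerLeft_comp]
  rw [vc_vu, ← Category.assoc, vc_post_right, he, reassoc_of% hm, hr]

theorem WhiskerInj.map_mul (hY : WhiskerInj Y) [IsIso f] [IsIso g] {A₁ B₁ AB₁ : C}
    {f₁ : A ⊗ Y ⟶ Y ⊗ A₁} {g₁ : B ⊗ Y ⟶ Y ⊗ B₁} {fg₁ : (A ⊗ B) ⊗ Y ⟶ Y ⊗ AB₁}
    {m : A' ⊗ B' ⟶ AB} {m₁ : A₁ ⊗ B₁ ⟶ AB₁} {a : A' ⟶ A₁} {b : B' ⟶ B₁} {ab : AB ⟶ AB₁}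
    (hm : vc f g ≫ Y ◁ m = fg) (hm₁ : vc f₁ g₁ ≫ Y ◁ m₁ = fg₁) (ha : f ≫ Y ◁ a = f₁)
    (hb : g ≫ Y ◁ b = g₁) (hab : fg ≫ Y ◁ ab = fg₁) : m ≫ ab = (a ⊗ₘ b) ≫ m₁ := by
  refine hY.ext (vc f g) ?_
  simp only [MonoidalCategory.whiskerLeft_comp]
  rw [reassoc_of% hm, hab, ← Category.assoc, ← vc_post, ha, hb, hm₁]

theorem WhiskerInj.map_unit (hY : WhiskerInj Y) {s : 𝟙_ C ⊗ Y ⟶ Y ⊗ E} {s₁ : 𝟙_ C ⊗ Y ⟶ Y ⊗ E'}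
    {e : 𝟙_ C ⟶ E} {e₁ : 𝟙_ C ⟶ E'} {a : E ⟶ E'} (he : vu Y ≫ Y ◁ e = s)
    (he₁ : vu Y ≫ Y ◁ e₁ = s₁) (ha : s ≫ Y ◁ a = s₁) : e ≫ a = e₁ := by
  refine hY.ext (vu Y) ?_
  rw [MonoidalCategory.whiskerLeft_comp, reassoc_of% he, ha, he₁]

/-- By interchange, the constraint of a composite functor is tested by horizontal composites of
squares. -/
theorem hc_mul {A'' B'' AB' AB'' : C} {f' : A' ⊗ Z ⟶ Z ⊗ A''} {g' : B' ⊗ Z ⟶ Z ⊗ B''}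
    {fg' : AB ⊗ Z ⟶ Z ⊗ AB''} {s : (A' ⊗ B') ⊗ Z ⟶ Z ⊗ AB'} {m : A' ⊗ B' ⟶ AB}
    {m' : A'' ⊗ B'' ⟶ AB'} {a : AB' ⟶ AB''} (hm : vc f g ≫ Y ◁ m = fg)
    (hm' : vc f' g' ≫ Z ◁ m' = s) (ha : s ≫ Z ◁ a = m ▷ Z ≫ fg') :
    vc (hc f f') (hc g g') ≫ (Y ⊗ Z) ◁ (m' ≫ a) = hc fg fg' := by
  rw [← hc_vc, ← hc_post, MonoidalCategory.whiskerLeft_comp, reassoc_of% hm', ha, ← hc_mid, hm]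

theorem hc_unit {A'' B'' : C} {f : 𝟙_ C ⊗ Y ⟶ Y ⊗ A'} {s : 𝟙_ C ⊗ Z ⟶ Z ⊗ A''}
    {g : A' ⊗ Z ⟶ Z ⊗ B''} {e : 𝟙_ C ⟶ A'} {e' : 𝟙_ C ⟶ A''} {a : A'' ⟶ B''}
    (he : vu Y ≫ Y ◁ e = f) (he' : vu Z ≫ Z ◁ e' = s) (ha : s ≫ Z ◁ a = e ▷ Z ≫ g) :
    vu (Y ⊗ Z) ≫ (Y ⊗ Z) ◁ (e' ≫ a) = hc f g := by
  rw [← hc_vu, ← hc_post, MonoidalCategory.whiskerLeft_comp, reassoc_of% he', ha, ← hc_mid, he]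

end Coherence

variable {D : ObjectProperty C}

/-- The squares `s` at the object `Y` are compatible with the action of the functor `Φ` on
morphisms. -/
def MapTest (Φ : RelCenter D ⥤ RelCenter D) {Y : C} (s : ∀ A, A.obj ⊗ Y ⟶ Y ⊗ (Φ.obj A).obj) :
    Prop :=
  ∀ {A B : RelCenter D} (f : A ⟶ B), s A ≫ Y ◁ (Φ.map f).f = f.f ▷ Y ≫ s B

variable {Φ Ψ : RelCenter D ⥤ RelCenter D} {Y Z : C} {s : ∀ A, A.obj ⊗ Y ⟶ Y ⊗ (Φ.obj A).obj}
  {t : ∀ A, A.obj ⊗ Y ⟶ Y ⊗ (Ψ.obj A).obj}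

/-- A lax monoidal structure which is determined by squares at one object. -/
abbrev laxOfTest (hY : WhiskerInj Y) (hs : ∀ A, IsIso (s A)) (h : MapTest Φ s)
    (e : 𝟙_ (RelCenter D) ⟶ Φ.obj (𝟙_ _)) (m : ∀ A B, Φ.obj A ⊗ Φ.obj B ⟶ Φ.obj (A ⊗ B))
    (he : vu Y ≫ Y ◁ e.f = s (𝟙_ _)) (hm : ∀ A B, vc (s A) (s B) ≫ Y ◁ (m A B).f = s (A ⊗ B)) :
    Φ.LaxMonoidal where
  ε := e
  μ := m
  μ_natural_left {A B} f X :=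
    RelCenter.hom_ext (hY.map_whiskerRight_mul (h f) (h (f ▷ X)) (hm A X) (hm B X))
  μ_natural_right {A B} X f :=
    RelCenter.hom_ext (hY.map_whiskerLeft_mul (h f) (h (X ◁ f)) (hm X A) (hm X B))
  associativity A B E :=
    RelCenter.hom_ext (hY.mul_assoc (hm A B) (hm (A ⊗ B) E) (hm B E) (hm A (B ⊗ E))
      (h (α_ A B E).hom))
  left_unitality A := RelCenter.hom_ext (hY.unit_mul he (hm (𝟙_ _) A) (h (λ_ A).hom))
  right_unitality A := RelCenter.hom_ext (hY.mul_unit he (hm A (𝟙_ _)) (h (ρ_ A).hom))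

/-- The squares `s` at the object `Y` are compatible with the monoidal functor `Φ`. -/
structure IsTest (Φ : RelCenter D ⥤ RelCenter D) [Φ.LaxMonoidal] {Y : C}
    (s : ∀ A, A.obj ⊗ Y ⟶ Y ⊗ (Φ.obj A).obj) : Prop where
  map : MapTest Φ s
  mu : ∀ A B, vc (s A) (s B) ≫ Y ◁ (Functor.LaxMonoidal.μ Φ A B).f = s (A ⊗ B)
  eps : vu Y ≫ Y ◁ (Functor.LaxMonoidal.ε Φ).f = s (𝟙_ _)

theorem IsTest.comp [Φ.LaxMonoidal] [Ψ.LaxMonoidal] {t : ∀ A, A.obj ⊗ Z ⟶ Z ⊗ (Ψ.obj A).obj}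
    (hs : IsTest Φ s) (ht : IsTest Ψ t) : IsTest (Φ ⋙ Ψ) (fun A => hc (s A) (t (Φ.obj A))) where
  map {A B} f := by
    change _ ≫ _ ◁ (Ψ.map (Φ.map f)).f = _
    rw [← hc_post, ht.map, ← hc_mid, hs.map, pre_hc]
  mu A B := hc_mul (hs.mu A B) (ht.mu (Φ.obj A) (Φ.obj B)) (ht.map (Functor.LaxMonoidal.μ Φ A B))
  eps := hc_unit hs.eps ht.eps (ht.map (Functor.LaxMonoidal.ε Φ))

theorem isTest_id (hY : D Y) : IsTest (𝟭 (RelCenter D)) (fun A => A.σ hY) where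
  map f := (f.comm hY).symm
  mu A B := by
    rw [Functor.LaxMonoidal.id_μ]
    change _ ≫ Y ◁ 𝟙 _ = _
    rw [MonoidalCategory.whiskerLeft_id, Category.comp_id]
    rfl
  eps := by
    rw [Functor.LaxMonoidal.id_ε]
    change _ ≫ Y ◁ 𝟙 _ = _
    rw [MonoidalCategory.whiskerLeft_id, Category.comp_id]
    rfl

/-- A natural isomorphism which is determined by squares at one object. -/
def natIsoOfTest (hY : WhiskerInj Y) (hs : ∀ A, IsIso (s A)) (hs' : MapTest Φ s)
    (ht' : MapTest Ψ t) (e : ∀ A, Φ.obj A ≅ Ψ.obj A) (he : ∀ A, s A ≫ Y ◁ (e A).hom.f = t A) :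
    Φ ≅ Ψ :=
  NatIso.ofComponents e fun {A B} f => by
    apply RelCenter.hom_ext
    refine hY.ext (s A) ?_
    simp only [RelCenter.comp_f, MonoidalCategory.whiskerLeft_comp]
    rw [reassoc_of% hs' f, he, reassoc_of% he A, ht' f]

theorem isMonoidal_of_test [Φ.LaxMonoidal] [Ψ.LaxMonoidal] (hY : WhiskerInj Y)
    (hs : ∀ A, IsIso (s A)) (hs' : IsTest Φ s) (ht' : IsTest Ψ t) (τ : Φ ⟶ Ψ)
    (hτ : ∀ A, s A ≫ Y ◁ (τ.app A).f = t A) : NatTrans.IsMonoidal τ where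
  unit := RelCenter.hom_ext (hY.map_unit hs'.eps ht'.eps (hτ _))
  tensor A B := RelCenter.hom_ext (by
    have := hY.map_mul (hs'.mu A B) (ht'.mu A B) (hτ A) (hτ B) (hτ _)
    rw [← RelCenter.tensorHom_f] at this
    exact this)

end Test

end GCat

end

noncomputable section

namespace GCat

/-! ### Slides followed by a projection -/

section Mates

variable {C : Type u} [Category.{v} C] [MonoidalCategory C] [TwoSidedDuals C]
  {D : ObjectProperty C} (A : RelCenter D) {E : C}

theorem slideX_post (V X : C) (h : D ((V ⊗ X) ⊗ dual V)) (p : conjObj V A.obj ⟶ E) :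
    slideX A V X h ≫ X ◁ p = 𝟙 _ ⊗≫ dual V ◁ (slideOut A (V ⊗ X) V h ≫ (V ⊗ X) ◁ p) ⊗≫
      ev V ▷ (X ⊗ E) ⊗≫ 𝟙 _ := by
  rw [slideX_eq]
  calc
    _ = 𝟙 _ ⊗≫ dual V ◁ slideOut A (V ⊗ X) V h ⊗≫
        (ev V ▷ (X ⊗ conjObj V A.obj) ≫ 𝟙_ C ◁ (X ◁ p)) ⊗≫ 𝟙 _ := by monoidal
    _ = _ := by rw [← whisker_exchange]; monoidal

theorem slide2_post (U V W : C) (h : D ((V ⊗ U) ⊗ dual W)) (p : conjObj W A.obj ⟶ E) :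
    slide2 A U V W h ≫ p =
      𝟙 _ ⊗≫ (dual U ⊗ dual V) ◁ (slideOut A (V ⊗ U) W h ≫ (V ⊗ U) ◁ p) ⊗≫
      dual U ◁ ev V ▷ (U ⊗ E) ⊗≫ ev U ▷ E ⊗≫ 𝟙 E := by
  rw [slide2_eq]
  calc
    _ = 𝟙 _ ⊗≫ (dual U ⊗ dual V) ◁ slideOut A (V ⊗ U) W h ⊗≫
        dual U ◁ ev V ▷ (U ⊗ conjObj W A.obj) ⊗≫
        (ev U ▷ conjObj W A.obj ≫ 𝟙_ C ◁ p) ⊗≫ 𝟙 _ := by monoidal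
    _ = 𝟙 _ ⊗≫ (dual U ⊗ dual V) ◁ slideOut A (V ⊗ U) W h ⊗≫
        dual U ◁ (ev V ▷ (U ⊗ conjObj W A.obj) ≫ 𝟙_ C ◁ (U ◁ p)) ⊗≫
        ev U ▷ E ⊗≫ 𝟙 _ := by rw [← whisker_exchange]; monoidal
    _ = _ := by rw [← whisker_exchange]; monoidal

end Mates

variable {G : Type w} [Group G] {C : Type u} [Category.{v} C] [Preadditive C]
  [HasFiniteBiproducts C] [MonoidalCategory C] [PivotalCategory C] {𝒢 : PivotalGrading G C}
  {α β γ : G}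

/-! ### Explicit formulas in terms of twists -/

section Split

variable {V : InvDim 𝒢 α} {A B : ZG 𝒢} {E F N : C} {p : conjObj V.obj A.obj ⟶ E}
  {q : E ⟶ conjObj V.obj A.obj}

theorem scal_mateL_twist (hpq : p ≫ q = piV V A) (hqp : q ≫ p = 𝟙 E) :
    scal V.dInv (mateL (((slideFam A V.mem).post p).app V.mem)) = p := by
  rw [mateL_twist hpq hqp, V.scal_dInv]

/-- The pattern of the `split` lemmas: a morphism with the required property at `V` is given, and
the explicit formula is shown to be equal to it. Here the slide followed by `p` is a mate of a
horizontal product, which contributes `d_V p`; then `d_V⁻¹` and `q` cancel. -/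
theorem split_slideX (hpq : p ≫ q = piV V A) (hqp : q ≫ p = 𝟙 E) {X : C} (hX : 𝒢.comp 1 X)
    {g : E ⊗ X ⟶ X ⊗ E}
    (hg : ((slideFam A V.mem).post p).Divides ((slideFam A V.mem).post p) g) :
    scal V.dInv (q ▷ X ≫ slideX A V.obj X (V.mem_slideX V hX) ≫ X ◁ p) = g := by
  have h : slideX A V.obj X (V.mem_slideX V hX) ≫ X ◁ p = scal (leftDim V.obj) (p ▷ X ≫ g) := by
    rw [slideX_post, ← scal_comp, ← scal_whiskerRight, ← mateL_twist hpq hqp, ← mateL_hc,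
      hg V.obj V.mem (mem_tensor_one hX V.mem)]
    rfl
  rw [h, comp_scal, V.scal_dInv, ← comp_whiskerRight_assoc, hqp, id_whiskerRight,
    Category.id_comp]

theorem split_conj (hpq : p ≫ q = piV V A) (hqp : q ≫ p = 𝟙 E) {p' : conjObj V.obj B.obj ⟶ F}
    {q' : F ⟶ conjObj V.obj B.obj} (hpq' : p' ≫ q' = piV V B) (hqp' : q' ≫ p' = 𝟙 F)
    {f : A.obj ⟶ B.obj} {m : E ⟶ F} (h : ((slideFam A V.mem).post p).app V.mem ≫ V.obj ◁ m =
      f ▷ V.obj ≫ ((slideFam B V.mem).post p').app V.mem) :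
    q ≫ (dual V.obj ◁ f) ▷ V.obj ≫ p' = m := by
  conv_lhs => rw [← scal_mateL_twist hpq' hqp']
  rw [comp_scal, comp_scal, conj_mateL]
  exact split_comp_mateL hpq hqp h

/-- Writing `q₁` as the mate of an inverse twist lets the contraction straighten, so that the twist
over `B` disappears; what remains is `d_V p`, which `q` cancels. -/
theorem split_contract (hp : IsPure C) (hpq : p ≫ q = piV V A) (hqp : q ≫ p = 𝟙 E)
    {p₁ : conjObj V.obj B.obj ⟶ F} {q₁ : F ⟶ conjObj V.obj B.obj} (hpq₁ : p₁ ≫ q₁ = piV V B)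
    (hqp₁ : q₁ ≫ p₁ = 𝟙 F) {p₂ : conjObj V.obj (A ⊗ B).obj ⟶ N}
    {q₂ : N ⟶ conjObj V.obj (A ⊗ B).obj} (hpq₂ : p₂ ≫ q₂ = piV V (A ⊗ B)) (hqp₂ : q₂ ≫ p₂ = 𝟙 N)
    {m : E ⊗ F ⟶ N} (h : vc (((slideFam A V.mem).post p).app V.mem)
      (((slideFam B V.mem).post p₁).app V.mem) ≫ V.obj ◁ m =
      ((slideFam (A ⊗ B) V.mem).post p₂).app V.mem) :
    (q ⊗ₘ q₁) ≫ contract V.obj A.obj B.obj ≫ p₂ = m := by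
  have hm : p₂ = scal V.dInv (mateL (vc (((slideFam A V.mem).post p).app V.mem)
      (((slideFam B V.mem).post p₁).app V.mem)) ≫ m) := by
    rw [← mateL_post]
    exact (scal_mateL_twist (A := A ⊗ B) hpq₂ hqp₂).symm.trans
      (congrArg (fun t => scal V.dInv (mateL t)) h.symm)
  have hq : conjObj V.obj A.obj ◁ q₁ ≫ contract V.obj A.obj B.obj ≫
      mateL (vc (((slideFam A V.mem).post p).app V.mem)
        (((slideFam B V.mem).post p₁).app V.mem)) = scal (leftDim V.obj) (p ▷ F) := by
    rw [← scal_whiskerRight, ← mateL_twist hpq hqp]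
    refine (congrArg (fun t => conjObj V.obj A.obj ◁ t ≫ _)
      (mateR_twist hp hpq₁ hqp₁)).trans ?_
    exact contract_mateL_vc _ _ _ (twist_inv_hom hp hpq₁ hqp₁ V.mem)
  rw [hm, comp_scal, comp_scal, MonoidalCategory.tensorHom_def, Category.assoc, reassoc_of% hq,
    scal_comp, comp_scal, V.scal_dInv, ← comp_whiskerRight_assoc, hqp, id_whiskerRight,
    Category.id_comp]

theorem split_unit {p : conjObj V.obj (𝟙_ C) ⟶ E} {q : E ⟶ conjObj V.obj (𝟙_ C)}
    (hpq : p ≫ q = piV V (𝟙_ (ZG 𝒢))) (hqp : q ≫ p = 𝟙 E) {m : 𝟙_ C ⟶ E}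
    (h : vu V.obj ≫ V.obj ◁ m = ((slideFam (𝟙_ (ZG 𝒢)) V.mem).post p).app V.mem) :
    (coevR V.obj ≫ (ρ_ (dual V.obj)).inv ▷ V.obj) ≫ p = m := by
  have hm : p = scal V.dInv (mateL (vu V.obj) ≫ m) := by
    rw [← mateL_post]
    exact (scal_mateL_twist (A := 𝟙_ (ZG 𝒢)) hpq hqp).symm.trans
      (congrArg (fun t => scal V.dInv (mateL t)) h.symm)
  conv_lhs => rw [hm]
  have := V.isIso
  rw [comp_scal, ← Category.assoc, mateL_vu, ← scal_comp, InvDim.dInv]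
  simp [scal, unitors_equal, unitors_inv_equal]

theorem split_slide (hpq : p ≫ q = piV V A) (hqp : q ≫ p = 𝟙 E) {U : InvDim 𝒢 α}
    {p' : conjObj U.obj A.obj ⟶ F} {m : E ⟶ F}
    (h : ((slideFam A V.mem).post p).app V.mem ≫ V.obj ◁ m =
      ((slideFam A U.mem).post p').app V.mem) :
    scal V.dInv (q ≫ slide A V.obj U.obj (V.mem_slide U) ≫ p') = m := by
  rw [slide_eq, ← mateL_post]
  exact split_comp_mateL hpq hqp h

/-- Each of the two evaluations turns one factor of the horizontal product into a dimension times a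
projection, which accounts for both inverse dimensions in `ζ`. -/
theorem split_slide2 (hp : IsPure C) (hpq : p ≫ q = piV V A) (hqp : q ≫ p = 𝟙 E) {U : InvDim 𝒢 β}
    {W : InvDim 𝒢 γ} (hγ : α * β = γ) {p₁ : conjObj U.obj E ⟶ F}
    {q₁ : F ⟶ conjObj U.obj E} {s : E ⊗ U.obj ⟶ U.obj ⊗ F}
    (hs : mateL s = scal (leftDim U.obj) p₁) (hqp₁ : q₁ ≫ p₁ = 𝟙 F)
    {p₂ : conjObj W.obj A.obj ⟶ N} {m : F ⟶ N}
    (h : hc (((slideFam A V.mem).post p).app V.mem) s ≫ (V.obj ⊗ U.obj) ◁ m =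
      ((slideFam A W.mem).post p₂).app (mem_tensor hγ V.mem U.mem)) :
    scal U.dInv (scal V.dInv (q₁ ≫ (dual U.obj ◁ q) ▷ U.obj ≫
      slide2 A U.obj V.obj W.obj (InvDim.mem_slide2 hγ U V W) ≫ p₂)) = m := by
  have key : slide2 A U.obj V.obj W.obj (InvDim.mem_slide2 hγ U V W) ≫ p₂ =
      (dual U.obj ◁ scal (leftDim V.obj) p) ▷ U.obj ≫ scal (leftDim U.obj) p₁ ≫ m := by
    rw [slide2_post, ← mateL_twist hpq hqp, ← hs, ← mateL_post, ← mateL_hc_hc,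
      hc_post, h]
    rfl
  rw [key, hp.whiskerLeft_scal, scal_whiskerRight, scal_comp, comp_scal, comp_scal, V.scal_dInv,
    scal_comp, comp_scal, comp_scal, comp_scal, U.scal_dInv]
  rw [← comp_whiskerRight_assoc, ← MonoidalCategory.whiskerLeft_comp, hqp,
    MonoidalCategory.whiskerLeft_id, id_whiskerRight, Category.id_comp, reassoc_of% hqp₁]

theorem split_insertU {U : InvDim 𝒢 (1 : G)} {p : conjObj U.obj A.obj ⟶ E}
    {q : E ⟶ conjObj U.obj A.obj} (hpq : p ≫ q = piV U A) (hqp : q ≫ p = 𝟙 E)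
    {m : A.obj ⟶ E} (h : A.σ U.mem ≫ U.obj ◁ m = ((slideFam A U.mem).post p).app U.mem) :
    insertU A U.obj U.mem ≫ p = m := by
  conv_lhs => rw [← scal_mateL_twist hpq hqp, ← h]
  rw [insertU_eq, comp_scal, mateL_post, ← Category.assoc,
    mateR_mateL_self _ _ (Iso.inv_hom_id _), scal_comp, U.scal_dInv, Category.id_comp]

end Split

end GCat

end

noncomputable section

namespace GCat

variable {G : Type w} [Group G] {C : Type u} [Category.{v} C] [Preadditive C]
  [HasFiniteBiproducts C] [MonoidalCategory C] [PivotalCategory C] {𝒢 : PivotalGrading G C}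
  {α β γ : G}

/-! ### Families with values in the center -/

namespace Fam

/-- A family with values in an object of the center is compatible with its half braiding. -/
def Braids {A : C} {B : ZG 𝒢} (S : Fam (𝒢.comp α) A B.obj) : Prop :=
  ∀ {X : C} (hX : 𝒢.comp 1 X), S.Divides S (B.σ hX)

section

variable {A : C} {B E : ZG 𝒢} {S : Fam (𝒢.comp α) A B.obj} {R : Fam (𝒢.comp γ) A E.obj}
  {Q : Fam (𝒢.comp β) B.obj E.obj}

/-- The quotient of two families is a twist. -/
theorem isTwist_of_divides (hS : S.Detects) (hR : R.Detects) (h : α * β = γ) (hSB : Braids S)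
    (hQ : ∀ {Z : C} (hZ : 𝒢.comp β Z), S.Divides R (Q.app hZ))
    (hQ' : ∀ {Z : C} (_ : 𝒢.comp β Z), ∃ g : E.obj ⊗ dual Z ⟶ dual Z ⊗ B.obj, R.Divides S g) :
    Q.IsTwist B where
  acts {X Z} hX hZ hXZ := hS.unique (fun _ hY => mem_tensor h hY hXZ) (hQ hXZ)
    ((hSB hX).comp (fun _ hY => mem_tensor_one hX hY) (fun _ hY => mem_tensor h hY hZ) (hQ hZ))
  isIso {Z} hZ := by
    obtain ⟨g, hg⟩ := hQ' hZ
    exact hS.isIso_of_divides hR (fun _ hY => mem_tensor h hY hZ)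
      (fun _ hY => mem_tensor (by rw [← h, mul_inv_cancel_right]) hY (𝒢.dual_mem hZ))
      (fun _ hY => mem_tensor_one 𝒢.unit_mem hY) (fun _ hY => mem_tensor_one 𝒢.unit_mem hY)
      (fun _ hY => mem_tensor_one (mem_tensor_dual hZ hZ) hY)
      (fun _ hY => mem_tensor_one (mem_tensor (inv_mul_cancel β) (𝒢.dual_mem hZ) hZ) hY)
      (hQ hZ) hg

/-- Both sides divide `R` by `S` over `Z ⊗ X`, so uniqueness of quotients applies. -/
theorem braids_of_divides (hS : S.Detects) (h : α * β = γ) (hRE : Braids R)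
    (hQ : ∀ {Z : C} (hZ : 𝒢.comp β Z), S.Divides R (Q.app hZ)) : Braids Q :=
  fun {_} hX _ hZ hZX => hS.unique (fun _ hY => mem_tensor h hY hZX)
    ((hQ hZ).comp (fun _ hY => mem_tensor h hY hZ) (fun _ hY => mem_tensor_one hX hY) (hRE hX))
    (hQ hZX)

theorem Braids.post (hS : Braids S) (m : B ⟶ E) : Braids (B := E) (S.post m.f) := by
  intro X hX Y hY hYX
  simp only [post_app]
  rw [hc_mid, m.comm, hc_post, hS hX Y hY hYX]

end

theorem Braids.tensor {A A' : C} {B B' : ZG 𝒢} {S : Fam (𝒢.comp α) A B.obj}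
    {S' : Fam (𝒢.comp α) A' B'.obj} (hS : Braids S) (hS' : Braids S') :
    Braids (B := B ⊗ B') (S.tensor S') := by
  intro X hX Y hY hYX
  refine (hc_vc _ _ _ _).trans ?_
  rw [hS hX Y hY hYX, hS' hX Y hY hYX, tensor_app]

theorem braids_unit (α : G) : Braids (B := 𝟙_ (ZG 𝒢)) (Fam.unit (𝒢.comp α)) :=
  fun {_} _ _ _ _ => hc_vu _ _

theorem braids_fam (A : ZG 𝒢) : Braids A.fam := fun {_} hX => A.fam_divides hX

variable {A B E F : ZG 𝒢}

/-- The morphism given by descent lies in the center because the half braidings of `B` and `E` are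
the quotients of `S` and `T` by themselves. -/
theorem IsTwist.exists_centerHom (hp : IsPure C) (V : InvDim 𝒢 α)
    {S : Fam (𝒢.comp α) A.obj B.obj} (hS : S.IsTwist A) (hSB : Braids S)
    {T : Fam (𝒢.comp α) A.obj E.obj} (hT : T.Acts A) (hTE : Braids T) :
    ∃ m : B ⟶ E, ∀ {Y : C} (hY : 𝒢.comp α Y), S.app hY ≫ Y ◁ m.f = T.app hY := by
  obtain ⟨m, hm⟩ := hS.exists_hom hp V hT
  exact ⟨{ f := m
           comm := fun {X} hX => Detects.comm_of_divides (hS.detects V) hm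
             (fun _ hY => mem_tensor_one hX hY) (hSB hX) (hTE hX) }, hm⟩

theorem IsTwist.exists_iso (hp : IsPure C) (V : InvDim 𝒢 α)
    {S : Fam (𝒢.comp α) A.obj B.obj} (hS : S.IsTwist A) (hSB : Braids S)
    {T : Fam (𝒢.comp α) A.obj E.obj} (hT : T.IsTwist A) (hTE : Braids T) :
    ∃ e : B ≅ E, ∀ {Y : C} (hY : 𝒢.comp α Y), S.app hY ≫ Y ◁ e.hom.f = T.app hY := by
  obtain ⟨m, hm⟩ := hS.exists_centerHom hp V hSB hT.acts hTE
  obtain ⟨n, hn⟩ := hT.exists_centerHom hp V hTE hS.acts hSB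
  refine ⟨⟨m, n, ?_, ?_⟩, hm⟩
  · apply RelCenter.hom_ext
    refine Detects.hom_ext (hS.detects V) fun {Y} hY => ?_
    simp [reassoc_of% hm hY, hn hY]
  · apply RelCenter.hom_ext
    refine Detects.hom_ext (hT.detects V) fun {Y} hY => ?_
    simp [reassoc_of% hn hY, hm hY]

/-- The quotient of two twists. -/
theorem IsTwist.exists_quotient (hp : IsPure C) (V : InvDim 𝒢 α) (W : InvDim 𝒢 γ)
    (h : α * β = γ) {S : Fam (𝒢.comp α) A.obj B.obj} (hS : S.IsTwist A) (hSB : Braids S)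
    {R : Fam (𝒢.comp γ) A.obj E.obj} (hR : R.IsTwist A) (hRE : Braids R) :
    ∃ Q : Fam (𝒢.comp β) B.obj E.obj, Q.IsTwist B ∧ Braids Q ∧
      ∀ {Z : C} (hZ : 𝒢.comp β Z), S.Divides R (Q.app hZ) := by
  choose g hg using fun (Z : C) (hZ : 𝒢.comp β Z) => hS.exists_divides hp V hR.acts h hZ
  have hQ : ∃ Q : Fam (𝒢.comp β) B.obj E.obj,
      ∀ {Z : C} (hZ : 𝒢.comp β Z), S.Divides R (Q.app hZ) :=
    ⟨{ app := fun {Z} hZ => g Z hZ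
       naturality := fun hZ hZ' f => Detects.natural (hS.detects V) (fun _ hY => mem_tensor h hY hZ)
         (fun _ hY => mem_tensor h hY hZ') (hg _ hZ) (hg _ hZ') f }, fun hZ => hg _ hZ⟩
  obtain ⟨Q, hQ⟩ := hQ
  exact ⟨Q, isTwist_of_divides (hS.detects V) (hR.detects W) h hSB hQ
    (fun hZ => hR.exists_divides hp W hS.acts (by rw [← h, mul_inv_cancel_right])
      (𝒢.dual_mem hZ)), braids_of_divides (hS.detects V) h hRE hQ, hQ⟩

/-- The comparison of the composite of two twists with a third one. -/
theorem IsTwist.exists_mulIso (hp : IsPure C) (U : InvDim 𝒢 α) (V : InvDim 𝒢 β)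
    (W : InvDim 𝒢 γ) (h : β * α = γ) {S : Fam (𝒢.comp β) A.obj B.obj} (hS : S.IsTwist A)
    (hSB : Braids S) {T : Fam (𝒢.comp α) B.obj E.obj} (hT : T.IsTwist B) (hTE : Braids T)
    {R : Fam (𝒢.comp γ) A.obj F.obj} (hR : R.IsTwist A) (hRF : Braids R) :
    ∃ e : E ≅ F, ∀ {Y' Y : C} (hY' : 𝒢.comp β Y') (hY : 𝒢.comp α Y),
      hc (S.app hY') (T.app hY) ≫ (Y' ⊗ Y) ◁ e.hom.f = R.app (mem_tensor h hY' hY) := by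
  -- The quotient `R/S` is a twist over `B` of the same degree as `T`, so these two can be compared.
  obtain ⟨Q, hQ, hQF, hSQ⟩ := hS.exists_quotient hp V W h hSB hR hRF
  obtain ⟨e, he⟩ := hT.exists_iso hp U hTE hQ hQF
  exact ⟨e, fun {Y' Y} hY' hY => by rw [← hc_post, he, hSQ hY Y' hY']⟩

end Fam

/-! ### Functors given by twists -/

/-- A monoidal endofunctor of the center is given by the twists `fam A`. -/
structure TwistSystem (Φ : ZG 𝒢 ⥤ ZG 𝒢) [Φ.LaxMonoidal] (α : G) where
  fam : ∀ A : ZG 𝒢, Fam (𝒢.comp α) A.obj (Φ.obj A).obj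
  isTwist : ∀ A : ZG 𝒢, (fam A).IsTwist A
  braids : ∀ A : ZG 𝒢, Fam.Braids (fam A)
  isTest : ∀ {Y : C} (hY : 𝒢.comp α Y), IsTest Φ (fun A => (fam A).app hY)

namespace TwistSystem

variable {Φ Ψ Ω : ZG 𝒢 ⥤ ZG 𝒢} [Φ.LaxMonoidal] [Ψ.LaxMonoidal] [Ω.LaxMonoidal]

variable (𝒢) in
/-- The identity functor is given by the half braidings. -/
def id : TwistSystem (𝟭 (ZG 𝒢)) (1 : G) where
  fam A := A.fam
  isTwist A := Fam.isTwist_fam A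
  braids A := Fam.braids_fam A
  isTest hY := isTest_id hY

theorem _root_.GCat.InvDim.whiskerInj (V : InvDim 𝒢 α) : WhiskerInj V.obj :=
  fun m m' h => V.whiskerLeft_injective m m' h

/-- Objectwise comparison of twists; naturality and monoidality are tested at `V`. It produces both
the cone `ι` and the isomorphism `φ₀`, the identity functor being of degree `1`. -/
theorem exists_iso (hp : IsPure C) (V : InvDim 𝒢 α) (S : TwistSystem Φ α) (T : TwistSystem Ψ α) :
    ∃ e : Φ ≅ Ψ, NatTrans.IsMonoidal e.hom ∧ ∀ (A : ZG 𝒢) {Y : C} (hY : 𝒢.comp α Y),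
      (S.fam A).app hY ≫ Y ◁ (e.hom.app A).f = (T.fam A).app hY := by
  choose e he using fun A =>
    (S.isTwist A).exists_iso hp V (S.braids A) (T.isTwist A) (T.braids A)
  refine ⟨natIsoOfTest V.whiskerInj (fun A => (S.isTwist A).isIso V.mem) (S.isTest V.mem).map
    (T.isTest V.mem).map e (fun A => he A V.mem), ?_, fun A Y hY => he A hY⟩
  exact isMonoidal_of_test V.whiskerInj (fun A => (S.isTwist A).isIso V.mem) (S.isTest V.mem)
    (T.isTest V.mem) _ (fun A => he A V.mem)

theorem exists_mulIso (hp : IsPure C) (U : InvDim 𝒢 α) (V : InvDim 𝒢 β) (W : InvDim 𝒢 γ)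
    (h : β * α = γ) (S : TwistSystem Φ β) (T : TwistSystem Ψ α) (R : TwistSystem Ω γ) :
    ∃ e : Φ ⋙ Ψ ≅ Ω, NatTrans.IsMonoidal e.hom ∧
      ∀ (A : ZG 𝒢) {Y' Y : C} (hY' : 𝒢.comp β Y') (hY : 𝒢.comp α Y),
        hc ((S.fam A).app hY') ((T.fam (Φ.obj A)).app hY) ≫ (Y' ⊗ Y) ◁ (e.hom.app A).f =
          (R.fam A).app (mem_tensor h hY' hY) := by
  choose e he using fun A =>
    (S.isTwist A).exists_mulIso hp U V W h (S.braids A) (T.isTwist (Φ.obj A))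
      (T.braids (Φ.obj A)) (R.isTwist A) (R.braids A)
  have hVU : WhiskerInj (V.obj ⊗ U.obj) := WhiskerInj.tensor V.whiskerInj U.whiskerInj
  have hi : ∀ A, IsIso (hc ((S.fam A).app V.mem) ((T.fam (Φ.obj A)).app U.mem)) := fun A => by
    have := (S.isTwist A).isIso V.mem
    have := (T.isTwist (Φ.obj A)).isIso U.mem
    infer_instance
  have ht := (S.isTest V.mem).comp (T.isTest U.mem)
  have hr := R.isTest (mem_tensor h V.mem U.mem)
  exact ⟨natIsoOfTest hVU hi ht.map hr.map e (fun A => he A V.mem U.mem),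
    isMonoidal_of_test hVU hi ht hr _ (fun A => he A V.mem U.mem), fun A Y' Y hY' hY => he A hY' hY⟩

end TwistSystem

/-- A choice of a twist over every object of the center. -/
structure TwistFamily (𝒢 : PivotalGrading G C) (α : G) where
  obj : ZG 𝒢 → ZG 𝒢
  fam : ∀ A : ZG 𝒢, Fam (𝒢.comp α) A.obj (obj A).obj
  isTwist : ∀ A : ZG 𝒢, (fam A).IsTwist A
  braids : ∀ A : ZG 𝒢, Fam.Braids (fam A)

namespace TwistFamily

variable (T : TwistFamily 𝒢 α) (hp : IsPure C) (V : InvDim 𝒢 α)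

theorem exists_map (T : TwistFamily 𝒢 α) (hp : IsPure C) (V : InvDim 𝒢 α) {A B : ZG 𝒢}
    (f : A ⟶ B) : ∃ m : T.obj A ⟶ T.obj B,
    ∀ {Y : C} (hY : 𝒢.comp α Y), (T.fam A).app hY ≫ Y ◁ m.f = f.f ▷ Y ≫ (T.fam B).app hY :=
  (T.isTwist A).exists_centerHom hp V (T.braids A) (T := (T.fam B).pre f.f)
    (Fam.Acts.pre (T.isTwist B).acts f) (fun {X} hX Y hY hYX => by
      simp only [Fam.pre_app]
      rw [pre_hc, T.braids B hX Y hY hYX])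

theorem exists_mu (T : TwistFamily 𝒢 α) (hp : IsPure C) (V : InvDim 𝒢 α) (A B : ZG 𝒢) :
    ∃ m : T.obj A ⊗ T.obj B ≅ T.obj (A ⊗ B), ∀ {Y : C} (hY : 𝒢.comp α Y),
      vc ((T.fam A).app hY) ((T.fam B).app hY) ≫ Y ◁ m.hom.f = (T.fam (A ⊗ B)).app hY :=
  Fam.IsTwist.exists_iso (A := A ⊗ B) (B := T.obj A ⊗ T.obj B) (S := (T.fam A).tensor (T.fam B))
    hp V (Fam.IsTwist.tensor (T.isTwist A) (T.isTwist B)) (Fam.Braids.tensor (T.braids A) (T.braids B)) (T.isTwist (A ⊗ B)) (T.braids (A ⊗ B))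

theorem exists_eps (T : TwistFamily 𝒢 α) (hp : IsPure C) (V : InvDim 𝒢 α) :
    ∃ e : 𝟙_ (ZG 𝒢) ≅ T.obj (𝟙_ (ZG 𝒢)), ∀ {Y : C} (hY : 𝒢.comp α Y),
      vu Y ≫ Y ◁ e.hom.f = (T.fam (𝟙_ (ZG 𝒢))).app hY :=
  Fam.IsTwist.exists_iso (A := 𝟙_ (ZG 𝒢)) (B := 𝟙_ (ZG 𝒢)) (S := Fam.unit (𝒢.comp α)) hp V
    (Fam.isTwist_unit α) (Fam.braids_unit α) (T.isTwist _) (T.braids _)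

/-- The functor defined by a family of twists. -/
def functor : ZG 𝒢 ⥤ ZG 𝒢 where
  obj := T.obj
  map f := (T.exists_map hp V f).choose
  map_id A := by
    apply RelCenter.hom_ext
    refine Fam.Detects.hom_ext ((T.isTwist A).detects V) fun {Y} hY => ?_
    rw [(T.exists_map hp V (𝟙 A)).choose_spec hY]
    simp
  map_comp {A B E} f g := by
    apply RelCenter.hom_ext
    refine Fam.Detects.hom_ext ((T.isTwist A).detects V) fun {Y} hY => ?_
    rw [(T.exists_map hp V (f ≫ g)).choose_spec hY, RelCenter.comp_f, RelCenter.comp_f,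
      MonoidalCategory.whiskerLeft_comp, reassoc_of% (T.exists_map hp V f).choose_spec hY,
      (T.exists_map hp V g).choose_spec hY, comp_whiskerRight_assoc]

theorem mapTest {Y : C} (hY : 𝒢.comp α Y) :
    MapTest (T.functor hp V) (fun A => (T.fam A).app hY) :=
  fun f => (T.exists_map hp V f).choose_spec hY

instance laxMonoidal : (T.functor hp V).LaxMonoidal :=
  laxOfTest V.whiskerInj (fun A => (T.isTwist A).isIso V.mem) (T.mapTest hp V V.mem)
    (T.exists_eps hp V).choose.hom (fun A B => (T.exists_mu hp V A B).choose.hom)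
    ((T.exists_eps hp V).choose_spec V.mem) (fun A B => (T.exists_mu hp V A B).choose_spec V.mem)

instance : IsIso (Functor.LaxMonoidal.ε (T.functor hp V)) :=
  inferInstanceAs (IsIso (T.exists_eps hp V).choose.hom)

instance (A B : ZG 𝒢) : IsIso (Functor.LaxMonoidal.μ (T.functor hp V) A B) :=
  inferInstanceAs (IsIso (T.exists_mu hp V A B).choose.hom)

instance monoidal : (T.functor hp V).Monoidal := Functor.Monoidal.ofLaxMonoidal _

/-- The monoidal functor defined by a family of twists. -/
def system : TwistSystem (T.functor hp V) α where
  fam := T.fam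
  isTwist := T.isTwist
  braids := T.braids
  isTest hY :=
    { map := T.mapTest hp V hY
      mu := fun A B => (T.exists_mu hp V A B).choose_spec hY
      eps := (T.exists_eps hp V).choose_spec hY }

end TwistFamily

namespace TwistSystem

variable {Φ : ZG 𝒢 ⥤ ZG 𝒢} [Φ.LaxMonoidal]

theorem additive [MonoidalPreadditive C] (S : TwistSystem Φ α) (V : InvDim 𝒢 α) : Φ.Additive where
  map_add {A B} f g := by
    apply RelCenter.hom_ext
    refine Fam.Detects.hom_ext ((S.isTwist A).detects V) fun {Y} hY => ?_
    have h {f : A ⟶ B} := (S.isTest hY).map f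
    refine (h (f := f + g)).trans ?_
    change (f.f + g.f) ▷ Y ≫ _ = _ ≫ Y ◁ ((Φ.map f).f + (Φ.map g).f)
    rw [MonoidalPreadditive.add_whiskerRight, MonoidalPreadditive.whiskerLeft_add,
      Preadditive.add_comp, Preadditive.comp_add]
    exact (congrArg₂ (· + ·) (h (f := f)) (h (f := g))).symm

theorem linear (k : Type w') [CommRing k] [Linear k C] [MonoidalPreadditive C]
    [MonoidalLinear k C] (S : TwistSystem Φ α) (V : InvDim 𝒢 α) : Φ.Linear k where
  map_smul {A B} f r := by
    apply RelCenter.hom_ext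
    refine Fam.Detects.hom_ext ((S.isTwist A).detects V) fun {Y} hY => ?_
    have h {f : A ⟶ B} := (S.isTest hY).map f
    refine (h (f := r • f)).trans ?_
    change (r • f.f) ▷ Y ≫ _ = _ ≫ Y ◁ (r • (Φ.map f).f)
    rw [MonoidalLinear.smul_whiskerRight, MonoidalLinear.whiskerLeft_smul, Linear.smul_comp,
      Linear.comp_smul]
    exact congrArg (r • ·) (h (f := f)).symm

end TwistSystem

end GCat

end

noncomputable section

namespace GCat

theorem vc_post_mul {C : Type u} [Category.{v} C] [MonoidalCategory C] {Y A B A' B' A₁ B₁ E E₁ : C}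
    {f : A ⊗ Y ⟶ Y ⊗ A'} {g : B ⊗ Y ⟶ Y ⊗ B'} {s : (A ⊗ B) ⊗ Y ⟶ Y ⊗ E} {m : A' ⊗ B' ⟶ E}
    {a : A' ⟶ A₁} {b : B' ⟶ B₁} {c : E ⟶ E₁} {m₁ : A₁ ⊗ B₁ ⟶ E₁} (hm : vc f g ≫ Y ◁ m = s)
    (h : m ≫ c = (a ⊗ₘ b) ≫ m₁) : vc (f ≫ Y ◁ a) (g ≫ Y ◁ b) ≫ Y ◁ m₁ = s ≫ Y ◁ c := by
  rw [vc_post, Category.assoc, ← MonoidalCategory.whiskerLeft_comp, ← h,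
    MonoidalCategory.whiskerLeft_comp, reassoc_of% hm]

theorem vu_post_unit {C : Type u} [Category.{v} C] [MonoidalCategory C] {Y E E₁ : C}
    {s : 𝟙_ C ⊗ Y ⟶ Y ⊗ E} {e : 𝟙_ C ⟶ E} {c : E ⟶ E₁} {e₁ : 𝟙_ C ⟶ E₁} (he : vu Y ≫ Y ◁ e = s)
    (h : e ≫ c = e₁) : vu Y ≫ Y ◁ e₁ = s ≫ Y ◁ c := by
  rw [← h, MonoidalCategory.whiskerLeft_comp, reassoc_of% he]

variable {G : Type w} [Group G] {C : Type u} [Category.{v} C] [Preadditive C]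
  [HasFiniteBiproducts C] [MonoidalCategory C] [PivotalCategory C] {𝒢 : PivotalGrading G C}
  {α β γ : G}

/-! ### Splittings of the idempotents -/

/-- Splittings of the idempotents attached to `V`. -/
structure Splitting (V : InvDim 𝒢 α) where
  obj : ZG 𝒢 → C
  p : ∀ A : ZG 𝒢, conjObj V.obj A.obj ⟶ obj A
  q : ∀ A : ZG 𝒢, obj A ⟶ conjObj V.obj A.obj
  p_q : ∀ A : ZG 𝒢, p A ≫ q A = piV V A
  q_p : ∀ A : ZG 𝒢, q A ≫ p A = 𝟙 _

/-- The twist over `A` defined by a morphism from the conjugate of `A`. -/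
abbrev splitFam (V : InvDim 𝒢 α) (A : ZG 𝒢) {E : C} (p : conjObj V.obj A.obj ⟶ E) :
    Fam (𝒢.comp α) A.obj E :=
  (slideFam A V.mem).post p

namespace Splitting

variable {V : InvDim 𝒢 α} (s : Splitting V)

theorem isTwist (s : Splitting V) (hp : IsPure C) (A : ZG 𝒢) :
    (splitFam V A (s.p A)).IsTwist A :=
  isTwist_of_split hp (s.p_q A) (s.q_p A)

theorem exists_square (s : Splitting V) (hp : IsPure C) (A : ZG 𝒢) {X : C} (hX : 𝒢.comp 1 X) :
    ∃ g : s.obj A ⊗ X ⟶ X ⊗ s.obj A,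
      (splitFam V A (s.p A)).Divides (splitFam V A (s.p A)) g :=
  (s.isTwist hp A).exists_divides hp V (s.isTwist hp A).acts (mul_one α) hX

/-- The twists defined by a splitting. -/
def twistFamily (hp : IsPure C) : TwistFamily 𝒢 α where
  obj A :=
    { obj := s.obj A
      braiding := Fam.Detects.halfBraiding ((s.isTwist hp A).detects V)
        (fun hX _ hY => mem_tensor_one hX hY) 𝒢.unit_mem mem_one_dual
        (fun hX hY => mem_tensor_one hY hX) (fun hX => (s.exists_square hp A hX).choose)
        (fun hX => (s.exists_square hp A hX).choose_spec) }
  fam A := splitFam V A (s.p A)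
  isTwist A := s.isTwist hp A
  braids A _ hX := (s.exists_square hp A hX).choose_spec

/-- The functor defined by a splitting. -/
def conjFunctor (hp : IsPure C) : ConjFunctor V where
  functor := (s.twistFamily hp).functor hp V
  p := s.p
  q := s.q
  p_q := s.p_q
  q_p := s.q_p
  braiding A _ hX :=
    (split_slideX (s.p_q A) (s.q_p A) hX ((s.twistFamily hp).braids A hX)).symm
  map_f {A B} f :=
    (split_conj (s.p_q A) (s.q_p A) (s.p_q B) (s.q_p B)
      ((s.twistFamily hp).mapTest hp V V.mem f)).symm
  mu_f A B :=
    (split_contract hp (s.p_q A) (s.q_p A) (s.p_q B) (s.q_p B) (s.p_q (A ⊗ B)) (s.q_p (A ⊗ B))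
      ((((s.twistFamily hp).system hp V).isTest V.mem).mu A B)).symm
  epsilon_f :=
    (split_unit (s.p_q (𝟙_ _)) (s.q_p (𝟙_ _))
      (((s.twistFamily hp).system hp V).isTest V.mem).eps).symm

end Splitting

namespace ConjFunctor

variable {V : InvDim 𝒢 α} (φ : ConjFunctor V)

theorem isTwist (φ : ConjFunctor V) (hp : IsPure C) (A : ZG 𝒢) :
    (splitFam V A (φ.p A)).IsTwist A :=
  isTwist_of_split hp (φ.p_q A) (φ.q_p A)

/-- The quotient of the twist by itself exists by descent, and the prescribed half braiding is the
formula that computes it. -/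
theorem braids (φ : ConjFunctor V) (hp : IsPure C) (A : ZG 𝒢) :
    Fam.Braids (splitFam V A (φ.p A)) := by
  intro X hX
  obtain ⟨g, hg⟩ := (φ.isTwist hp A).exists_divides hp V (φ.isTwist hp A).acts (mul_one α) hX
  rw [φ.braiding A hX, split_slideX (φ.p_q A) (φ.q_p A) hX hg]
  exact hg

/-- The twists of a conjugation functor. -/
def system (hp : IsPure C) : TwistSystem φ.functor α where
  fam A := splitFam V A (φ.p A)
  isTwist A := φ.isTwist hp A
  braids A := φ.braids hp A
  isTest {Y} hY :=
    { map := fun {A B} f => by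
        -- Descent yields a morphism compatible with the twists at all `Y`; its property at `V`
        -- alone identifies it with the prescribed formula. The same device serves for `mu` and
        -- `eps`.
        obtain ⟨m, hm⟩ := (φ.isTwist hp A).exists_hom hp V
          (T := (splitFam V B (φ.p B)).pre f.f) (Fam.Acts.pre (φ.isTwist hp B).acts f)
        rw [φ.map_f, split_conj (φ.p_q A) (φ.q_p A) (φ.p_q B) (φ.q_p B) (hm V.mem)]
        exact hm hY
      mu := fun A B => by
        obtain ⟨m, hm⟩ := Fam.IsTwist.exists_hom (A := A ⊗ B) hp V
          (S := (splitFam V A (φ.p A)).tensor (splitFam V B (φ.p B)))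
          (Fam.IsTwist.tensor (φ.isTwist hp A) (φ.isTwist hp B)) (φ.isTwist hp (A ⊗ B)).acts
        have := split_contract hp (φ.p_q A) (φ.q_p A) (φ.p_q B) (φ.q_p B) (φ.p_q (A ⊗ B))
          (φ.q_p (A ⊗ B)) (hm V.mem)
        exact (congrArg (fun t => vc _ _ ≫ Y ◁ t) ((φ.mu_f A B).trans this)).trans (hm hY)
      eps := by
        obtain ⟨m, hm⟩ := Fam.IsTwist.exists_hom (A := 𝟙_ (ZG 𝒢)) hp V
          (S := Fam.unit (𝒢.comp α)) (Fam.isTwist_unit α) (φ.isTwist hp (𝟙_ _)).acts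
        have := split_unit (φ.p_q (𝟙_ _)) (φ.q_p (𝟙_ _)) (hm V.mem)
        exact (congrArg (fun t => vu Y ≫ Y ◁ t) (φ.epsilon_f.trans this)).trans (hm hY) }

/-- This and the next two lemmas replace the formulas for `δ`, `ζ` and `η` by their action on
twists, which is all that is used afterwards. -/
theorem fam_deltaUV (hp : IsPure C) {U : InvDim 𝒢 α} (φU : ConjFunctor U) (φV : ConjFunctor V)
    (A : ZG 𝒢) {Y : C} (hY : 𝒢.comp α Y) :
    (splitFam V A (φV.p A)).app hY ≫ Y ◁ deltaUV φU φV A = (splitFam U A (φU.p A)).app hY := by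
  obtain ⟨m, hm⟩ := (φV.isTwist hp A).exists_hom hp V (φU.isTwist hp A).acts
  rw [deltaUV, split_slide (φV.p_q A) (φV.q_p A) (hm V.mem), hm hY]

theorem fam_zetaUVW (hp : IsPure C) (h : β * α = γ) {U : InvDim 𝒢 α} {V : InvDim 𝒢 β}
    {W : InvDim 𝒢 γ} (φU : ConjFunctor U) (φV : ConjFunctor V) (φW : ConjFunctor W) (A : ZG 𝒢)
    {Y' Y : C} (hY' : 𝒢.comp β Y') (hY : 𝒢.comp α Y) :
    hc ((splitFam V A (φV.p A)).app hY')
        ((splitFam U (φV.functor.obj A) (φU.p (φV.functor.obj A))).app hY) ≫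
      (Y' ⊗ Y) ◁ zetaUVW h φU φV φW A = (splitFam W A (φW.p A)).app (mem_tensor h hY' hY) := by
  obtain ⟨e, he⟩ := (φV.isTwist hp A).exists_mulIso hp U V W h (φV.braids hp A)
    (φU.isTwist hp _) (φU.braids hp _) (φW.isTwist hp A) (φW.braids hp A)
  rw [zetaUVW, split_slide2 hp (φV.p_q A) (φV.q_p A) h (mateL_twist (φU.p_q _) (φU.q_p _))
    (φU.q_p _) (he V.mem U.mem), he hY' hY]

theorem fam_etaU (hp : IsPure C) {U : InvDim 𝒢 (1 : G)} (φU : ConjFunctor U) (A : ZG 𝒢) {Y : C}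
    (hY : 𝒢.comp 1 Y) : A.σ hY ≫ Y ◁ etaU φU A = (splitFam U A (φU.p A)).app hY := by
  obtain ⟨m, hm⟩ := (Fam.isTwist_fam A).exists_hom hp U (φU.isTwist hp A).acts
  rw [etaU, split_insertU (φU.p_q A) (φU.q_p A) (hm U.mem)]
  exact hm hY

end ConjFunctor

namespace TwistSystem

variable {Φ Ψ : ZG 𝒢 ⥤ ZG 𝒢} [Φ.LaxMonoidal] [Ψ.LaxMonoidal]

/-- The transport of a system of twists along a monoidal isomorphism. -/
def transport (S : TwistSystem Φ α) (e : Φ ≅ Ψ) (he : NatTrans.IsMonoidal e.hom) :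
    TwistSystem Ψ α where
  fam A := (S.fam A).post (e.hom.app A).f
  isTwist A :=
    { acts := Fam.Acts.post (S.isTwist A).acts _
      isIso := fun {Y} hY => by
        have := (S.isTwist A).isIso hY
        have : IsIso (e.hom.app A).f :=
          ⟨(e.inv.app A).f, congrArg (·.f) (e.hom_inv_id_app A),
            congrArg (·.f) (e.inv_hom_id_app A)⟩
        exact inferInstanceAs (IsIso ((S.fam A).app hY ≫ Y ◁ (e.hom.app A).f)) }
  braids A := Fam.Braids.post (S.braids A) (e.hom.app A)
  isTest {Y} hY :=
    { map := fun {A B} f => by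
        have h : (Φ.map f).f ≫ (e.hom.app B).f = (e.hom.app A).f ≫ (Ψ.map f).f :=
          congrArg (·.f) (e.hom.naturality f)
        have h' : (S.fam A).app hY ≫ Y ◁ (Φ.map f).f = f.f ▷ Y ≫ (S.fam B).app hY :=
          (S.isTest hY).map f
        simp only [Fam.post_app, Category.assoc, ← MonoidalCategory.whiskerLeft_comp]
        rw [← h, MonoidalCategory.whiskerLeft_comp, reassoc_of% h']
      mu := fun A B => vc_post_mul ((S.isTest hY).mu A B)
        ((congrArg (·.f) (he.tensor A B)).trans
          (congrArg (· ≫ _) (RelCenter.tensorHom_f (e.hom.app A) (e.hom.app B))))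
      eps := vu_post_unit (S.isTest hY).eps (congrArg (·.f) he.unit) }

end TwistSystem

end GCat

end

noncomputable section

namespace GCat

/-! ### Homogeneous splittings -/

section Homogeneous

variable {G : Type w} [Group G] {C : Type u} [Category.{v} C] [Preadditive C]
  [HasFiniteBiproducts C] [MonoidalCategory C]

theorem GGrading.exists_zero (𝒢 : GGrading G C) (δ : G) : ∃ Z : C, 𝒢.comp δ Z ∧ 𝟙 Z = 0 := by
  have := 𝒢.additive δ
  obtain ⟨Z, hZ⟩ := HasZeroObject.zero (C := (𝒢.comp δ).FullSubcategory)
  have h : 𝟙 Z = 0 := hZ.eq_of_src _ _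
  exact ⟨Z.obj, Z.property, congrArg (·.hom) h⟩

/-- An idempotent of a homogeneous object which splits has a homogeneous splitting. -/
theorem GGrading.exists_split (𝒢 : GGrading G C) {δ : G} {M E : C} (hM : 𝒢.comp δ M)
    (p : M ⟶ E) (q : E ⟶ M) (hqp : q ≫ p = 𝟙 E) :
    ∃ (E' : C) (p' : M ⟶ E') (q' : E' ⟶ M), 𝒢.comp δ E' ∧ p' ≫ q' = p ≫ q ∧ q' ≫ p' = 𝟙 E' := by
  classical
  obtain ⟨s, Y, hY, ⟨e⟩⟩ := 𝒢.split E
  -- Only the summand of degree `δ` can map nontrivially to `M`, so it already carries the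
  -- splitting.
  have h0 : ∀ j : s, (j : G) ≠ δ → biproduct.ι Y j ≫ e.inv ≫ q = 0 :=
    fun j hj => 𝒢.hom_eq_zero (hY j) hM hj _
  by_cases hδ : δ ∈ s
  · refine ⟨Y ⟨δ, hδ⟩, p ≫ e.hom ≫ biproduct.π Y ⟨δ, hδ⟩, biproduct.ι Y ⟨δ, hδ⟩ ≫ e.inv ≫ q,
      hY ⟨δ, hδ⟩, ?_, ?_⟩
    · have : biproduct.π Y ⟨δ, hδ⟩ ≫ biproduct.ι Y ⟨δ, hδ⟩ ≫ e.inv ≫ q = e.inv ≫ q := by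
        refine biproduct.hom_ext' _ _ fun j => ?_
        by_cases hj : j = ⟨δ, hδ⟩
        · subst hj; simp
        · rw [biproduct.ι_π_ne_assoc _ hj, zero_comp, h0 j (fun h => hj (Subtype.ext h))]
      simp only [Category.assoc]
      rw [this, e.hom_inv_id_assoc]
    · simp only [Category.assoc]
      rw [reassoc_of% hqp]
      simp
  -- No summand has degree `δ`, so the idempotent vanishes and a zero object of that component
  -- splits it.
  · have hq : q = 0 := by
      rw [← cancel_epi e.inv]
      refine biproduct.hom_ext' _ _ fun j => ?_
      rw [h0 j (fun h => hδ (h ▸ j.2)), comp_zero, comp_zero]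
    obtain ⟨Z, hZ, h1⟩ := 𝒢.exists_zero δ
    exact ⟨Z, 0, 0, hZ, by simp [hq], by simp [h1]⟩

end Homogeneous

variable {G : Type w} [Group G] {C : Type u} [Category.{v} C] [Preadditive C]
  [HasFiniteBiproducts C] [MonoidalCategory C] [PivotalCategory C] {𝒢 : PivotalGrading G C}
  {α β γ : G}

theorem conjObj_mem {V A : C} (hV : 𝒢.comp α V) (hA : 𝒢.comp γ A) :
    𝒢.comp (α⁻¹ * γ * α) (conjObj V A) :=
  𝒢.tensor_mem (𝒢.tensor_mem (𝒢.dual_mem hV) hA) hV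

/-- The components are not assumed closed under isomorphism, so the splitting object has to be
chosen inside the correct one for `φ_α` to respect the grading strictly. -/
theorem exists_homogeneous_splitting [MonoidalPreadditive C] (hns : NonSingular 𝒢)
    (V : InvDim 𝒢 α) (A : ZG 𝒢) :
    ∃ (E : C) (p : conjObj V.obj A.obj ⟶ E) (q : E ⟶ conjObj V.obj A.obj),
      p ≫ q = piV V A ∧ q ≫ p = 𝟙 E ∧
        ∀ γ : G, 𝒢.comp γ A.obj → 𝒢.comp (α⁻¹ * γ * α) E := by
  have := hns.splitIdempotents
  obtain ⟨E, q, p, hqp, hpq⟩ := IsIdempotentComplete.idempotents_split _ _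
    (piV_idem hns.pure V A)
  -- A zero object may belong to several components at once. Its conjugate then has all the required
  -- degrees, and identities split the idempotent.
  by_cases h0 : 𝟙 A.obj = 0
  · have h1 : 𝟙 (conjObj V.obj A.obj) = 0 := by
      rw [← id_whiskerRight, ← MonoidalCategory.whiskerLeft_id, h0,
        MonoidalPreadditive.whiskerLeft_zero, MonoidalPreadditive.zero_whiskerRight]
    refine ⟨conjObj V.obj A.obj, 𝟙 _, 𝟙 _, ?_, Category.id_comp _, fun γ hA => conjObj_mem V.mem hA⟩
    rw [Category.comp_id, ← Category.comp_id (piV V A), h1, comp_zero]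
  · by_cases hA : ∃ γ, 𝒢.comp γ A.obj
    · obtain ⟨γ, hγ⟩ := hA
      obtain ⟨E', p', q', hE', hpq', hqp'⟩ :=
        𝒢.exists_split (conjObj_mem V.mem hγ) p q hqp
      refine ⟨E', p', q', hpq'.trans hpq, hqp', fun γ' hγ' => ?_⟩
      obtain rfl : γ = γ' := by
        by_contra hne
        exact h0 (𝒢.hom_eq_zero hγ hγ' hne _)
      exact hE'
    · exact ⟨E, p, q, hpq, hqp, fun γ hγ => (hA ⟨γ, hγ⟩).elim⟩

variable [MonoidalPreadditive C]

/-- Homogeneous splittings of all the idempotents attached to `V`. -/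
def homogeneousSplitting (hns : NonSingular 𝒢) (V : InvDim 𝒢 α) : Splitting V where
  obj A := (exists_homogeneous_splitting hns V A).choose
  p A := (exists_homogeneous_splitting hns V A).choose_spec.choose
  q A := (exists_homogeneous_splitting hns V A).choose_spec.choose_spec.choose
  p_q A := (exists_homogeneous_splitting hns V A).choose_spec.choose_spec.choose_spec.1
  q_p A := (exists_homogeneous_splitting hns V A).choose_spec.choose_spec.choose_spec.2.1

theorem homogeneousSplitting_mem (hns : NonSingular 𝒢) (V : InvDim 𝒢 α) {A : ZG 𝒢}
    (hA : 𝒢.comp γ A.obj) :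
    𝒢.comp (α⁻¹ * γ * α) ((homogeneousSplitting hns V).obj A) :=
  (exists_homogeneous_splitting hns V A).choose_spec.choose_spec.choose_spec.2.2 γ hA

/-! ### The canonical crossing -/

section Coherence

variable {C : Type u} [Category.{v} C] [MonoidalCategory C] {Y Y' Y'' A B E F K K' L N : C}

theorem comp_whiskerLeft_id (f : A ⟶ Y ⊗ E) : f ≫ Y ◁ 𝟙 E = f := by simp

theorem WhiskerInj.hc_assoc {f : A ⊗ Y'' ⟶ Y'' ⊗ B} {g : B ⊗ Y' ⟶ Y' ⊗ E} {h : E ⊗ Y ⟶ Y ⊗ F}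
    [IsIso f] [IsIso g] [IsIso h] (hY : WhiskerInj ((Y'' ⊗ Y') ⊗ Y))
    {fg : A ⊗ (Y'' ⊗ Y') ⟶ (Y'' ⊗ Y') ⊗ K} {gh : B ⊗ (Y' ⊗ Y) ⟶ (Y' ⊗ Y) ⊗ K'}
    {k : K ⊗ Y ⟶ Y ⊗ L} {r : A ⊗ ((Y'' ⊗ Y') ⊗ Y) ⟶ ((Y'' ⊗ Y') ⊗ Y) ⊗ N}
    {r' : A ⊗ (Y'' ⊗ (Y' ⊗ Y)) ⟶ (Y'' ⊗ (Y' ⊗ Y)) ⊗ N} {m₁ : E ⟶ K} {m₁' : F ⟶ L} {m₂ : L ⟶ N}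
    {m₃ : F ⟶ K'} {m₄ : K' ⟶ N} (h₁ : hc f g ≫ (Y'' ⊗ Y') ◁ m₁ = fg)
    (hm : h ≫ Y ◁ m₁' = m₁ ▷ Y ≫ k) (h₂ : hc fg k ≫ ((Y'' ⊗ Y') ⊗ Y) ◁ m₂ = r)
    (h₃ : hc g h ≫ (Y' ⊗ Y) ◁ m₃ = gh) (h₄ : hc f gh ≫ (Y'' ⊗ (Y' ⊗ Y)) ◁ m₄ = r')
    (hr : A ◁ (α_ Y'' Y' Y).hom ≫ r' = r ≫ (α_ Y'' Y' Y).hom ▷ N) : m₁' ≫ m₂ = m₃ ≫ m₄ := by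
  refine hY.ext (hc (hc f g) h) ?_
  rw [← cancel_mono ((α_ Y'' Y' Y).hom ▷ N)]
  simp only [MonoidalCategory.whiskerLeft_comp, Category.assoc]
  conv_rhs => rw [whisker_exchange, whisker_exchange_assoc, reassoc_of% GCat.hc_assoc f g h,
    ← reassoc_of% hc_post f, h₃, h₄, hr]
  rw [← reassoc_of% hc_post (hc f g) h, hm, ← hc_mid, h₁, reassoc_of% h₂]

end Coherence

namespace NonSingular

variable (hns : NonSingular 𝒢)

/-- The conjugation functors. -/
def conj (V : InvDim 𝒢 α) : ConjFunctor V := (homogeneousSplitting hns V).conjFunctor hns.pure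

variable (α) in
/-- A chosen object with invertible left dimension. -/
def invDim : InvDim 𝒢 α := (hns.exists_invDim α).some

variable (α) in
/-- The twists of a chosen conjugation functor. -/
abbrev system : TwistSystem (hns.conj (hns.invDim α)).functor α :=
  (hns.conj (hns.invDim α)).system hns.pure

theorem isIso_system (A : ZG 𝒢) : IsIso (((hns.system α).fam A).app (hns.invDim α).mem) :=
  ((hns.system α).isTwist A).isIso (hns.invDim α).mem

/-- The isomorphism `φ₂`. -/
def mul (h : β * α = γ) : (hns.conj (hns.invDim β)).functor ⋙ (hns.conj (hns.invDim α)).functor ≅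
    (hns.conj (hns.invDim γ)).functor :=
  ((hns.system β).exists_mulIso hns.pure (hns.invDim α) (hns.invDim β) (hns.invDim γ) h
    (hns.system α) (hns.system γ)).choose

theorem mul_isMonoidal (h : β * α = γ) : NatTrans.IsMonoidal (hns.mul h).hom :=
  ((hns.system β).exists_mulIso hns.pure (hns.invDim α) (hns.invDim β) (hns.invDim γ) h
    (hns.system α) (hns.system γ)).choose_spec.1

theorem system_mul (h : β * α = γ) (A : ZG 𝒢) {Y' Y : C} (hY' : 𝒢.comp β Y')
    (hY : 𝒢.comp α Y) :
    hc (((hns.system β).fam A).app hY') (((hns.system α).fam _).app hY) ≫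
      (Y' ⊗ Y) ◁ ((hns.mul h).hom.app A).f =
        ((hns.system γ).fam A).app (mem_tensor h hY' hY) :=
  ((hns.system β).exists_mulIso hns.pure (hns.invDim α) (hns.invDim β) (hns.invDim γ) h
    (hns.system α) (hns.system γ)).choose_spec.2 A hY' hY

/-- The isomorphism `φ₀`. -/
def one : 𝟭 (ZG 𝒢) ≅ (hns.conj (hns.invDim 1)).functor :=
  ((TwistSystem.id 𝒢).exists_iso hns.pure (hns.invDim 1) (hns.system 1)).choose

theorem one_isMonoidal : NatTrans.IsMonoidal hns.one.hom :=
  ((TwistSystem.id 𝒢).exists_iso hns.pure (hns.invDim 1) (hns.system 1)).choose_spec.1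

theorem system_one (A : ZG 𝒢) {Y : C} (hY : 𝒢.comp 1 Y) :
    A.σ hY ≫ Y ◁ (hns.one.hom.app A).f = ((hns.system 1).fam A).app hY :=
  ((TwistSystem.id 𝒢).exists_iso hns.pure (hns.invDim 1) (hns.system 1)).choose_spec.2 A hY

/-- The universal cone. -/
def cone (V : InvDim 𝒢 α) : (hns.conj (hns.invDim α)).functor ≅ (hns.conj V).functor :=
  ((hns.system α).exists_iso hns.pure V ((hns.conj V).system hns.pure)).choose

theorem cone_isMonoidal (V : InvDim 𝒢 α) : NatTrans.IsMonoidal (hns.cone V).hom :=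
  ((hns.system α).exists_iso hns.pure V ((hns.conj V).system hns.pure)).choose_spec.1

theorem system_cone (V : InvDim 𝒢 α) (A : ZG 𝒢) {Y : C} (hY : 𝒢.comp α Y) :
    ((hns.system α).fam A).app hY ≫ Y ◁ ((hns.cone V).hom.app A).f =
      (((hns.conj V).system hns.pure).fam A).app hY :=
  ((hns.system α).exists_iso hns.pure V ((hns.conj V).system hns.pure)).choose_spec.2 A hY

/-- The functor of degree `α⁻¹` is a quasi-inverse, through the isomorphisms `φ₂` and `φ₀`. -/
theorem isEquivalence (α : G) : (hns.conj (hns.invDim α)).functor.IsEquivalence :=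
  (CategoryTheory.Equivalence.mk (hns.conj (hns.invDim α)).functor
    (hns.conj (hns.invDim α⁻¹)).functor
    (hns.one ≪≫ (hns.mul (mul_inv_cancel α)).symm)
    (hns.mul (inv_mul_cancel α) ≪≫ hns.one.symm)).isEquivalence_functor

/-- Both sides carry the triple horizontal product of twists to the twist of degree `γβα`, up to the
associator, and that product is invertible. -/
theorem mul_assoc_app {βα γβ γβα : G} (h₁ : β * α = βα) (h₂ : γ * β = γβ) (h₃ : γ * βα = γβα)
    (h₄ : γβ * α = γβα) (X : ZG 𝒢) :
    (hns.conj (hns.invDim α)).functor.map ((hns.mul h₂).hom.app X) ≫ (hns.mul h₄).hom.app X =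
      (hns.mul h₁).hom.app ((hns.conj (hns.invDim γ)).functor.obj X) ≫
        (hns.mul h₃).hom.app X := by
  have hV := (hns.invDim α).mem
  have hV' := (hns.invDim β).mem
  have hV'' := (hns.invDim γ).mem
  have := hns.isIso_system (α := γ) X
  have := hns.isIso_system (α := β) ((hns.conj (hns.invDim γ)).functor.obj X)
  have := hns.isIso_system (α := α)
    (((hns.conj (hns.invDim γ)).functor ⋙ (hns.conj (hns.invDim β)).functor).obj X)
  exact RelCenter.hom_ext (WhiskerInj.hc_assoc
    (WhiskerInj.tensor (WhiskerInj.tensor (hns.invDim γ).whiskerInj (hns.invDim β).whiskerInj)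
      (hns.invDim α).whiskerInj)
    (hns.system_mul h₂ X hV'' hV') (((hns.system α).isTest hV).map ((hns.mul h₂).hom.app X))
    (hns.system_mul h₄ X (mem_tensor h₂ hV'' hV') hV) (hns.system_mul h₁ _ hV' hV)
    (hns.system_mul h₃ X hV'' (mem_tensor h₁ hV' hV)) (((hns.system γβα).fam X).naturality _ _ _))

theorem one_mul_app (X : ZG 𝒢) :
    hns.one.hom.app ((hns.conj (hns.invDim α)).functor.obj X) ≫
      (hns.mul (mul_one α)).hom.app X = 𝟙 _ := by
  have := hns.isIso_system (α := α) X
  have := (Fam.isTwist_fam ((hns.conj (hns.invDim α)).functor.obj X)).isIso (hns.invDim 1).mem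
  apply RelCenter.hom_ext
  refine WhiskerInj.ext (WhiskerInj.tensor (hns.invDim α).whiskerInj (hns.invDim 1).whiskerInj)
    (hc (((hns.system α).fam X).app (hns.invDim α).mem)
      (RelCenter.σ ((hns.conj (hns.invDim α)).functor.obj X) (hns.invDim 1).mem)) ?_
  rw [RelCenter.comp_f, MonoidalCategory.whiskerLeft_comp, ← Category.assoc, ← hc_post]
  rw [hns.system_one, hns.system_mul]
  exact ((hns.system α).braids X (hns.invDim 1).mem _ (hns.invDim α).mem _).symm.trans
    (comp_whiskerLeft_id _).symm

theorem mul_one_app (X : ZG 𝒢) :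
    (hns.conj (hns.invDim α)).functor.map (hns.one.hom.app X) ≫
      (hns.mul (one_mul α)).hom.app X = 𝟙 _ := by
  have := hns.isIso_system (α := α) X
  have := (Fam.isTwist_fam X).isIso (hns.invDim 1).mem
  apply RelCenter.hom_ext
  refine WhiskerInj.ext (WhiskerInj.tensor (hns.invDim 1).whiskerInj (hns.invDim α).whiskerInj)
    (hc (X.σ (hns.invDim 1).mem) (((hns.system α).fam X).app (hns.invDim α).mem)) ?_
  have h : ((hns.system α).fam X).app (hns.invDim α).mem ≫
      (hns.invDim α).obj ◁ ((hns.conj (hns.invDim α)).functor.map (hns.one.hom.app X)).f = _ :=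
    ((hns.system α).isTest (hns.invDim α).mem).map (hns.one.hom.app X)
  rw [RelCenter.comp_f, MonoidalCategory.whiskerLeft_comp, ← Category.assoc, ← hc_post]
  rw [h, ← hc_mid, hns.system_one]
  exact ((hns.system_mul (one_mul α) X (hns.invDim 1).mem (hns.invDim α).mem).trans
    (((hns.system α).isTwist X).acts _ _ _)).trans (comp_whiskerLeft_id _).symm

theorem cone_delta (U V : InvDim 𝒢 α) (A : ZG 𝒢) :
    ((hns.cone V).hom.app A).f ≫ deltaUV (hns.conj U) (hns.conj V) A =
      ((hns.cone U).hom.app A).f := by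
  have := hns.isIso_system (α := α) A
  refine WhiskerInj.ext (hns.invDim α).whiskerInj (((hns.system α).fam A).app (hns.invDim α).mem) ?_
  rw [MonoidalCategory.whiskerLeft_comp, reassoc_of% hns.system_cone V A, hns.system_cone U A]
  exact ConjFunctor.fam_deltaUV hns.pure _ _ A _

theorem mul_cone (h : β * α = γ) (U : InvDim 𝒢 α) (V : InvDim 𝒢 β) (W : InvDim 𝒢 γ) (A : ZG 𝒢) :
    ((hns.mul h).hom.app A ≫ (hns.cone W).hom.app A).f =
      ((hns.cone U).hom.app ((hns.conj (hns.invDim β)).functor.obj A) ≫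
        (hns.conj U).functor.map ((hns.cone V).hom.app A)).f ≫
        zetaUVW h (hns.conj U) (hns.conj V) (hns.conj W) A := by
  have := hns.isIso_system (α := β) A
  have := hns.isIso_system (α := α) ((hns.conj (hns.invDim β)).functor.obj A)
  refine WhiskerInj.ext (WhiskerInj.tensor (hns.invDim β).whiskerInj (hns.invDim α).whiskerInj)
    (hc (((hns.system β).fam A).app (hns.invDim β).mem)
      (((hns.system α).fam _).app (hns.invDim α).mem)) ?_
  have h' : (((hns.conj U).system hns.pure).fam _).app (hns.invDim α).mem ≫
      (hns.invDim α).obj ◁ ((hns.conj U).functor.map ((hns.cone V).hom.app A)).f = _ :=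
    (((hns.conj U).system hns.pure).isTest (hns.invDim α).mem).map ((hns.cone V).hom.app A)
  simp only [RelCenter.comp_f, MonoidalCategory.whiskerLeft_comp]
  rw [reassoc_of% hns.system_mul h A, hns.system_cone W A, Category.assoc,
    ← reassoc_of% hc_post, hns.system_cone U, ← reassoc_of% hc_post, h', ← hc_mid,
    hns.system_cone V A]
  exact (ConjFunctor.fam_zetaUVW hns.pure h _ _ _ A _ _).symm

theorem one_cone (U : InvDim 𝒢 (1 : G)) (A : ZG 𝒢) :
    (hns.one.hom.app A ≫ (hns.cone U).hom.app A).f = etaU (hns.conj U) A := by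
  have := (Fam.isTwist_fam A).isIso (hns.invDim 1).mem
  refine WhiskerInj.ext (hns.invDim 1).whiskerInj (A.σ (hns.invDim 1).mem) ?_
  rw [RelCenter.comp_f, MonoidalCategory.whiskerLeft_comp, reassoc_of% hns.system_one A,
    hns.system_cone U A]
  exact (ConjFunctor.fam_etaU hns.pure _ A _).symm

/-- The canonical crossing. -/
def canonicalCrossing (k : Type w') [CommRing k] [Linear k C] [MonoidalLinear k C] :
    CanonicalCrossing 𝒢 k where
  functor α := (hns.conj (hns.invDim α)).functor
  monoidal α := (hns.conj (hns.invDim α)).monoidal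
  additive α := (hns.system α).additive (hns.invDim α)
  linear α := (hns.system α).linear k (hns.invDim α)
  isEquivalence := hns.isEquivalence
  mul _ _ _ h := hns.mul h
  mul_monoidal _ _ _ h := hns.mul_isMonoidal h
  one := hns.one
  one_monoidal := hns.one_isMonoidal
  assoc _ _ _ _ _ _ h₁ h₂ h₃ h₄ X := hns.mul_assoc_app h₁ h₂ h₃ h₄ X
  one_left _ X := hns.one_mul_app X
  one_right _ X := hns.mul_one_app X
  grading α _ _ hX := homogeneousSplitting_mem hns (hns.invDim α) hX
  conj V := hns.conj V
  ι V := hns.cone V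
  ι_monoidal V := hns.cone_isMonoidal V
  ι_delta U V A := hns.cone_delta U V A
  mul_ι h U V W A := hns.mul_cone h U V W A
  one_ι U A := hns.one_cone U A

end NonSingular

end GCat

end

noncomputable section

namespace GCat

variable {G : Type w} [Group G] {C : Type u} [Category.{v} C] [Preadditive C]
  [HasFiniteBiproducts C] [MonoidalCategory C] [PivotalCategory C] {𝒢 : PivotalGrading G C}
  {α β γ : G} {k : Type w'} [CommRing k] [Linear k C] [MonoidalPreadditive C] [MonoidalLinear k C]

/-! ### The twists of a canonical crossing -/

instance isIso_app_f {Φ Ψ : ZG 𝒢 ⥤ ZG 𝒢} (e : Φ ≅ Ψ) (A : ZG 𝒢) : IsIso (e.hom.app A).f :=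
  ⟨(e.inv.app A).f, congrArg (·.f) (e.hom_inv_id_app A), congrArg (·.f) (e.inv_hom_id_app A)⟩

namespace CanonicalCrossing

variable (φ : CanonicalCrossing 𝒢 k) (hns : NonSingular 𝒢)

variable (α) in
/-- The system of twists which gives the functor `φ_α`. -/
def system : TwistSystem (φ.functor α) α :=
  ((φ.conj (hns.invDim α)).system hns.pure).transport (φ.ι (hns.invDim α)).symm
    (haveI := φ.ι_monoidal (hns.invDim α); inferInstanceAs (NatTrans.IsMonoidal (φ.ι _).inv))

/-- The twists of `φ_α` were transported from one chosen object; the cone relation turns the change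
of object into `δ`, which matches the twists, so any `V` yields the same ones. -/
theorem system_ι (V : InvDim 𝒢 α) (A : ZG 𝒢) {Y : C} (hY : 𝒢.comp α Y) :
    ((φ.system α hns).fam A).app hY ≫ Y ◁ ((φ.ι V).hom.app A).f =
      (splitFam V A ((φ.conj V).p A)).app hY := by
  have h : ((φ.ι (hns.invDim α)).inv.app A).f ≫ ((φ.ι V).hom.app A).f =
      deltaUV (φ.conj V) (φ.conj (hns.invDim α)) A := by
    have h1 : ((φ.ι (hns.invDim α)).inv.app A).f ≫ ((φ.ι (hns.invDim α)).hom.app A).f = 𝟙 _ :=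
      congrArg (·.f) ((φ.ι (hns.invDim α)).inv_hom_id_app A)
    rw [← φ.ι_delta V (hns.invDim α) A, reassoc_of% h1]
  refine Eq.trans ?_ (ConjFunctor.fam_deltaUV hns.pure (φ.conj V) (φ.conj (hns.invDim α)) A hY)
  rw [← h, MonoidalCategory.whiskerLeft_comp, ← Category.assoc]
  rfl

theorem system_mul (h : β * α = γ) (A : ZG 𝒢) {Y' Y : C} (hY' : 𝒢.comp β Y')
    (hY : 𝒢.comp α Y) :
    hc (((φ.system β hns).fam A).app hY') (((φ.system α hns).fam _).app hY) ≫
      (Y' ⊗ Y) ◁ ((φ.mul α β γ h).hom.app A).f =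
        ((φ.system γ hns).fam A).app (mem_tensor h hY' hY) := by
  let U := hns.invDim α
  let V := hns.invDim β
  let W := hns.invDim γ
  rw [← cancel_mono ((Y' ⊗ Y) ◁ ((φ.ι W).hom.app A).f), Category.assoc,
    ← MonoidalCategory.whiskerLeft_comp, system_ι]
  have h' : (((φ.conj U).system hns.pure).fam _).app hY ≫
      Y ◁ ((φ.conj U).functor.map ((φ.ι V).hom.app A)).f = _ :=
    (((φ.conj U).system hns.pure).isTest hY).map ((φ.ι V).hom.app A)
  have h'' := φ.mul_ι h U V W A
  rw [RelCenter.comp_f] at h''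
  rw [h'', RelCenter.comp_f]
  simp only [MonoidalCategory.whiskerLeft_comp]
  rw [Category.assoc, ← reassoc_of% hc_post, system_ι, ← reassoc_of% hc_post]
  refine (congrArg (fun t => hc _ t ≫ _) h').trans ?_
  rw [← hc_mid, system_ι]
  exact ConjFunctor.fam_zetaUVW hns.pure h _ _ _ A _ _

theorem system_one (A : ZG 𝒢) {Y : C} (hY : 𝒢.comp 1 Y) :
    A.σ hY ≫ Y ◁ (φ.one.hom.app A).f = ((φ.system 1 hns).fam A).app hY := by
  let U := hns.invDim 1
  rw [← cancel_mono (Y ◁ ((φ.ι U).hom.app A).f), Category.assoc,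
    ← MonoidalCategory.whiskerLeft_comp, system_ι]
  have h := φ.one_ι U A
  rw [RelCenter.comp_f] at h
  rw [h]
  exact ConjFunctor.fam_etaU hns.pure _ A _

end CanonicalCrossing

end GCat

end

noncomputable section

namespace GCat

/-! ### Universal families -/

section Universal

variable {C : Type u} [Category.{v} C] [MonoidalCategory C] {D D' : ObjectProperty C}
  {A B E F : C}

namespace Fam

/-- The family `S` is universal among the families of squares with source `A`. -/
structure Universal (S : Fam D A B) : Prop where
  exists_desc : ∀ {E : C} (T : Fam D A E),
    ∃ m : B ⟶ E, ∀ {Y : C} (hY : D Y), S.app hY ≫ Y ◁ m = T.app hY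
  hom_ext : ∀ {E : C} (m m' : B ⟶ E),
    (∀ {Y : C} (hY : D Y), S.app hY ≫ Y ◁ m = S.app hY ≫ Y ◁ m') → m = m'

variable [TwoSidedDuals C]

/-- Rigidity: a morphism `B ⊗ R ⟶ N` amounts to a morphism `B ⟶ N ⊗ R*`, to which uniqueness
applies. -/
theorem Universal.detects {S : Fam D A B} (hS : S.Universal) : S.Detects := by
  intro R N g g' h
  have key : ∀ f : B ⊗ R ⟶ N, f =
      (𝟙 B ⊗≫ B ◁ coev R ⊗≫ f ▷ dual R) ▷ R ⊗≫ N ◁ ev R ⊗≫ 𝟙 N := by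
    intro f
    calc
      f = 𝟙 _ ⊗≫ B ◁ (coev R ▷ R ⊗≫ R ◁ ev R) ⊗≫ f := by rw [ev_coev]; monoidal
      _ = 𝟙 _ ⊗≫ B ◁ coev R ▷ R ⊗≫ ((B ⊗ R) ◁ ev R ≫ f ▷ 𝟙_ C) ⊗≫ 𝟙 _ := by monoidal
      _ = _ := by rw [whisker_exchange]; monoidal
  rw [key g, key g', hS.hom_ext (𝟙 B ⊗≫ B ◁ coev R ⊗≫ g ▷ dual R)
    (𝟙 B ⊗≫ B ◁ coev R ⊗≫ g' ▷ dual R) fun {Y} hY => ?_]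
  have key' : ∀ f : B ⊗ R ⟶ N, S.app hY ≫ Y ◁ (𝟙 B ⊗≫ B ◁ coev R ⊗≫ f ▷ dual R) =
      𝟙 _ ⊗≫ (A ⊗ Y) ◁ coev R ⊗≫ (S.app hY ▷ R ≫ (α_ Y B R).hom ≫ Y ◁ f) ▷ dual R ⊗≫ 𝟙 _ := by
    intro f
    calc
      _ = 𝟙 _ ⊗≫ (S.app hY ▷ 𝟙_ C ≫ (Y ⊗ B) ◁ coev R) ⊗≫ (Y ◁ f) ▷ dual R ⊗≫ 𝟙 _ := by monoidal
      _ = _ := by rw [← whisker_exchange]; monoidal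
  rw [key', key', h hY]

/-- Bending `Z` turns `R` at `Y ⊗ Z` into a family over `Y` with values in `(Z ⊗ E) ⊗ Z*`. It
factors through `S`, and evaluating `Z* ⊗ Z` gives the quotient. -/
theorem Universal.exists_divides {S : Fam D A B} (hS : S.Universal) (R : Fam D' A E) {Z : C}
    (hZ : ∀ Y : C, D Y → D' (Y ⊗ Z)) : ∃ g : B ⊗ Z ⟶ Z ⊗ E, S.Divides R g := by
  obtain ⟨m, hm⟩ := hS.exists_desc (E := (Z ⊗ E) ⊗ dual Z)
    { app := fun {Y} hY => 𝟙 _ ⊗≫ (A ⊗ Y) ◁ coev Z ⊗≫ R.app (hZ Y hY) ▷ dual Z ⊗≫ 𝟙 _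
      naturality := fun {Y Y'} hY hY' f => by
        have h := R.naturality (hZ Y hY) (hZ Y' hY') (f ▷ Z)
        calc
          _ = 𝟙 _ ⊗≫ (A ◁ f ▷ 𝟙_ C ≫ A ◁ Y' ◁ coev Z) ⊗≫ R.app (hZ Y' hY') ▷ dual Z ⊗≫ 𝟙 _ := by
            monoidal
          _ = 𝟙 _ ⊗≫ (A ⊗ Y) ◁ coev Z ⊗≫ (A ◁ f ▷ Z ≫ R.app (hZ Y' hY')) ▷ dual Z ⊗≫ 𝟙 _ := by
            rw [← MonoidalCategory.whiskerLeft_comp, ← whisker_exchange]; monoidal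
          _ = _ := by rw [h]; monoidal }
  refine ⟨m ▷ Z ⊗≫ (Z ⊗ E) ◁ ev Z ⊗≫ 𝟙 _, fun Y hY hYZ => ?_⟩
  simp only [hc]
  calc
    _ = 𝟙 _ ⊗≫ (S.app hY ≫ Y ◁ m) ▷ Z ⊗≫ Y ◁ ((Z ⊗ E) ◁ ev Z) ⊗≫ 𝟙 _ := by monoidal
    _ = 𝟙 _ ⊗≫ (A ⊗ Y) ◁ coev Z ▷ Z ⊗≫ (R.app hYZ ▷ (dual Z ⊗ Z) ≫ ((Y ⊗ Z) ⊗ E) ◁ ev Z) ⊗≫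
        𝟙 _ := by rw [hm hY]; monoidal
    _ = 𝟙 _ ⊗≫ (A ⊗ Y) ◁ (coev Z ▷ Z ⊗≫ Z ◁ ev Z) ⊗≫ R.app hYZ ⊗≫ 𝟙 _ := by
      rw [← whisker_exchange]; monoidal
    _ = _ := by rw [ev_coev]; monoidal

end Fam

variable [TwoSidedDuals C]

/-- With `mateL_natural`, this matches dinaturality of `Y* ⊗ A ⊗ Y ⟶ E` with naturality of the
corresponding squares, so that the coend becomes a universal family. -/
theorem comate_natural {Y Y' : C} (g : Y ⟶ Y') {r : conjObj Y A ⟶ E} {r' : conjObj Y' A ⟶ E}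
    (h : (dualMap g ▷ A) ▷ Y ≫ r = (dual Y' ⊗ A) ◁ g ≫ r') :
    A ◁ g ≫ comate r' = comate r ≫ g ▷ E := by
  simp only [comate]
  calc
    _ = 𝟙 _ ⊗≫ (𝟙_ C ◁ (A ◁ g) ≫ coev Y' ▷ (A ⊗ Y')) ⊗≫ Y' ◁ r' := by monoidal
    _ = 𝟙 _ ⊗≫ coev Y' ▷ (A ⊗ Y) ⊗≫ Y' ◁ ((dual Y' ⊗ A) ◁ g ≫ r') := by
      rw [whisker_exchange]; monoidal
    _ = 𝟙 _ ⊗≫ (coev Y' ≫ Y' ◁ dualMap g) ▷ (A ⊗ Y) ⊗≫ Y' ◁ r := by rw [← h]; monoidal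
    _ = 𝟙 _ ⊗≫ coev Y ▷ (A ⊗ Y) ⊗≫ (g ▷ ((dual Y ⊗ A) ⊗ Y) ≫ Y' ◁ r) := by
      rw [coev_dualMap]; monoidal
    _ = _ := by rw [← whisker_exchange]; monoidal

theorem mateL_natural {Y Y' : C} (g : Y ⟶ Y') {t : A ⊗ Y ⟶ Y ⊗ E} {t' : A ⊗ Y' ⟶ Y' ⊗ E}
    (h : A ◁ g ≫ t' = t ≫ g ▷ E) :
    (dualMap g ▷ A) ▷ Y ≫ mateL t = (dual Y' ⊗ A) ◁ g ≫ mateL t' := by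
  simp only [mateL]
  calc
    _ = 𝟙 _ ⊗≫ (dualMap g ▷ (A ⊗ Y) ≫ dual Y ◁ t) ⊗≫ ev Y ▷ E ⊗≫ 𝟙 _ := by monoidal
    _ = 𝟙 _ ⊗≫ dual Y' ◁ t ⊗≫ (dualMap g ▷ Y ≫ ev Y) ▷ E ⊗≫ 𝟙 _ := by
      rw [← whisker_exchange]; monoidal
    _ = 𝟙 _ ⊗≫ dual Y' ◁ (t ≫ g ▷ E) ⊗≫ ev Y' ▷ E ⊗≫ 𝟙 _ := by rw [dualMap_ev]; monoidal
    _ = _ := by rw [← h]; monoidal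

end Universal

/-! ### Centralizers -/

section Centralizer

variable {G : Type w} [Group G] {C : Type u} [Category.{v} C] [Preadditive C]
  [HasFiniteBiproducts C] [MonoidalCategory C] [PivotalCategory C] {𝒢 : PivotalGrading G C}
  {α β γ : G}

theorem exists_centralizer (h : GCentralizable 𝒢) (α : G) : Nonempty (Centralizer 𝒢 α) := by
  have := h α
  let ι : ∀ (X : C) {Y : C}, 𝒢.comp α Y → ((dual Y ⊗ X) ⊗ Y ⟶ coend (coendFunctor 𝒢 α X)) :=
    fun X Y hY => coend.ι (coendFunctor 𝒢 α X) ⟨Y, hY⟩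
  have hι : ∀ (X : C) {Y Y' : C} (hY : 𝒢.comp α Y) (hY' : 𝒢.comp α Y') (g : Y ⟶ Y'),
      (dualMap g ▷ X) ▷ Y ≫ ι X hY = (dual Y' ⊗ X) ◁ g ≫ ι X hY' := fun X Y Y' hY hY' g =>
    coend.condition (coendFunctor 𝒢 α X) (i := ⟨Y, hY⟩) (j := ⟨Y', hY'⟩) (ObjectProperty.homMk g)
  have hex : ∀ {X X' : C} (f : X ⟶ X'), ∃ m : coend (coendFunctor 𝒢 α X) ⟶
      coend (coendFunctor 𝒢 α X'), ∀ {Y : C} (hY : 𝒢.comp α Y),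
        ι X hY ≫ m = (dual Y ◁ f) ▷ Y ≫ ι X' hY := fun {X X'} f =>
    ⟨coend.desc (fun Y => (dual Y.obj ◁ f) ▷ Y.obj ≫ ι X' Y.property) (fun Y Y' g => by
      have := hι X' Y.property Y'.property g.hom
      change (dualMap g.hom ▷ X) ▷ Y.obj ≫ (dual Y.obj ◁ f) ▷ Y.obj ≫ _ =
        (dual Y'.obj ⊗ X) ◁ g.hom ≫ (dual Y'.obj ◁ f) ▷ Y'.obj ≫ _
      rw [← comp_whiskerRight_assoc, ← whisker_exchange, comp_whiskerRight_assoc, this,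
        whisker_exchange_assoc]), fun hY =>
      coend.ι_desc (F := coendFunctor 𝒢 α X) _ _ (ObjectProperty.FullSubcategory.mk _ hY)⟩
  choose m hm using @hex
  have hext : ∀ {X E : C} {f g : coend (coendFunctor 𝒢 α X) ⟶ E},
      (∀ {Y : C} (hY : 𝒢.comp α Y), ι X hY ≫ f = ι X hY ≫ g) → f = g :=
    fun h => coend.hom_ext fun Y => h Y.property
  exact ⟨{
    Z :=
      { obj := fun X => coend (coendFunctor 𝒢 α X)
        map := fun f => m f
        map_id := fun X => hext fun hY => by rw [hm]; simp
        map_comp := fun f g => hext fun hY => by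
          rw [hm, reassoc_of% hm f hY, hm]; simp }
    ρ := ι
    naturality := fun f _ hY => (hm f hY).symm
    dinaturality := hι
    isColimit := fun X => ⟨IsColimit.ofIsoColimit (colimit.isColimit _)
      (Cowedge.ext (Iso.refl _) (fun _ => Category.comp_id _))⟩ }⟩

namespace Centralizer

variable (Z : Centralizer 𝒢 α)

/-- The family of the morphisms `∂`. -/
@[simps]
def fam (X : C) : Fam (𝒢.comp α) X (Z.Z.obj X) where
  app hY := Z.del X hY
  naturality hY hY' g := comate_natural g (Z.dinaturality X hY hY' g)

theorem mateL_del (X : C) {Y : C} (hY : 𝒢.comp α Y) : mateL (Z.del X hY) = Z.ρ X hY :=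
  mateL_comate (Z.ρ X hY)

theorem universal (X : C) : (Z.fam X).Universal where
  exists_desc {E} T := by
    obtain ⟨hc⟩ := Z.isColimit X
    refine ⟨Cowedge.IsColimit.desc hc (fun Y => mateL (T.app Y.property))
      (fun Y Y' g => mateL_natural g.hom (T.naturality Y.property Y'.property g.hom)),
      fun {Y} hY => ?_⟩
    have h := Cowedge.IsColimit.π_desc hc (fun Y => mateL (T.app Y.property))
      (fun Y Y' g => mateL_natural g.hom (T.naturality Y.property Y'.property g.hom)) ⟨Y, hY⟩
    refine (comate_post (Z.ρ X hY) _).symm.trans ((congrArg comate h).trans ?_)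
    exact comate_mateL (T.app hY)
  hom_ext {E} m m' h := by
    obtain ⟨hc⟩ := Z.isColimit X
    refine Cowedge.IsColimit.hom_ext hc fun Y => ?_
    have h' := congrArg mateL (h Y.property)
    rw [mateL_post, mateL_post, fam_app, mateL_del] at h'
    exact h'

theorem del_natural {X X' : C} (f : X ⟶ X') {Y : C} (hY : 𝒢.comp α Y) :
    Z.del X hY ≫ Y ◁ Z.Z.map f = f ▷ Y ≫ Z.del X' hY :=
  (comate_post (Z.ρ X hY) (Z.Z.map f)).symm.trans
    ((congrArg comate (Z.naturality f hY).symm).trans (comate_pre f (Z.ρ X' hY)))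

end Centralizer

end Centralizer

end GCat

end

noncomputable section

namespace GCat

/-! ### Coherence of comonoidal structures, tested by families of squares -/

section OplaxCoherence

variable {C : Type u} [Category.{v} C] [MonoidalCategory C] {Y A B E A' B' E' AB BE ABE ABE' : C}
  {f : A ⊗ Y ⟶ Y ⊗ A'} {g : B ⊗ Y ⟶ Y ⊗ B'} {h : E ⊗ Y ⟶ Y ⊗ E'}

theorem comp_comul_assoc {fg : (A ⊗ B) ⊗ Y ⟶ Y ⊗ AB} {gh : (B ⊗ E) ⊗ Y ⟶ Y ⊗ BE}
    {s : ((A ⊗ B) ⊗ E) ⊗ Y ⟶ Y ⊗ ABE} {s' : (A ⊗ (B ⊗ E)) ⊗ Y ⟶ Y ⊗ ABE'}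
    {m₁ : AB ⟶ A' ⊗ B'} {m₂ : ABE ⟶ AB ⊗ E'} {m₃ : BE ⟶ B' ⊗ E'} {m₄ : ABE' ⟶ A' ⊗ BE}
    {a : ABE ⟶ ABE'} (h₁ : fg ≫ Y ◁ m₁ = vc f g) (h₂ : s ≫ Y ◁ m₂ = vc fg h)
    (h₃ : gh ≫ Y ◁ m₃ = vc g h) (h₄ : s' ≫ Y ◁ m₄ = vc f gh)
    (ha : s ≫ Y ◁ a = (α_ A B E).hom ▷ Y ≫ s') :
    s ≫ Y ◁ (m₂ ≫ m₁ ▷ E' ≫ (α_ A' B' E').hom) = s ≫ Y ◁ (a ≫ m₄ ≫ A' ◁ m₃) := by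
  simp only [MonoidalCategory.whiskerLeft_comp]
  rw [reassoc_of% h₂, reassoc_of% ha, reassoc_of% h₄, ← Category.assoc (vc _ _), vc_post_left, h₁,
    vc_assoc, vc_post_right, h₃]

theorem comp_counit_left {s : 𝟙_ C ⊗ Y ⟶ Y ⊗ E} {s' : (𝟙_ C ⊗ A) ⊗ Y ⟶ Y ⊗ B'} {e : E ⟶ 𝟙_ C}
    {m : B' ⟶ E ⊗ A'} {l : A' ⟶ B'} (he : s ≫ Y ◁ e = vu Y) (hm : s' ≫ Y ◁ m = vc s f)
    (hl : f ≫ Y ◁ l = (λ_ A).inv ▷ Y ≫ s') :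
    f ≫ Y ◁ (λ_ A').inv = f ≫ Y ◁ (l ≫ m ≫ e ▷ A') := by
  simp only [MonoidalCategory.whiskerLeft_comp]
  rw [reassoc_of% hl, reassoc_of% hm, vc_post_left, he, ← cancel_epi ((λ_ A).hom ▷ Y),
    hom_inv_whiskerRight_assoc, ← reassoc_of% vu_vc f, whiskerLeft_hom_inv, Category.comp_id]

theorem comp_counit_right {s : 𝟙_ C ⊗ Y ⟶ Y ⊗ E} {s' : (A ⊗ 𝟙_ C) ⊗ Y ⟶ Y ⊗ B'} {e : E ⟶ 𝟙_ C}
    {m : B' ⟶ A' ⊗ E} {r : A' ⟶ B'} (he : s ≫ Y ◁ e = vu Y) (hm : s' ≫ Y ◁ m = vc f s)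
    (hr : f ≫ Y ◁ r = (ρ_ A).inv ▷ Y ≫ s') :
    f ≫ Y ◁ (ρ_ A').inv = f ≫ Y ◁ (r ≫ m ≫ A' ◁ e) := by
  simp only [MonoidalCategory.whiskerLeft_comp]
  rw [reassoc_of% hr, reassoc_of% hm, vc_post_right, he, ← cancel_epi ((ρ_ A).hom ▷ Y),
    hom_inv_whiskerRight_assoc, ← reassoc_of% vc_vu f, whiskerLeft_hom_inv, Category.comp_id]

theorem comp_comul_left {fh : (A ⊗ E) ⊗ Y ⟶ Y ⊗ AB} {gh : (B ⊗ E) ⊗ Y ⟶ Y ⊗ BE} {a : A ⟶ B}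
    {a' : A' ⟶ B'} {a'' : AB ⟶ BE} {m : AB ⟶ A' ⊗ E'} {m' : BE ⟶ B' ⊗ E'}
    (ha : f ≫ Y ◁ a' = a ▷ Y ≫ g) (ha' : fh ≫ Y ◁ a'' = (a ▷ E) ▷ Y ≫ gh)
    (hm : fh ≫ Y ◁ m = vc f h) (hm' : gh ≫ Y ◁ m' = vc g h) :
    fh ≫ Y ◁ (m ≫ a' ▷ E') = fh ≫ Y ◁ (a'' ≫ m') := by
  simp only [MonoidalCategory.whiskerLeft_comp]
  rw [reassoc_of% hm, reassoc_of% ha', hm', vc_post_left, ha, pre_vc_left]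

theorem comp_comul_right {hf : (E ⊗ A) ⊗ Y ⟶ Y ⊗ AB} {hg : (E ⊗ B) ⊗ Y ⟶ Y ⊗ BE} {a : A ⟶ B}
    {a' : A' ⟶ B'} {a'' : AB ⟶ BE} {m : AB ⟶ E' ⊗ A'} {m' : BE ⟶ E' ⊗ B'}
    (ha : f ≫ Y ◁ a' = a ▷ Y ≫ g) (ha' : hf ≫ Y ◁ a'' = (E ◁ a) ▷ Y ≫ hg)
    (hm : hf ≫ Y ◁ m = vc h f) (hm' : hg ≫ Y ◁ m' = vc h g) :
    hf ≫ Y ◁ (m ≫ E' ◁ a') = hf ≫ Y ◁ (a'' ≫ m') := by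
  simp only [MonoidalCategory.whiskerLeft_comp]
  rw [reassoc_of% hm, reassoc_of% ha', hm', vc_post_right, ha, pre_vc_right]

end OplaxCoherence

variable {G : Type w} [Group G] {C : Type u} [Category.{v} C] [Preadditive C]
  [HasFiniteBiproducts C] [MonoidalCategory C] [PivotalCategory C] {𝒢 : PivotalGrading G C}
  {α β γ : G}

/-! ### Existence of the free functors -/

/-- The quotients `∂^γ/∂^β` form a natural family of degree `α` with source `Z_β (X)`, and hence
factor through the universal family `∂^α`. -/
theorem Centralizer.exists_Z2 (Zα : Centralizer 𝒢 α) (Zβ : Centralizer 𝒢 β)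
    (Zγ : Centralizer 𝒢 γ) (h : β * α = γ) (X : C) :
    ∃ m : Zα.Z.obj (Zβ.Z.obj X) ⟶ Zγ.Z.obj X, ∀ {Y : C} (hY : 𝒢.comp α Y),
      (Zβ.fam X).Divides (Zγ.fam X) (Zα.del (Zβ.Z.obj X) hY ≫ Y ◁ m) := by
  choose g hg using fun (Y : C) (hY : 𝒢.comp α Y) =>
    (Zβ.universal X).exists_divides (Zγ.fam X) (fun _ hY' => mem_tensor h hY' hY)
  obtain ⟨m, hm⟩ := (Zα.universal (Zβ.Z.obj X)).exists_desc
    { app := fun {Y} hY => g Y hY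
      naturality := fun hY hY' f => Fam.Detects.natural (Zβ.universal X).detects
        (fun _ hY' => mem_tensor h hY' hY) (fun _ h' => mem_tensor h h' hY') (hg _ hY)
        (hg _ hY') f }
  refine ⟨m, fun {Y} hY => ?_⟩
  rw [show Zα.del (Zβ.Z.obj X) hY ≫ Y ◁ m = g Y hY from hm hY]
  exact hg Y hY

theorem hc_post_eq {C : Type u} [Category.{v} C] [MonoidalCategory C] {A B E F Y Z : C}
    (f : A ⊗ Y ⟶ Y ⊗ B) (g : B ⊗ Z ⟶ Z ⊗ E) (m : E ⟶ F) :
    hc f (g ≫ Z ◁ m) = 𝟙 _ ⊗≫ f ▷ Z ⊗≫ Y ◁ g ⊗≫ (Y ⊗ Z) ◁ m := by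
  simp only [hc]; monoidal

theorem vc_eq {C : Type u} [Category.{v} C] [MonoidalCategory C] {A B A' B' Y : C}
    (f : A ⊗ Y ⟶ Y ⊗ A') (g : B ⊗ Y ⟶ Y ⊗ B') :
    vc f g = 𝟙 _ ⊗≫ A ◁ g ⊗≫ f ▷ B' ≫ (α_ Y A' B').hom := by
  simp only [vc]; monoidal

variable (Z : ∀ α : G, Centralizer 𝒢 α)

/-- The half braidings of the free objects. -/
def freeHalfBraidings : FreeHalfBraidings Z where
  Z2 α β γ h X := ((Z α).exists_Z2 (Z β) (Z γ) h X).choose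
  Z2_spec α β γ h X Y Y' hY hY' :=
    (hc_post_eq _ _ _).symm.trans
      (((Z α).exists_Z2 (Z β) (Z γ) h X).choose_spec hY Y' hY' (mem_tensor h hY' hY))
  halfBraiding α X := Fam.Detects.halfBraiding ((Z α).universal X).detects
    (fun hX _ hY => mem_tensor_one hX hY) 𝒢.unit_mem mem_one_dual
    (fun hX hY => mem_tensor_one hY hX)
    (fun {Y} hY => (Z 1).del ((Z α).Z.obj X) hY ≫
      Y ◁ ((Z 1).exists_Z2 (Z α) (Z α) (mul_one α) X).choose)
    (fun hY => ((Z 1).exists_Z2 (Z α) (Z α) (mul_one α) X).choose_spec hY)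
  halfBraiding_spec α X Y hY := rfl
  map_comm α {X X'} f {Y} hY := by
    refine Fam.Detects.comm_of_divides ((Z α).universal X).detects
      (T := ((Z α).fam X').pre f) (fun hY => (Z α).del_natural f hY)
      (fun _ hY' => mem_tensor_one hY hY')
      (((Z 1).exists_Z2 (Z α) (Z α) (mul_one α) X).choose_spec hY) (fun Y' hY' hYY' => ?_)
    exact (pre_hc _ _ _).trans (congrArg (f ▷ (Y' ⊗ Y) ≫ ·)
      (((Z 1).exists_Z2 (Z α) (Z α) (mul_one α) X').choose_spec hY Y' hY' hYY'))

variable {Z}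

namespace FreeHalfBraidings

variable (F : FreeHalfBraidings Z)

theorem divides (h : β * α = γ) (X : C) {Y : C} (hY : 𝒢.comp α Y) :
    ((Z β).fam X).Divides ((Z γ).fam X)
      ((Z α).del ((Z β).Z.obj X) hY ≫ Y ◁ F.Z2 α β γ h X) :=
  fun _ hY' _ => (hc_post_eq _ _ _).trans (F.Z2_spec α β γ h X hY hY')

/-- The half braiding of a free object is the quotient of `∂^α` by itself. -/
theorem braids (α : G) (X : C) :
    Fam.Braids (B := (F.functor α).obj X) ((Z α).fam X) := by
  intro Y hY
  rw [show RelCenter.σ ((F.functor α).obj X) hY = _ from F.halfBraiding_spec α X hY]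
  exact F.divides (mul_one α) X hY

/-- Universal property of the free object inside the center, from which its comonoidal structure is
obtained. -/
theorem exists_centerHom (α : G) (X : C) {E : ZG 𝒢} (T : Fam (𝒢.comp α) X E.obj)
    (hT : Fam.Braids T) : ∃ m : (F.functor α).obj X ⟶ E,
      ∀ {Y : C} (hY : 𝒢.comp α Y), (Z α).del X hY ≫ Y ◁ m.f = T.app hY := by
  obtain ⟨m, hm⟩ := ((Z α).universal X).exists_desc T
  exact ⟨{ f := m
           comm := fun {Y} hY => Fam.Detects.comm_of_divides ((Z α).universal X).detects hm
             (fun _ hY' => mem_tensor_one hY hY') (F.braids α X hY) (hT hY) }, hm⟩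

theorem hom_ext (α : G) {X : C} {E : ZG 𝒢} {m m' : (F.functor α).obj X ⟶ E}
    (h : ∀ {Y : C} (hY : 𝒢.comp α Y), (Z α).del X hY ≫ Y ◁ m.f = (Z α).del X hY ≫ Y ◁ m'.f) :
    m = m' :=
  RelCenter.hom_ext (((Z α).universal X).hom_ext _ _ h)

theorem exists_comul (α : G) (X₁ X₂ : C) :
    ∃ m : (F.functor α).obj (X₁ ⊗ X₂) ⟶ (F.functor α).obj X₁ ⊗ (F.functor α).obj X₂,
      ∀ {Y : C} (hY : 𝒢.comp α Y),
        (Z α).del (X₁ ⊗ X₂) hY ≫ Y ◁ m.f = vc ((Z α).del X₁ hY) ((Z α).del X₂ hY) :=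
  F.exists_centerHom α (X₁ ⊗ X₂) (E := (F.functor α).obj X₁ ⊗ (F.functor α).obj X₂)
    (((Z α).fam X₁).tensor ((Z α).fam X₂)) 
    (Fam.Braids.tensor (B := (F.functor α).obj X₁) (B' := (F.functor α).obj X₂) (F.braids α X₁)
      (F.braids α X₂))

theorem exists_counit (α : G) : ∃ m : (F.functor α).obj (𝟙_ C) ⟶ 𝟙_ (ZG 𝒢),
    ∀ {Y : C} (hY : 𝒢.comp α Y), (Z α).del (𝟙_ C) hY ≫ Y ◁ m.f = vu Y :=
  F.exists_centerHom α (𝟙_ C) (E := 𝟙_ (ZG 𝒢)) (Fam.unit (𝒢.comp α)) (Fam.braids_unit α)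

/-- The comonoidal structure of the free functors. -/
abbrev oplax (α : G) : (F.functor α).OplaxMonoidal where
  η := (F.exists_counit α).choose
  δ X₁ X₂ := (F.exists_comul α X₁ X₂).choose
  δ_natural_left {X₁ X₂} f X := F.hom_ext α fun hY =>
    comp_comul_left ((Z α).del_natural f hY) ((Z α).del_natural (f ▷ X) hY)
      ((F.exists_comul α X₁ X).choose_spec hY) ((F.exists_comul α X₂ X).choose_spec hY)
  δ_natural_right {X₁ X₂} X f := F.hom_ext α fun hY =>
    comp_comul_right ((Z α).del_natural f hY) ((Z α).del_natural (X ◁ f) hY)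
      ((F.exists_comul α X X₁).choose_spec hY) ((F.exists_comul α X X₂).choose_spec hY)
  oplax_associativity X₁ X₂ X₃ := F.hom_ext α fun hY =>
    comp_comul_assoc ((F.exists_comul α X₁ X₂).choose_spec hY)
      ((F.exists_comul α (X₁ ⊗ X₂) X₃).choose_spec hY) ((F.exists_comul α X₂ X₃).choose_spec hY)
      ((F.exists_comul α X₁ (X₂ ⊗ X₃)).choose_spec hY) ((Z α).del_natural (α_ X₁ X₂ X₃).hom hY)
  oplax_left_unitality X := F.hom_ext α fun hY =>
    comp_counit_left ((F.exists_counit α).choose_spec hY)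
      ((F.exists_comul α (𝟙_ C) X).choose_spec hY) ((Z α).del_natural (λ_ X).inv hY)
  oplax_right_unitality X := F.hom_ext α fun hY =>
    comp_counit_right ((F.exists_counit α).choose_spec hY)
      ((F.exists_comul α X (𝟙_ C)).choose_spec hY) ((Z α).del_natural (ρ_ X).inv hY)

/-- The free functors. -/
def freeFunctors : FreeFunctors Z where
  toFreeHalfBraidings := F
  oplaxMonoidal := F.oplax
  comul_spec α X₁ X₂ _ hY := ((F.exists_comul α X₁ X₂).choose_spec hY).trans (vc_eq _ _)
  counit_spec α _ hY := (F.exists_counit α).choose_spec hY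

end FreeHalfBraidings

end GCat

end

noncomputable section

namespace GCat

/-! ### Cancellation lemmas for the comparison isomorphisms -/

section ComparisonCoherence

variable {C : Type u} [Category.{v} C] [MonoidalCategory C] {Y Y' A B E A' B' E' K L M N : C}

theorem WhiskerInj.counit_eq (hY : WhiskerInj Y) {τ : A ⊗ Y ⟶ Y ⊗ A'} [IsIso τ]
    {t : 𝟙_ C ⊗ Y ⟶ Y ⊗ E} {g : A ⊗ Y ⟶ Y ⊗ B} {w : A' ⟶ B} {η : B ⟶ 𝟙_ C} {η' : A ⟶ 𝟙_ C}
    {m : A' ⟶ E} {e : 𝟙_ C ⟶ E} {e' : E ⟶ 𝟙_ C} (hw : τ ≫ Y ◁ w = g)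
    (hg : g ≫ Y ◁ η = η' ▷ Y ≫ vu Y) (hm : τ ≫ Y ◁ m = η' ▷ Y ≫ t) (he : vu Y ≫ Y ◁ e = t)
    (h : e ≫ e' = 𝟙 _) : w ≫ η = m ≫ e' := by
  refine hY.ext τ ?_
  simp only [MonoidalCategory.whiskerLeft_comp]
  rw [reassoc_of% hw, hg, reassoc_of% hm, ← he, Category.assoc, ← MonoidalCategory.whiskerLeft_comp,
    h, MonoidalCategory.whiskerLeft_id, Category.comp_id]

theorem WhiskerInj.comul_eq (hY : WhiskerInj Y) {τ : N ⊗ Y ⟶ Y ⊗ L} [IsIso τ]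
    {τ₁ : A ⊗ Y ⟶ Y ⊗ A'} {τ₂ : B ⊗ Y ⟶ Y ⊗ B'} {t : (A ⊗ B) ⊗ Y ⟶ Y ⊗ K} {g : N ⊗ Y ⟶ Y ⊗ M}
    {g₁ : A ⊗ Y ⟶ Y ⊗ E} {g₂ : B ⊗ Y ⟶ Y ⊗ E'} {w : L ⟶ M} {w₁ : A' ⟶ E} {w₂ : B' ⟶ E'}
    {d : M ⟶ E ⊗ E'} {d' : N ⟶ A ⊗ B} {m : L ⟶ K} {e : A' ⊗ B' ⟶ K} {e' : K ⟶ A' ⊗ B'}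
    (hw : τ ≫ Y ◁ w = g) (hw₁ : τ₁ ≫ Y ◁ w₁ = g₁) (hw₂ : τ₂ ≫ Y ◁ w₂ = g₂)
    (hg : g ≫ Y ◁ d = d' ▷ Y ≫ vc g₁ g₂) (hm : τ ≫ Y ◁ m = d' ▷ Y ≫ t)
    (he : vc τ₁ τ₂ ≫ Y ◁ e = t) (h : e ≫ e' = 𝟙 _) : w ≫ d = (m ≫ e') ≫ (w₁ ⊗ₘ w₂) := by
  refine hY.ext τ ?_
  simp only [MonoidalCategory.whiskerLeft_comp, Category.assoc]
  rw [reassoc_of% hw, hg, reassoc_of% hm, ← he, Category.assoc,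
    ← whiskerLeft_comp_assoc, h, MonoidalCategory.whiskerLeft_id, Category.id_comp, ← vc_post,
    hw₁, hw₂]

theorem WhiskerInj.mul_comp_eq (hY : WhiskerInj (Y' ⊗ Y)) {s : A ⊗ Y' ⟶ Y' ⊗ B}
    {t : B ⊗ Y ⟶ Y ⊗ E} [IsIso s] [IsIso t] {r : A ⊗ (Y' ⊗ Y) ⟶ (Y' ⊗ Y) ⊗ K}
    {g : A ⊗ (Y' ⊗ Y) ⟶ (Y' ⊗ Y) ⊗ N} {t' : L ⊗ Y ⟶ Y ⊗ M} {g₂ : A ⊗ Y' ⟶ Y' ⊗ L}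
    {g₃ : L ⊗ Y ⟶ Y ⊗ N} {m : E ⟶ K} {w₁ : K ⟶ N} {w₂ : B ⟶ L} {w₂' : E ⟶ M} {w₃ : M ⟶ N}
    (hm : hc s t ≫ (Y' ⊗ Y) ◁ m = r) (h₁ : r ≫ (Y' ⊗ Y) ◁ w₁ = g) (h₂ : s ≫ Y' ◁ w₂ = g₂)
    (ht : t ≫ Y ◁ w₂' = w₂ ▷ Y ≫ t') (h₃ : t' ≫ Y ◁ w₃ = g₃) (hg : hc g₂ g₃ = g) :
    m ≫ w₁ = w₂' ≫ w₃ := by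
  refine hY.ext (hc s t) ?_
  simp only [MonoidalCategory.whiskerLeft_comp]
  rw [reassoc_of% hm, h₁, ← reassoc_of% hc_post, ht, ← hc_mid, h₂, ← hc_post, h₃, hg]

theorem comp_natural {τ : A ⊗ Y ⟶ Y ⊗ A'} {τ' : B ⊗ Y ⟶ Y ⊗ B'} {g : A ⊗ Y ⟶ Y ⊗ E}
    {g' : B ⊗ Y ⟶ Y ⊗ E'} {a : A ⟶ B} {m : A' ⟶ B'} {w : A' ⟶ E} {w' : B' ⟶ E'} {b : E ⟶ E'}
    (hm : τ ≫ Y ◁ m = a ▷ Y ≫ τ') (hw : τ ≫ Y ◁ w = g) (hw' : τ' ≫ Y ◁ w' = g')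
    (hg : a ▷ Y ≫ g' = g ≫ Y ◁ b) : τ ≫ Y ◁ (m ≫ w') = τ ≫ Y ◁ (w ≫ b) := by
  simp only [MonoidalCategory.whiskerLeft_comp]
  rw [reassoc_of% hm, hw', reassoc_of% hw, hg]

end ComparisonCoherence

variable {G : Type w} [Group G] {C : Type u} [Category.{v} C] [Preadditive C]
  [HasFiniteBiproducts C] [MonoidalCategory C] [PivotalCategory C] {𝒢 : PivotalGrading G C}
  {α β γ : G} {Z : ∀ α : G, Centralizer 𝒢 α}

/-! ### Twists between free objects -/

namespace FreeHalfBraidings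

variable (F : FreeHalfBraidings Z)

/-- The twists over the free objects with values in free objects. -/
def quotient (h : β * α = γ) (X : C) : Fam (𝒢.comp α) ((Z β).Z.obj X) ((Z γ).Z.obj X) :=
  ((Z α).fam ((Z β).Z.obj X)).post (F.Z2 α β γ h X)

theorem divides_quotient (h : β * α = γ) (X : C) {Y : C} (hY : 𝒢.comp α Y) :
    ((Z β).fam X).Divides ((Z γ).fam X) ((F.quotient h X).app hY) :=
  F.divides h X hY

/-- The link between the two constructions. The families `∂^β` and `∂^γ` both detect, and the
reverse quotient `∂^β/∂^γ` over duals, given by `Z₂(α⁻¹, γ)`, supplies invertibility. -/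
theorem quotient_isTwist (h : β * α = γ) (X : C) :
    (F.quotient h X).IsTwist ((F.functor β).obj X) :=
  Fam.isTwist_of_divides (B := (F.functor β).obj X) (E := (F.functor γ).obj X)
    ((Z β).universal X).detects ((Z γ).universal X).detects h (F.braids β X)
    (fun hY => F.divides_quotient h X hY)
    (fun hY => ⟨_, F.divides (α := α⁻¹) (by rw [← h, mul_inv_cancel_right]) X (𝒢.dual_mem hY)⟩)

theorem quotient_braids (h : β * α = γ) (X : C) :
    Fam.Braids (B := (F.functor γ).obj X) (F.quotient h X) :=
  Fam.braids_of_divides (B := (F.functor β).obj X) (E := (F.functor γ).obj X)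
    ((Z β).universal X).detects h (F.braids γ X) (fun hY => F.divides_quotient h X hY)

theorem quotient_one (X : C) {Y : C} (hY : 𝒢.comp 1 Y) :
    (F.quotient (mul_one α) X).app hY = RelCenter.σ ((F.functor α).obj X) hY :=
  (F.halfBraiding_spec α X hY).symm

theorem quotient_natural (h : β * α = γ) {X X' : C} (f : X ⟶ X') {Y : C} (hY : 𝒢.comp α Y) :
    (Z β).Z.map f ▷ Y ≫ (F.quotient h X').app hY =
      (F.quotient h X).app hY ≫ Y ◁ (Z γ).Z.map f := by
  refine Fam.Detects.hc_ext ((Z β).universal X).detects fun {Y'} hY' => ?_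
  have hn := (Z β).del_natural f hY'
  rw [← hc_mid, hc_post, F.divides_quotient h X hY Y' hY' (mem_tensor h hY' hY)]
  refine (congrArg (fun t => hc t _) hn).trans ((pre_hc _ _ _).trans ?_)
  refine (congrArg (fun t => f ▷ (Y' ⊗ Y) ≫ t)
    (F.divides_quotient h X' hY Y' hY' (mem_tensor h hY' hY))).trans ?_
  exact ((Z γ).del_natural f _).symm

/-- Multiplicativity of quotients and their uniqueness; the intermediate family `∂^{γβ}` cancels. -/
theorem quotient_hc {βα γβ γβα : G} (h₁ : β * α = βα) (h₂ : γ * β = γβ) (h₃ : γ * βα = γβα)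
    (h₄ : γβ * α = γβα) (X : C) {Y' Y : C} (hY' : 𝒢.comp β Y') (hY : 𝒢.comp α Y) :
    hc ((F.quotient h₂ X).app hY') ((F.quotient h₄ X).app hY) =
      (F.quotient h₃ X).app (mem_tensor h₁ hY' hY) :=
  Fam.Detects.unique ((Z γ).universal X).detects
    (fun _ h => mem_tensor h₃ h (mem_tensor h₁ hY' hY))
    ((F.divides_quotient h₂ X hY').comp (fun _ h => mem_tensor h₂ h hY')
      (fun _ h => mem_tensor h₄ h hY) (F.divides_quotient h₄ X hY))
    (F.divides_quotient h₃ X _)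

end FreeHalfBraidings

namespace FreeFunctors

variable (F : FreeFunctors Z)

/-- The counits carry `∂^β` and `∂^γ` to the trivial family, whose quotient by itself is trivial. -/
theorem quotient_counit (h : β * α = γ) {Y : C} (hY : 𝒢.comp α Y) :
    (F.quotient h (𝟙_ C)).app hY ≫ Y ◁ (Functor.OplaxMonoidal.η (F.functor γ)).f =
      (Functor.OplaxMonoidal.η (F.functor β)).f ▷ Y ≫ vu Y := by
  refine Fam.Detects.hc_ext ((Z β).universal (𝟙_ C)).detects fun {Y'} hY' => ?_
  refine (hc_post _ _ _).trans ?_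
  rw [F.divides_quotient h (𝟙_ C) hY Y' hY' (mem_tensor h hY' hY)]
  refine (F.counit_spec γ (mem_tensor h hY' hY)).trans (Eq.trans ?_ (hc_mid _ _ _))
  exact (hc_vu Y' Y).symm.trans (congrArg (fun t => hc t (vu Y)) (F.counit_spec β hY').symm)

/-- The comultiplications carry `∂` to vertical products, and by interchange the quotient of
vertical products is the vertical product of the quotients. -/
theorem quotient_comul (h : β * α = γ) (X₁ X₂ : C) {Y : C} (hY : 𝒢.comp α Y) :
    (F.quotient h (X₁ ⊗ X₂)).app hY ≫ Y ◁ (Functor.OplaxMonoidal.δ (F.functor γ) X₁ X₂).f =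
      (Functor.OplaxMonoidal.δ (F.functor β) X₁ X₂).f ▷ Y ≫
        vc ((F.quotient h X₁).app hY) ((F.quotient h X₂).app hY) := by
  refine Fam.Detects.hc_ext ((Z β).universal (X₁ ⊗ X₂)).detects fun {Y'} hY' => ?_
  have hY'Y := mem_tensor h hY' hY
  have hs : ∀ (δ : G) {W : C} (hW : 𝒢.comp δ W), (Z δ).del (X₁ ⊗ X₂) hW ≫
      W ◁ (Functor.OplaxMonoidal.δ (F.functor δ) X₁ X₂).f =
        vc ((Z δ).del X₁ hW) ((Z δ).del X₂ hW) :=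
    fun δ W hW => (F.comul_spec δ X₁ X₂ hW).trans (vc_eq _ _).symm
  refine (hc_post _ _ _).trans ?_
  rw [F.divides_quotient h (X₁ ⊗ X₂) hY Y' hY' hY'Y]
  refine (hs γ hY'Y).trans (Eq.trans ?_ (hc_mid _ _ _))
  refine Eq.trans ?_ (congrArg (fun t => hc t _) (hs β hY').symm)
  refine Eq.trans ?_ (hc_vc _ _ _ _).symm
  exact (congrArg₂ vc (F.divides_quotient h X₁ hY Y' hY' hY'Y)
    (F.divides_quotient h X₂ hY Y' hY' hY'Y)).symm

end FreeFunctors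

/-! ### The comparison isomorphisms -/

section Comparison

variable {k : Type w'} [CommRing k] [Linear k C] [MonoidalPreadditive C] [MonoidalLinear k C]
  (F : FreeFunctors Z) (φ : CanonicalCrossing 𝒢 k) (hns : NonSingular 𝒢)

/-- Both families are twists of degree `α` over `F_β (X)` compatible with the half braidings of
their targets, so they are isomorphic in the center. -/
theorem exists_comparison (F : FreeFunctors Z) (φ : CanonicalCrossing 𝒢 k)
    (hns : NonSingular 𝒢) (h : β * α = γ) :
    ∃ e : F.functor β ⋙ φ.functor α ≅ F.functor γ, ∀ (X : C) {Y : C} (hY : 𝒢.comp α Y),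
      ((φ.system α hns).fam ((F.functor β).obj X)).app hY ≫ Y ◁ (e.hom.app X).f =
        (F.quotient h X).app hY := by
  choose e he using fun X : C =>
    Fam.IsTwist.exists_iso (E := (F.functor γ).obj X) hns.pure (hns.invDim α)
      ((φ.system α hns).isTwist ((F.functor β).obj X))
      ((φ.system α hns).braids ((F.functor β).obj X)) (F.quotient_isTwist h X)
      (F.quotient_braids h X)
  refine ⟨NatIso.ofComponents e fun {X X'} f => ?_, fun X Y hY => he X hY⟩
  exact RelCenter.hom_ext (Fam.Detects.hom_ext
    (((φ.system α hns).isTwist ((F.functor β).obj X)).detects (hns.invDim α)) fun {Y} hY =>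
      comp_natural (((φ.system α hns).isTest hY).map ((F.functor β).map f)) (he X hY) (he X' hY)
        (F.quotient_natural h f hY))

/-- The comparison isomorphisms `ω`. -/
def comparison (h : β * α = γ) : F.functor β ⋙ φ.functor α ≅ F.functor γ :=
  (exists_comparison F φ hns h).choose

theorem system_comparison (h : β * α = γ) (X : C) {Y : C} (hY : 𝒢.comp α Y) :
    ((φ.system α hns).fam ((F.functor β).obj X)).app hY ≫
      Y ◁ ((comparison F φ hns h).hom.app X).f = (F.quotient h X).app hY :=
  (exists_comparison F φ hns h).choose_spec X hY

/-- The mate at `V` of the relation defining the comparison: the twist becomes `d_V p`, and `∂`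
becomes `ρ`. -/
theorem p_comparison (h : β * α = γ) (V : InvDim 𝒢 α) (X : C) :
    (φ.conj V).p ((F.functor β).obj X) ≫ ((φ.ι V).inv.app ((F.functor β).obj X)).f ≫
        ((comparison F φ hns h).hom.app X).f =
      scal V.dInv ((Z α).ρ ((Z β).Z.obj X) V.mem ≫ F.Z2 α β γ h X) := by
  set B := (F.functor β).obj X
  have h₁ : ((φ.ι V).hom.app B).f ≫ ((φ.ι V).inv.app B).f = 𝟙 _ :=
    congrArg (·.f) ((φ.ι V).hom_inv_id_app B)
  have h₂ : (splitFam V B ((φ.conj V).p B)).app V.mem ≫ V.obj ◁ (((φ.ι V).inv.app B).f ≫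
      ((comparison F φ hns h).hom.app X).f) = (F.quotient h X).app V.mem := by
    rw [← φ.system_ι hns V B V.mem, Category.assoc, ← MonoidalCategory.whiskerLeft_comp,
      reassoc_of% h₁]
    exact system_comparison F φ hns h X V.mem
  have h₃ : mateL ((F.quotient h X).app V.mem) =
      (Z α).ρ ((Z β).Z.obj X) V.mem ≫ F.Z2 α β γ h X :=
    (mateL_post _ _).trans (congrArg (· ≫ _) ((Z α).mateL_del _ V.mem))
  refine Eq.trans ?_ (congrArg (fun t => scal V.dInv t) h₃)
  refine Eq.trans ?_ (congrArg (fun t => scal V.dInv (mateL t)) h₂)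
  rw [mateL_post, ← scal_comp, scal_mateL_twist ((φ.conj V).p_q B) ((φ.conj V).q_p B)]

/-- For uniqueness one `V` in each degree suffices: `p` is a split epimorphism and `ι` is
invertible, so the prescribed composite determines `ω`. -/
theorem isCanonical_iff
    (ω : ∀ α β γ : G, β * α = γ → (F.functor β ⋙ φ.functor α ≅ F.functor γ)) :
    IsCanonical F φ ω ↔ ω = fun _ _ _ h => comparison F φ hns h := by
  constructor
  · intro hω
    funext α β γ h
    refine Iso.ext (NatTrans.ext (funext fun X => RelCenter.hom_ext ?_))
    let V := hns.invDim α
    have h₁ := (hω α β γ h V X).trans (p_comparison F φ hns h V X).symm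
    have h₂ := congrArg (fun t => (φ.conj V).q ((F.functor β).obj X) ≫ t) h₁
    simp only [reassoc_of% (φ.conj V).q_p ((F.functor β).obj X)] at h₂
    have : IsIso ((φ.ι V).inv.app ((F.functor β).obj X)).f :=
      isIso_app_f (φ.ι V).symm ((F.functor β).obj X)
    exact (cancel_epi _).1 h₂
  · rintro rfl α β γ h V X
    exact p_comparison F φ hns h V X

theorem isComonoidal_comparison (h : β * α = γ) : IsComonoidal (comparison F φ hns h).hom where
  counit := by
    let V := hns.invDim α
    have hV : WhiskerInj V.obj := V.whiskerInj
    have := ((φ.system α hns).isTwist ((F.functor β).obj (𝟙_ C))).isIso V.mem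
    exact RelCenter.hom_ext (hV.counit_eq (system_comparison F φ hns h (𝟙_ C) V.mem)
      (F.quotient_counit h V.mem)
      (((φ.system α hns).isTest V.mem).map (Functor.OplaxMonoidal.η (F.functor β)))
      ((φ.system α hns).isTest V.mem).eps
      (congrArg (·.f) (Functor.Monoidal.ε_η (φ.functor α))))
  comul X₁ X₂ := by
    let V := hns.invDim α
    have hV : WhiskerInj V.obj := V.whiskerInj
    have := ((φ.system α hns).isTwist ((F.functor β).obj (X₁ ⊗ X₂))).isIso V.mem
    exact RelCenter.hom_ext ((hV.comul_eq
      (e' := (Functor.OplaxMonoidal.δ (φ.functor α) ((F.functor β).obj X₁)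
        ((F.functor β).obj X₂)).f)
      (system_comparison F φ hns h (X₁ ⊗ X₂) V.mem)
      (system_comparison F φ hns h X₁ V.mem) (system_comparison F φ hns h X₂ V.mem)
      (F.quotient_comul h X₁ X₂ V.mem)
      (((φ.system α hns).isTest V.mem).map (Functor.OplaxMonoidal.δ (F.functor β) X₁ X₂))
      (((φ.system α hns).isTest V.mem).mu _ _)
      (congrArg RelCenter.Hom.f (Functor.Monoidal.μ_δ (φ.functor α) _ _))).trans
        (congrArg (_ ≫ ·) (RelCenter.tensorHom_f _ _).symm))

/-- In degree `1` the quotient is the half braiding itself, and `φ₀` carries the half braiding to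
the twist of `φ_1`; hence the comparison inverts `φ₀`. -/
theorem comparison_one (α : G) (X : C) :
    (comparison F φ hns (mul_one α)).hom.app X = φ.one.inv.app ((F.functor α).obj X) := by
  let V := hns.invDim 1
  have hV : WhiskerInj V.obj := V.whiskerInj
  have h : φ.one.hom.app ((F.functor α).obj X) ≫ (comparison F φ hns (mul_one α)).hom.app X =
      𝟙 ((F.functor α).obj X) := by
    apply RelCenter.hom_ext
    have := (Fam.isTwist_fam ((F.functor α).obj X)).isIso V.mem
    refine hV.ext (RelCenter.σ ((F.functor α).obj X) V.mem) ?_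
    rw [RelCenter.comp_f, MonoidalCategory.whiskerLeft_comp,
      reassoc_of% φ.system_one hns ((F.functor α).obj X) V.mem, system_comparison,
      F.quotient_one, RelCenter.id_f, comp_whiskerLeft_id]
  exact (cancel_epi (φ.one.hom.app _)).1 (h.trans (φ.one.hom_inv_id_app _).symm)

/-- Precomposed with the product of twists at `V` and `U`, both sides become quotients of the
families `∂`, and `quotient_hc` identifies them. -/
theorem mul_comparison {βα γβ γβα : G} (h₁ : β * α = βα) (h₂ : γ * β = γβ) (h₃ : γ * βα = γβα)
    (h₄ : γβ * α = γβα) (X : C) :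
    (φ.mul α β βα h₁).hom.app ((F.functor γ).obj X) ≫ (comparison F φ hns h₃).hom.app X =
      (φ.functor α).map ((comparison F φ hns h₂).hom.app X) ≫
        (comparison F φ hns h₄).hom.app X := by
  let U := hns.invDim α
  let V := hns.invDim β
  have hVU : WhiskerInj (V.obj ⊗ U.obj) := WhiskerInj.tensor V.whiskerInj U.whiskerInj
  have := ((φ.system β hns).isTwist ((F.functor γ).obj X)).isIso V.mem
  have := ((φ.system α hns).isTwist ((φ.functor β).obj ((F.functor γ).obj X))).isIso U.mem
  exact RelCenter.hom_ext (hVU.mul_comp_eq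
    (φ.system_mul hns h₁ ((F.functor γ).obj X) V.mem U.mem)
    (system_comparison F φ hns h₃ X (mem_tensor h₁ V.mem U.mem))
    (system_comparison F φ hns h₂ X V.mem)
    (((φ.system α hns).isTest U.mem).map ((comparison F φ hns h₂).hom.app X))
    (system_comparison F φ hns h₄ X U.mem) (F.quotient_hc h₁ h₂ h₃ h₄ X V.mem U.mem))

end Comparison

end GCat

end

theorem theorem9p3 {k : Type w'} [CommRing k] {G : Type w} [Group G] {C : Type u} [Category.{v} C]
    [Preadditive C] [Linear k C] [HasFiniteBiproducts C] [MonoidalCategory C]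
    [MonoidalPreadditive C] [MonoidalLinear k C] [GCat.PivotalCategory C]
    (𝒢 : GCat.PivotalGrading G C) (hns : GCat.NonSingular 𝒢) (hcent : GCat.GCentralizable 𝒢) :
    Nonempty (GCat.CanonicalCrossing 𝒢 k) ∧
    Nonempty (∀ α : G, GCat.Centralizer 𝒢 α) ∧
    ∀ Z : ∀ α : G, GCat.Centralizer 𝒢 α,
      Nonempty (GCat.FreeFunctors Z) ∧
      ∀ (F : GCat.FreeFunctors Z) (φ : GCat.CanonicalCrossing 𝒢 k),
        ∃ ω : ∀ α β γ : G, β * α = γ → (F.functor β ⋙ φ.functor α ≅ F.functor γ),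
          (∀ ω' : ∀ α β γ : G, β * α = γ → (F.functor β ⋙ φ.functor α ≅ F.functor γ),
            GCat.IsCanonical F φ ω' ↔ ω' = ω) ∧
          (∀ (α β γ : G) (h : β * α = γ), GCat.IsComonoidal (ω α β γ h).hom) ∧
          (∀ (α : G) (X : C),
            (ω 1 α α (mul_one α)).hom.app X = φ.one.inv.app ((F.functor α).obj X)) ∧
          (∀ (α β γ βα γβ γβα : G) (h₁ : β * α = βα) (h₂ : γ * β = γβ) (h₃ : γ * βα = γβα)
            (h₄ : γβ * α = γβα) (X : C),
            (φ.mul α β βα h₁).hom.app ((F.functor γ).obj X) ≫ (ω βα γ γβα h₃).hom.app X =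
              (φ.functor α).map ((ω β γ γβ h₂).hom.app X) ≫ (ω α γβ γβα h₄).hom.app X) := by
  refine ⟨⟨hns.canonicalCrossing k⟩, ⟨fun α => (GCat.exists_centralizer hcent α).some⟩,
    fun Z => ⟨⟨(GCat.freeHalfBraidings Z).freeFunctors⟩, fun F φ =>
      ⟨fun _ _ _ h => GCat.comparison F φ hns h, GCat.isCanonical_iff F φ hns,
        fun _ _ _ h => GCat.isComonoidal_comparison F φ hns h,
        fun α X => GCat.comparison_one F φ hns α X,
        fun _ _ _ _ _ _ h₁ h₂ h₃ h₄ X => GCat.mul_comparison F φ hns h₁ h₂ h₃ h₄ X⟩⟩⟩
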